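/- **Setting.** For an integrable $g\ge 0$ on $\mathbb R^3\times\mathbb R^3$ write $\rho_g(x)=\int g(x,v)\,dv$ and $E_g(x)=\int_{\mathbb R^3}\frac{x-y}{|x-y|^3}\rho_g(y)\,dy$. Let $f_0\in L^\infty$ be a compactly supported probability density on $\mathbb R^3\times\mathbb R^3$ and $(\xi_0,\eta_0)\in\mathbb R^3\times\mathbb R^3$ with $|x-\xi_0|\ge\delta_0>0$ for all $(x,v)\in\operatorname{supp} f_0$. A solution on $[0,T]$ of the Vlasov–Poisson system with one unit point charge, with this initial datum, is a pair $(\xi,f)$ with $\xi\in C^2([0,T];\mathbb R^3)$, $f$ and $\rho_f$ in $L^\infty([0,T],L^1\cap L^\infty)$, $\dot\xi=\eta$, $\dot\eta(t)=E_{f(t)}(\xi(t))$, $(\xi,\eta)(0)=(\xi_0,\eta_0)$, together with an invertible flow $(X,V)(\cdot,\cdot,\tau,t):(\mathbb R^3\setminus\{\xi(\tau)\})\times\mathbb R^3\to(\mathbb R^3\setminus\{\xi(t)\})\times\mathbb R^3$, $\tau,t\in[0,T]$, such that $$\dot X=V,\qquad \dot V=E_{f(t)}(X)+\frac{X-\xi(t)}{|X-\xi(t)|^3},\qquad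 (X,V)(x,v,\tau,\tau)=(x,v),$$ $f(X(x,v,0,t),V(x,v,0,t),t)=f_0(x,v)$, and, for some $\delta>0$, $|X(x,v,\tau,t)-\xi(t)|\ge\delta$ for all $\tau,t\in[0,T]$ and $(x,v)\in\operatorname{supp} f(\tau)$ (in particular $\operatorname{supp}f(\tau)$ lies in the domain of the flow). Its energy is $$H=\tfrac12\int|v|^2f_0\,dx\,dv+\tfrac12|\eta_0|^2+\int\frac{\rho_{f_0}(x)}{|x-\xi_0|}\,dx+\tfrac12\iint\frac{\rho_{f_0}(x)\rho_{f_0}(y)}{|x-y|}\,dx\,dy .$$ **Constants.** Given the values of $M=\|f_0\|_{L^\infty}$ and $H$, there is a constant $K>0$, depending only on $M$ and $H$, such that $$\int\frac{1}{|x-x'|^2}\Big(\int_{|v|<R}g(x',v)\,dv\Big)dx'\le K R^{4/3}\qquad\text{for all }x\in\mathbb R^3,\ R>0,$$ for every probability density $g$ with $\|g\|_{L^\infty}\le M$ and $\frac12\int|v|^2g\,dx\,dv\le H$, and such that the following holds. Let $K_1\ge\max(8H,1)$, $K_2\ge16$ and $8K/K_2<1/8$. Then there is a constant $C_2>0$,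 depending only on $M$, $H$, $K_1$, $K_2$, such that for every $T>0$ and every solution on $[0,T]$ with $\|f_0\|_{L^\infty}=M$ and energy $H$ the following is true. **Claim.** Put $h(x,v,t)=\frac12|v-\eta(t)|^2+\frac1{|x-\xi(t)|}+K_1$ and $$Q_T=\sup\{\sqrt h(X(x,v,0,t),V(x,v,0,t),t):\ t\in[0,T],\ (x,v)\in\operatorname{supp} f_0\}.$$ Then $Q_T<\infty$. Let $\Delta T=\frac1{K_2Q_T}$, suppose $\Delta T<T$, and let $n$ be either $\lfloor T/\Delta T\rfloor$ or $\lceil T/\Delta T\rceil$ (the assertion holds for both); put $t_i=i\,\Delta T$ for $0\le i<n$ and $t_n=T$. Let $Q_0=\sup\{\sqrt h(x,v,0):(x,v)\in\operatorname{supp} f_0\}$ and, for $1\le i\le n$, $$Q_i=\sup\{\sqrt h(X(x,v,t_{i-1},t),V(x,v,t_{i-1},t),t):\ t\in(t_{i-1},t_i),\ (x,v)\in\operatorname{supp} f(t_{i-1})\}.$$ Then $$Q_i\le Q_{i-1}+C_2\,Q_T\,\Delta T,\qquad i=1,\dots,n .$$ -/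

import Mathlib

open MeasureTheory Set
open scoped ENNReal NNReal

noncomputable section

namespace PlasmaCharge

/-- Physical space with its Euclidean norm. -/
abbrev Space : Type := EuclideanSpace ℝ (Fin 3)

/-- Phase space: pairs (position, velocity). -/
abbrev Phase : Type := Space × Space

/-- The Coulomb kernel `x / |x|³`. -/
def coulomb (x : Space) : Space := (‖x‖ ^ 3)⁻¹ • x

/-- Spatial density of a phase-space density. -/
def rho (g : Phase → ℝ) (x : Space) : ℝ := ∫ v, g (x, v)

/-- Spatial density of the particles of speed `< R`. -/
def rhoLow (g : Phase → ℝ) (R : ℝ) (x : Space) : ℝ := ∫ v in Metric.ball (0 : Space) R, g (x, v)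

/-- Electric field generated by a phase-space density: `∫ (x - y) / |x - y|³ ρ(y) dy`. -/
def field (g : Phase → ℝ) (x : Space) : Space := ∫ y, rho g y • coulomb (x - y)

/-- Kinetic energy of the plasma. -/
def kinetic (g : Phase → ℝ) : ℝ := (1 / 2) * ∫ p : Phase, ‖p.2‖ ^ 2 * g p

/-- Total energy of a plasma with density `g` and of a unit point charge at `ξ` with velocity `η`. -/
def totalEnergy (g : Phase → ℝ) (ξ η : Space) : ℝ :=
  kinetic g + (1 / 2) * ‖η‖ ^ 2 + (∫ x, rho g x / ‖x - ξ‖)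
    + (1 / 2) * ∫ q : Space × Space, rho g q.1 * rho g q.2 / ‖q.1 - q.2‖

/-- Probability densities on phase space. -/
structure IsProbDensity (g : Phase → ℝ) : Prop where
  nonneg : ∀ p, 0 ≤ g p
  integrable : Integrable g
  integral_eq_one : ∫ p, g p = 1

/-- `K` is an admissible constant in the static estimate `∫ ρ_R(x') / |x - x'|² dx' ≤ K R^{4/3}`,
for all probability densities with sup norm at most `M` and kinetic energy at most `H`. -/
def IsFieldConstant (M H K : ℝ) : Prop :=
  ∀ g : Phase → ℝ, IsProbDensity g → eLpNorm g ⊤ volume ≤ ENNReal.ofReal M →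
    Integrable (fun p : Phase => ‖p.2‖ ^ 2 * g p) → kinetic g ≤ H →
    ∀ R : ℝ, 0 < R → ∀ x : Space,
      ∫⁻ x', ENNReal.ofReal (rhoLow g R x' / ‖x - x'‖ ^ 2) ≤ ENNReal.ofReal (K * R ^ (4 / 3 : ℝ))

/-- Admissible initial data: a bounded, compactly supported probability density whose support
is at positive distance from the charge. -/
structure IsInitialDatum (f₀ : Phase → ℝ) (ξ₀ : Space) : Prop where
  density : IsProbDensity f₀
  bounded : MemLp f₀ ⊤ volume
  compact : HasCompactSupport f₀
  away : ∃ δ₀ : ℝ, 0 < δ₀ ∧ ∀ p ∈ tsupport f₀, δ₀ ≤ ‖p.1 - ξ₀‖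

/-- Phase points whose position differs from that of the charge. -/
def phaseDomain (ξ : Space) : Set Phase := {p | p.1 ≠ ξ}

/-- `(ξ, f)` is a solution on `[0,T]` of the Vlasov-Poisson system with one unit point charge,
with charge velocity `η` and characteristic flow `Φ τ t (x, v) = (X, V)(x, v, τ, t)`. -/
structure IsSolution (T : ℝ) (f₀ : Phase → ℝ) (ξ₀ η₀ : Space) (ξ η : ℝ → Space)
    (f : ℝ → Phase → ℝ) (Φ : ℝ → ℝ → Phase → Phase) : Prop where
  /-- joint measurability of `f` on `[0,T] × ℝ³ × ℝ³` -/
  measurable : AEStronglyMeasurable (fun q : ℝ × Phase => f q.1 q.2)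
    ((volume.restrict (Icc 0 T)).prod volume)
  /-- `f` and `ρ` belong to `L^∞([0,T], L¹ ∩ L^∞)` -/
  bounded : ∃ B : ℝ≥0, ∀ᵐ t ∂(volume.restrict (Icc 0 T)),
    eLpNorm (f t) 1 volume ≤ B ∧ eLpNorm (f t) ⊤ volume ≤ B ∧
    eLpNorm (rho (f t)) 1 volume ≤ B ∧ eLpNorm (rho (f t)) ⊤ volume ≤ B
  /-- motion of the charge -/
  charge_C2 : ContDiffOn ℝ 2 ξ (Icc 0 T)
  charge_pos : ∀ t ∈ Icc 0 T, HasDerivWithinAt ξ (η t) (Icc 0 T) t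
  charge_vel : ∀ t ∈ Icc 0 T, HasDerivWithinAt η (field (f t) (ξ t)) (Icc 0 T) t
  charge_init : ξ 0 = ξ₀ ∧ η 0 = η₀
  /-- `Φ` is an invertible flow away from the charge -/
  flow_bij : ∀ τ ∈ Icc 0 T, ∀ t ∈ Icc 0 T,
    BijOn (Φ τ t) (phaseDomain (ξ τ)) (phaseDomain (ξ t))
  flow_self : ∀ τ ∈ Icc 0 T, ∀ p ∈ phaseDomain (ξ τ), Φ τ τ p = p
  flow_comp : ∀ τ ∈ Icc 0 T, ∀ s ∈ Icc 0 T, ∀ t ∈ Icc 0 T, ∀ p ∈ phaseDomain (ξ τ),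
    Φ s t (Φ τ s p) = Φ τ t p
  /-- the characteristic equations -/
  flow_pos : ∀ τ ∈ Icc 0 T, ∀ p ∈ phaseDomain (ξ τ), ∀ t ∈ Icc 0 T,
    HasDerivWithinAt (fun s => (Φ τ s p).1) (Φ τ t p).2 (Icc 0 T) t
  flow_vel : ∀ τ ∈ Icc 0 T, ∀ p ∈ phaseDomain (ξ τ), ∀ t ∈ Icc 0 T,
    HasDerivWithinAt (fun s => (Φ τ s p).2)
      (field (f t) (Φ τ t p).1 + coulomb ((Φ τ t p).1 - ξ t)) (Icc 0 T) t
  /-- the density is transported by the flow -/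
  transport : ∀ t ∈ Icc 0 T, ∀ p ∈ phaseDomain (ξ 0), f t (Φ 0 t p) = f₀ p
  /-- the support of the plasma lies in the domain of the flow and stays away from the charge -/
  supp_subset : ∀ τ ∈ Icc 0 T, tsupport (f τ) ⊆ phaseDomain (ξ τ)
  lower : ∃ δ : ℝ, 0 < δ ∧ ∀ τ ∈ Icc 0 T, ∀ t ∈ Icc 0 T, ∀ p ∈ tsupport (f τ),
    δ ≤ ‖(Φ τ t p).1 - ξ t‖

/-- Energy of a plasma particle in the frame of the charge. -/
def particleEnergy (K₁ : ℝ) (ξ η : ℝ → Space) (p : Phase) (t : ℝ) : ℝ :=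
  ‖p.2 - η t‖ ^ 2 / 2 + 1 / ‖p.1 - ξ t‖ + K₁

/-- The values of `√h`, at the times `t ∈ I`, on the trajectories issued at time `τ` from `S`. -/
def energyValues (K₁ : ℝ) (ξ η : ℝ → Space) (Φ : ℝ → ℝ → Phase → Phase)
    (τ : ℝ) (S : Set Phase) (I : Set ℝ) : Set ℝ :=
  {r | ∃ t ∈ I, ∃ p ∈ S, r = √(particleEnergy K₁ ξ η (Φ τ t p) t)}

/-- `Q_T`: the supremum of `√h` over `[0,T]` and the trajectories issued from `supp f₀`. -/
def maxEnergy (K₁ T : ℝ) (f₀ : Phase → ℝ) (ξ η : ℝ → Space) (Φ : ℝ → ℝ → Phase → Phase) : ℝ :=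
  sSup (energyValues K₁ ξ η Φ 0 (tsupport f₀) (Icc 0 T))

/-- The grid `t_i = i ΔT` for `i < n`, `t_n = T`. -/
def gridTime (T ΔT : ℝ) (n i : ℕ) : ℝ := if i < n then i * ΔT else T

/-- `Q_i`: for `i = 0` the supremum of `√h` at time `0` over `supp f₀`; for `i ≥ 1` the supremum
of `√h` over `(t_{i-1}, t_i)` and the trajectories issued at `t_{i-1}` from `supp f(t_{i-1})`. -/
def stepEnergy (K₁ T ΔT : ℝ) (n : ℕ) (f₀ : Phase → ℝ) (ξ η : ℝ → Space) (f : ℝ → Phase → ℝ)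
    (Φ : ℝ → ℝ → Phase → Phase) : ℕ → ℝ
  | 0 => sSup ((fun p => √(particleEnergy K₁ ξ η p 0)) '' tsupport f₀)
  | i + 1 => sSup (energyValues K₁ ξ η Φ (gridTime T ΔT n i) (tsupport (f (gridTime T ΔT n i)))
      (Ioo (gridTime T ΔT n i) (gridTime T ΔT n (i + 1))))

end PlasmaCharge

end

open PlasmaCharge

open MeasureTheory Set
open scoped ENNReal NNReal

noncomputable section

namespace PlasmaCharge

/-! ### Radial integrals in physical space -/

/-! Because `ΔT = 1 / (K₂ Q)` with `Q = Q_T`, the allowed increment `C₂ Q ΔT` is the constant `C₂ /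
K₂`. It therefore suffices that `√h` grows along every characteristic by at most a constant
depending on `M`, `H`, `K₁` during any time at most `1 / (8 Q)`: this is `exists_level_le_add`.
Since `h` contains the potential of the charge, the singular force cancels in its derivative and
`|d√h/dt| ≤ |E(X)| + |E(ξ)|` (`hasDerivWithinAt_level`, `abs_deriv_level_le`). The pointwise bound
`|E| = O(Q^{4/3})` only gives a growth `O(Q^{1/3})`; the gain comes from averaging the field in time
along a path.

Let `x` be a path whose velocity stays within `O(Q^{3/4})` of a fixed `V₀`. The plasma splits into
the particles of speed `O(Q^{3/4})`, those of velocity within `O(Q^{3/4})` of `V₀`, those closer to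
`x` than `1/h`, and the rest. By the static estimate (`lintegral_slow_inv_sq_le`) the first two
classes produce a field `O((Q^{3/4})^{4/3}) = O(Q)`, and by the bound on the density so does the
third (`lintegral_near_inv_sq_le`); over a time `1 / (8 Q)` these contributions are bounded. A
particle of the rest has a large and almost constant velocity relative to `x`, except during its own
encounter with the charge, of duration `O(1/h)`. The distance cutoff `1/h` then bounds the time
integral of its kernel by `O(h)` (`lintegral_rest_le`), and the sum over all particles is bounded by
the energy (`lintegral_absField_le`).

The encounter is controlled by repulsion: near the charge `|X - ξ|²` is convex in time with second
derivative of order at least `h`, so `|X - ξ| ≥ c √h |t - m|` (`exists_nearest_time`). Outside the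
window `|t - m| ≤ 1/h` the force of the charge has a bounded time integral, and the velocity is
almost constant (`norm_vel_sub_le_of_side`). For a fast particle taken as the path `x`, where `√h ≥
Q^{3/4}`, the window contributes only `O(Q^{4/3} / Q^{3/2})` (`lintegral_absField_self_le`).

The static estimate is needed at every time, hence a density at most `M` and a kinetic energy at
most `H` at every time. The definition of a solution states neither. The force is log-Lipschitz, so
the flow is a uniform limit of volume-preserving symplectic Euler schemes and transports the
Lebesgue measure (`IsForce.map_restrict`); thus `f(t)` is the image of `f₀`
(`IsSolution.map_labelFlow`). The energy inequality follows by regularizing the pair interaction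
(`CharFlow.energy_le`).

Writing `Q = w ^ 12` turns `Q^{1/3}`, `Q^{3/4}`, `Q^{4/3}`, `Q^{3/2}` into `w ^ 4`, `w ^ 9`, `w ^
16`, `w ^ 18`. -/

/-- The area of the unit sphere of physical space. -/
def sphereArea : ℝ := 3 * volume.real (Metric.ball (0 : Space) 1)

lemma sphereArea_nonneg : 0 ≤ sphereArea := by unfold sphereArea; positivity

lemma lintegral_radial {φ : ℝ → ℝ} (h0 : ∀ y, 0 ≤ φ y)
    (hφ : IntegrableOn (fun y => y ^ 2 * φ y) (Ioi 0)) :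
    ∫⁻ z : Space, ENNReal.ofReal (φ ‖z‖)
      = ENNReal.ofReal (sphereArea * ∫ y in Ioi (0 : ℝ), y ^ 2 * φ y) := by
  have hd : Module.finrank ℝ Space = 3 := by simp
  have hi : Integrable (fun z : Space => φ ‖z‖) := by
    rw [integrable_fun_norm_addHaar volume (f := φ), hd]
    simpa using hφ
  rw [← ofReal_integral_eq_lintegral_ofReal hi (.of_forall fun z => h0 _),
    integral_fun_norm_addHaar volume φ, hd]
  congr 1
  simp [sphereArea, mul_assoc]

lemma lintegral_radial_sub {φ : ℝ → ℝ} (h0 : ∀ y, 0 ≤ φ y)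
    (hφ : IntegrableOn (fun y => y ^ 2 * φ y) (Ioi 0)) (x : Space) :
    ∫⁻ z : Space, ENNReal.ofReal (φ ‖x - z‖)
      = ENNReal.ofReal (sphereArea * ∫ y in Ioi (0 : ℝ), y ^ 2 * φ y) := by
  rw [← lintegral_radial h0 hφ]
  exact lintegral_sub_left_eq_self (fun z => ENNReal.ofReal (φ ‖z‖)) x

lemma volume_ball_le (x : Space) {r : ℝ} (hr : 0 ≤ r) :
    volume (Metric.ball x r) ≤ ENNReal.ofReal (sphereArea * r ^ 3) := by
  have hd : Module.finrank ℝ Space = 3 := by simp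
  rw [Measure.addHaar_ball volume x hr, hd, mul_comm sphereArea,
    ENNReal.ofReal_mul (by positivity)]
  gcongr
  rw [← ENNReal.ofReal_toReal (a := volume (Metric.ball (0 : Space) 1)) measure_ball_lt_top.ne]
  apply ENNReal.ofReal_le_ofReal
  have : 0 ≤ volume.real (Metric.ball (0 : Space) 1) := by positivity
  unfold sphereArea
  change volume.real _ ≤ _
  linarith

lemma lintegral_ball_inv_sq_le (x : Space) {r : ℝ} (hr : 0 ≤ r) :
    ∫⁻ z in Metric.ball x r, ENNReal.ofReal ((‖x - z‖ ^ 2)⁻¹)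
      ≤ ENNReal.ofReal (sphereArea * r) := by
  set φ : ℝ → ℝ := (Iio r).indicator fun y => (y ^ 2)⁻¹
  have hφ : EqOn (fun y => y ^ 2 * φ y) ((Iio r).indicator fun _ => 1) (Ioi 0) := by
    intro y hy
    by_cases h : y < r
    · simp [φ, h, (ne_of_gt hy : y ≠ 0)]
    · simp [φ, h]
  have hi : IntegrableOn (fun y => y ^ 2 * φ y) (Ioi 0) := by
    refine IntegrableOn.congr_fun ?_ hφ.symm measurableSet_Ioi
    rw [IntegrableOn, integrable_indicator_iff measurableSet_Iio, IntegrableOn,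
      Measure.restrict_restrict measurableSet_Iio, Iio_inter_Ioi]
    exact integrableOn_const (by simp)
  have := lintegral_radial_sub (φ := φ)
    (fun y => indicator_nonneg (fun _ _ => by positivity) _) hi x
  rw [setIntegral_congr_fun measurableSet_Ioi hφ, integral_indicator measurableSet_Iio,
    Measure.restrict_restrict measurableSet_Iio, Iio_inter_Ioi] at this
  simp only [integral_const, MeasurableSet.univ, measureReal_restrict_apply, univ_inter,
    Real.volume_real_Ioo_of_le hr, sub_zero, smul_eq_mul, mul_one] at this
  rw [← this, ← lintegral_indicator measurableSet_ball]
  apply lintegral_mono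
  intro z
  by_cases h : z ∈ Metric.ball x r
  · have h' : ‖x - z‖ < r := by rwa [Metric.mem_ball, dist_comm, dist_eq_norm] at h
    simp [φ, h, h']
  · simp [h]

/-- The power five is the inverse square kernel times the volume, of order `‖x - z‖ ^ (-3)`, of the
velocity ball that `lintegral_restricted_velocity_le` allows at `z`. -/
lemma lintegral_compl_ball_inv_pow_five_le (x : Space) {d : ℝ} (hd : 0 < d) :
    ∫⁻ z in (Metric.ball x d)ᶜ, ENNReal.ofReal ((‖x - z‖ ^ 5)⁻¹)
      ≤ ENNReal.ofReal (sphereArea * (d ^ 2)⁻¹) := by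
  set φ : ℝ → ℝ := (Ici d).indicator fun y => (y ^ 5)⁻¹
  have hφ : EqOn (fun y => y ^ 2 * φ y) ((Ici d).indicator fun y => y ^ (-3 : ℝ)) (Ioi 0) := by
    intro y hy
    by_cases h : d ≤ y
    · simp only [mem_Ici, h, indicator_of_mem, φ]
      have : y ≠ 0 := (ne_of_gt hy)
      rw [show (-3 : ℝ) = -((3 : ℕ) : ℝ) by norm_num, Real.rpow_neg (le_of_lt hy),
        Real.rpow_natCast]
      field_simp
    · simp [φ, h]
  have hI : Ici d ∩ Ioi 0 = Ici d := inter_eq_left.2 fun y hy => lt_of_lt_of_le hd hy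
  have hi : IntegrableOn (fun y => y ^ 2 * φ y) (Ioi 0) := by
    refine IntegrableOn.congr_fun ?_ hφ.symm measurableSet_Ioi
    rw [IntegrableOn, integrable_indicator_iff measurableSet_Ici, IntegrableOn,
      Measure.restrict_restrict measurableSet_Ici, hI]
    have := integrableOn_Ioi_rpow_of_lt (a := -3) (by norm_num) hd
    exact (integrableOn_Ici_iff_integrableOn_Ioi).2 this
  have := lintegral_radial_sub (φ := φ)
    (fun y => indicator_nonneg (fun y (hy : d ≤ y) => by
      have : 0 ≤ y := hd.le.trans hy
      positivity) _) hi x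
  rw [setIntegral_congr_fun measurableSet_Ioi hφ, integral_indicator measurableSet_Ici,
    Measure.restrict_restrict measurableSet_Ici, hI, integral_Ici_eq_integral_Ioi,
    integral_Ioi_rpow_of_lt (by norm_num) hd] at this
  calc _ ≤ ∫⁻ z : Space, ENNReal.ofReal (φ ‖x - z‖) := ?_
    _ ≤ _ := ?_
  · rw [← lintegral_indicator measurableSet_ball.compl]
    apply lintegral_mono
    intro z
    by_cases h : z ∈ (Metric.ball x d)ᶜ
    · have h' : d ≤ ‖x - z‖ := by
        rwa [mem_compl_iff, Metric.mem_ball, dist_comm, dist_eq_norm, not_lt] at h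
      simp only [indicator_of_mem h, φ]
      rw [indicator_of_mem (by exact h')]
    · simp only [indicator_of_notMem h]; exact zero_le
  · rw [this]
    apply ENNReal.ofReal_le_ofReal
    apply mul_le_mul_of_nonneg_left _ sphereArea_nonneg
    rw [show (-3 : ℝ) + 1 = -((2 : ℕ) : ℝ) by norm_num, Real.rpow_neg hd.le, Real.rpow_natCast]
    have : 0 ≤ (d ^ 2)⁻¹ := by positivity
    rw [neg_div_neg_eq]
    push_cast
    linarith

/-- The critical power in dimension three. The difference of two Coulomb kernels decays like the
inverse cube, so this logarithm is the one in the log-Lipschitz modulus of the field. -/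
lemma lintegral_annulus_inv_cube_le (x : Space) {d : ℝ} (hd : 0 < d) (hd1 : d ≤ 1) :
    ∫⁻ z in Metric.ball x 1 \ Metric.ball x d, ENNReal.ofReal ((‖x - z‖ ^ 3)⁻¹)
      ≤ ENNReal.ofReal (sphereArea * (- Real.log d)) := by
  set φ : ℝ → ℝ := (Ico d 1).indicator fun y => (y ^ 3)⁻¹
  have hφ : EqOn (fun y => y ^ 2 * φ y) ((Ico d 1).indicator fun y => y⁻¹) (Ioi 0) := by
    intro y hy
    by_cases h : y ∈ Ico d 1
    · simp only [h, indicator_of_mem, φ]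
      have : y ≠ 0 := (ne_of_gt hy)
      field_simp
    · simp [φ, h]
  have hI : Ico d 1 ∩ Ioi 0 = Ico d 1 := inter_eq_left.2 fun y hy => lt_of_lt_of_le hd hy.1
  have h0 : (0 : ℝ) ∉ uIcc d 1 := by
    rw [uIcc_of_le hd1]; intro h; exact absurd h.1 (not_le.2 hd)
  have hi : IntegrableOn (fun y => y ^ 2 * φ y) (Ioi 0) := by
    refine IntegrableOn.congr_fun ?_ hφ.symm measurableSet_Ioi
    rw [IntegrableOn, integrable_indicator_iff measurableSet_Ico, IntegrableOn,
      Measure.restrict_restrict measurableSet_Ico, hI]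
    have : IntervalIntegrable (fun y : ℝ => y⁻¹) volume d 1 :=
      intervalIntegral.intervalIntegrable_inv (fun y hy h => h0 (h ▸ hy)) continuousOn_id
    exact (intervalIntegrable_iff_integrableOn_Ico_of_le hd1).1 this
  have := lintegral_radial_sub (φ := φ)
    (fun y => indicator_nonneg (fun y (hy : y ∈ Ico d 1) => by
      have : 0 ≤ y := hd.le.trans hy.1
      positivity) _) hi x
  rw [setIntegral_congr_fun measurableSet_Ioi hφ, integral_indicator measurableSet_Ico,
    Measure.restrict_restrict measurableSet_Ico, hI, integral_Ico_eq_integral_Ioc,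
    ← intervalIntegral.integral_of_le hd1, integral_inv h0, one_div, Real.log_inv] at this
  rw [← this, ← lintegral_indicator (measurableSet_ball.diff measurableSet_ball)]
  apply lintegral_mono
  intro z
  by_cases h : z ∈ Metric.ball x 1 \ Metric.ball x d
  · have h' : ‖x - z‖ ∈ Ico d 1 := by
      rw [mem_sdiff, Metric.mem_ball, Metric.mem_ball, dist_comm, dist_eq_norm, not_lt] at h
      exact ⟨h.2, h.1⟩
    simp only [indicator_of_mem h, φ]
    rw [indicator_of_mem h']
  · simp only [indicator_of_notMem h]; exact zero_le

/-! ### Static estimate of the Coulomb field of slow particles -/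

/-- The bound for the inverse-square field, in a velocity ball, of a density bounded by one whose
velocities are restricted by the position. -/
lemma lintegral_restricted_velocity_le {s : ℝ} (hs : 0 < s) (x c : Space) :
    ∫⁻ p in {p : Phase | ‖p.2 - c‖ < s ^ 3 ∧ ‖p.2‖ * (s ^ 2 * ‖x - p.1‖) < 1},
        ENNReal.ofReal ((‖x - p.1‖ ^ 2)⁻¹)
      ≤ ENNReal.ofReal (2 * sphereArea ^ 2 * s ^ 4) := by
  have hA := sphereArea_nonneg
  set B : Set Phase := {p | ‖p.2 - c‖ < s ^ 3 ∧ ‖p.2‖ * (s ^ 2 * ‖x - p.1‖) < 1} with hB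
  have hBm : MeasurableSet B := by
    have h1 : MeasurableSet {p : Phase | ‖p.2 - c‖ < s ^ 3} :=
      measurableSet_lt (by fun_prop) (by fun_prop)
    have h2 : MeasurableSet {p : Phase | ‖p.2‖ * (s ^ 2 * ‖x - p.1‖) < 1} :=
      measurableSet_lt (by fun_prop) (by fun_prop)
    exact h1.inter h2
  have hslice : ∀ y : Space, ∫⁻ w, B.indicator
      (fun p : Phase => ENNReal.ofReal ((‖x - p.1‖ ^ 2)⁻¹)) (y, w)
      = ENNReal.ofReal ((‖x - y‖ ^ 2)⁻¹) * volume {w : Space | (y, w) ∈ B} := by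
    intro y
    have hm : MeasurableSet {w : Space | (y, w) ∈ B} := measurable_prodMk_left hBm
    rw [← lintegral_indicator_const hm]
    rfl
  rw [← lintegral_indicator hBm, Measure.volume_eq_prod, lintegral_prod]
  swap
  · refine (Measurable.indicator ?_ hBm).aemeasurable
    fun_prop
  simp_rw [hslice]
  -- At this distance the two bounds on the admissible velocities, the balls of radius `s ^ 3` and
  -- `(s ^ 2 * d)⁻¹`, have equal size.
  set d : ℝ := (s ^ 5)⁻¹ with hd
  have hdpos : 0 < d := by positivity
  have hnear : ∫⁻ y in Metric.ball x d,
      ENNReal.ofReal ((‖x - y‖ ^ 2)⁻¹) * volume {w : Space | (y, w) ∈ B}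
      ≤ ENNReal.ofReal (sphereArea ^ 2 * s ^ 4) := by
    calc _ ≤ ∫⁻ y in Metric.ball x d,
          ENNReal.ofReal ((‖x - y‖ ^ 2)⁻¹) * ENNReal.ofReal (sphereArea * (s ^ 3) ^ 3) := by
          refine lintegral_mono fun y => ?_
          gcongr
          refine le_trans (measure_mono ?_) (volume_ball_le c (by positivity))
          intro w hw
          rw [Metric.mem_ball, dist_eq_norm]
          exact hw.1
      _ ≤ ENNReal.ofReal (sphereArea * d) * ENNReal.ofReal (sphereArea * (s ^ 3) ^ 3) := by
          rw [lintegral_mul_const _ (by fun_prop)]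
          gcongr
          exact lintegral_ball_inv_sq_le x hdpos.le
      _ = _ := by
          rw [← ENNReal.ofReal_mul (by positivity), hd]
          congr 1
          field_simp
  have hfar : ∫⁻ y in (Metric.ball x d)ᶜ,
      ENNReal.ofReal ((‖x - y‖ ^ 2)⁻¹) * volume {w : Space | (y, w) ∈ B}
      ≤ ENNReal.ofReal (sphereArea ^ 2 * s ^ 4) := by
    calc _ ≤ ∫⁻ y in (Metric.ball x d)ᶜ,
          ENNReal.ofReal ((‖x - y‖ ^ 5)⁻¹) * ENNReal.ofReal (sphereArea * (s ^ 6)⁻¹) := by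
          refine setLIntegral_mono (by fun_prop) fun y hy => ?_
          have hy' : d ≤ ‖x - y‖ := by
            rwa [mem_compl_iff, Metric.mem_ball, dist_comm, dist_eq_norm, not_lt] at hy
          have hz : 0 < ‖x - y‖ := hdpos.trans_le hy'
          calc _ ≤ ENNReal.ofReal ((‖x - y‖ ^ 2)⁻¹) *
              ENNReal.ofReal (sphereArea * ((s ^ 2 * ‖x - y‖)⁻¹) ^ 3) := by
                gcongr
                refine le_trans (measure_mono ?_) (volume_ball_le 0 (by positivity))
                intro w hw
                rw [Metric.mem_ball, dist_zero_right, ← one_div, lt_div_iff₀ (by positivity)]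
                exact hw.2
            _ = _ := by
                rw [← ENNReal.ofReal_mul (by positivity), ← ENNReal.ofReal_mul (by positivity)]
                congr 1
                field_simp
      _ ≤ ENNReal.ofReal (sphereArea * (d ^ 2)⁻¹) * ENNReal.ofReal (sphereArea * (s ^ 6)⁻¹) := by
          rw [lintegral_mul_const _ (by fun_prop)]
          gcongr
          exact lintegral_compl_ball_inv_pow_five_le x hdpos
      _ = _ := by
          rw [← ENNReal.ofReal_mul (by positivity), hd]
          congr 1
          field_simp
  rw [← lintegral_add_compl _ (measurableSet_ball (x := x) (ε := d))]
  refine (add_le_add hnear hfar).trans_eq ?_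
  rw [← ENNReal.ofReal_add (by positivity) (by positivity)]
  congr 1
  ring

/-- The inverse-square field of the particles with velocity in a ball of radius `s³`. -/
lemma lintegral_slow_inv_sq_le {ν : Measure Phase} {M : ℝ≥0} (hν : ν ≤ M • volume) {E : ℝ}
    (hE0 : 0 ≤ E) (hE : ∫⁻ p, ENNReal.ofReal (‖p.2‖ ^ 2) ∂ν ≤ ENNReal.ofReal E)
    {s : ℝ} (hs : 0 < s) (x c : Space) :
    ∫⁻ p in {p : Phase | ‖p.2 - c‖ < s ^ 3}, ENNReal.ofReal ((‖x - p.1‖ ^ 2)⁻¹) ∂ν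
      ≤ ENNReal.ofReal ((E + M * (2 * sphereArea ^ 2)) * s ^ 4) := by
  have hA := sphereArea_nonneg
  set B : Set Phase := {p | ‖p.2 - c‖ < s ^ 3 ∧ ‖p.2‖ * (s ^ 2 * ‖x - p.1‖) < 1} with hB
  have hBm : MeasurableSet B := by
    have h1 : MeasurableSet {p : Phase | ‖p.2 - c‖ < s ^ 3} :=
      measurableSet_lt (by fun_prop) (by fun_prop)
    have h2 : MeasurableSet {p : Phase | ‖p.2‖ * (s ^ 2 * ‖x - p.1‖) < 1} :=
      measurableSet_lt (by fun_prop) (by fun_prop)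
    exact h1.inter h2
  have hSm : MeasurableSet {p : Phase | ‖p.2 - c‖ < s ^ 3} :=
    measurableSet_lt (by fun_prop) (by fun_prop)
  -- Off `B` the kernel is at most `s ^ 4` times the squared speed, which the kinetic energy
  -- controls. On `B` the density bound is used instead. The centre `c` is arbitrary although the
  -- energy is measured from velocity zero.
  have hpt : ∀ p ∈ {p : Phase | ‖p.2 - c‖ < s ^ 3}, ENNReal.ofReal ((‖x - p.1‖ ^ 2)⁻¹)
      ≤ ENNReal.ofReal (s ^ 4) * ENNReal.ofReal (‖p.2‖ ^ 2)
        + B.indicator (fun p : Phase => ENNReal.ofReal ((‖x - p.1‖ ^ 2)⁻¹)) p := by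
    intro p hp
    by_cases h : p ∈ B
    · rw [indicator_of_mem h]; exact le_add_self
    · rw [indicator_of_notMem h, add_zero, ← ENNReal.ofReal_mul (by positivity)]
      apply ENNReal.ofReal_le_ofReal
      have h1 : 1 ≤ ‖p.2‖ * (s ^ 2 * ‖x - p.1‖) := by
        by_contra hc
        exact h ⟨hp, not_le.1 hc⟩
      rcases (norm_nonneg (x - p.1)).eq_or_lt with hz | hz
      · rw [← hz]; norm_num; positivity
      · rw [← one_div, div_le_iff₀ (by positivity)]
        nlinarith [mul_self_le_mul_self zero_le_one h1]
  calc _ ≤ ∫⁻ p in {p : Phase | ‖p.2 - c‖ < s ^ 3},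
        (ENNReal.ofReal (s ^ 4) * ENNReal.ofReal (‖p.2‖ ^ 2)
        + B.indicator (fun p : Phase => ENNReal.ofReal ((‖x - p.1‖ ^ 2)⁻¹)) p) ∂ν :=
        setLIntegral_mono' hSm hpt
    _ ≤ ∫⁻ p, (ENNReal.ofReal (s ^ 4) * ENNReal.ofReal (‖p.2‖ ^ 2)
        + B.indicator (fun p : Phase => ENNReal.ofReal ((‖x - p.1‖ ^ 2)⁻¹)) p) ∂ν :=
        setLIntegral_le_lintegral _ _
    _ ≤ ENNReal.ofReal (s ^ 4) * ENNReal.ofReal E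
        + M * ENNReal.ofReal (2 * sphereArea ^ 2 * s ^ 4) := by
        rw [lintegral_add_left (by fun_prop), lintegral_const_mul _ (by fun_prop)]
        gcongr
        calc _ ≤ ∫⁻ p, B.indicator (fun p : Phase => ENNReal.ofReal ((‖x - p.1‖ ^ 2)⁻¹)) p
              ∂(M • volume) := lintegral_mono' hν le_rfl
          _ = M * ∫⁻ p in B, ENNReal.ofReal ((‖x - p.1‖ ^ 2)⁻¹) := by
              rw [lintegral_smul_measure, lintegral_indicator hBm]; rfl
          _ ≤ _ := by
              gcongr
              exact lintegral_restricted_velocity_le hs x c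
    _ = _ := by
        rw [← ENNReal.ofReal_coe_nnreal, ← ENNReal.ofReal_mul (by positivity),
          ← ENNReal.ofReal_mul (by positivity), ← ENNReal.ofReal_add (by positivity) (by positivity)]
        congr 1
        ring

lemma withDensity_ofReal_le {α : Type*} [MeasurableSpace α] {ν : Measure α} {g : α → ℝ}
    (h0 : ∀ p, 0 ≤ g p) {M : ℝ} (hM : eLpNorm g ⊤ ν ≤ ENNReal.ofReal M) :
    ν.withDensity (fun p => ENNReal.ofReal (g p)) ≤ M.toNNReal • ν := by
  change _ ≤ (M.toNNReal : ℝ≥0∞) • ν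
  rw [← withDensity_const]
  apply withDensity_mono
  have := ae_le_eLpNormEssSup (f := g) (μ := ν)
  rw [← eLpNorm_exponent_top] at this
  filter_upwards [this] with p hp
  have h2 := hp.trans hM
  rwa [Real.enorm_eq_ofReal (h0 p)] at h2

lemma exists_isFieldConstant (M H : ℝ) : ∃ K : ℝ, 0 < K ∧ IsFieldConstant M H K := by
  have hA := sphereArea_nonneg
  -- The last summand only makes the constant positive.
  refine ⟨2 * |H| + M.toNNReal * (2 * sphereArea ^ 2) + 1, by positivity, ?_⟩
  intro g hg hM hintg hH R hR x
  set ν : Measure Phase := volume.withDensity fun p => ENNReal.ofReal (g p) with hν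
  have hgm : AEMeasurable (fun p => ENNReal.ofReal (g p)) volume :=
    hg.integrable.aestronglyMeasurable.aemeasurable.ennreal_ofReal
  have hle : ν ≤ M.toNNReal • volume := withDensity_ofReal_le hg.nonneg hM
  have hE : ∫⁻ p, ENNReal.ofReal (‖p.2‖ ^ 2) ∂ν ≤ ENNReal.ofReal (2 * |H|) := by
    rw [hν, lintegral_withDensity_eq_lintegral_mul₀ hgm (by fun_prop)]
    simp only [Pi.mul_apply, ← ENNReal.ofReal_mul (hg.nonneg _)]
    rw [← ofReal_integral_eq_lintegral_ofReal]
    · apply ENNReal.ofReal_le_ofReal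
      have : ∫ p : Phase, g p * ‖p.2‖ ^ 2 = ∫ p : Phase, ‖p.2‖ ^ 2 * g p := by simp_rw [mul_comm]
      rw [this]
      have h := hH.trans (le_abs_self H)
      unfold kinetic at h
      linarith
    · simpa only [mul_comm] using hintg
    · exact .of_forall fun p => mul_nonneg (hg.nonneg p) (by positivity)
  set s : ℝ := R ^ (1 / 3 : ℝ) with hs
  have hs0 : 0 < s := by positivity
  have hs3 : s ^ 3 = R := by
    rw [hs, ← Real.rpow_natCast, ← Real.rpow_mul hR.le]; norm_num
  have hs4 : s ^ 4 = R ^ (4 / 3 : ℝ) := by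
    rw [hs, ← Real.rpow_natCast, ← Real.rpow_mul hR.le]; norm_num
  have hSm : MeasurableSet {p : Phase | ‖p.2 - 0‖ < s ^ 3} :=
    measurableSet_lt (by fun_prop) (by fun_prop)
  have key := lintegral_slow_inv_sq_le hle (by positivity) hE hs0 x 0
  calc _ ≤ ∫⁻ p in {p : Phase | ‖p.2 - 0‖ < s ^ 3}, ENNReal.ofReal ((‖x - p.1‖ ^ 2)⁻¹) ∂ν := ?_
    _ ≤ _ := key
    _ ≤ _ := by
      rw [hs4]
      apply ENNReal.ofReal_le_ofReal
      apply mul_le_mul_of_nonneg_right _ (by positivity)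
      linarith
  rw [hν, restrict_withDensity hSm,
    lintegral_withDensity_eq_lintegral_mul₀ hgm.restrict (by fun_prop),
    ← lintegral_indicator hSm, Measure.volume_eq_prod, lintegral_prod]
  swap
  · refine AEMeasurable.indicator ?_ hSm
    rw [← Measure.volume_eq_prod]
    exact hgm.mul (by fun_prop)
  apply lintegral_mono
  intro y
  calc ENNReal.ofReal (rhoLow g R y / ‖x - y‖ ^ 2)
      = ENNReal.ofReal (rhoLow g R y) * ENNReal.ofReal ((‖x - y‖ ^ 2)⁻¹) := by
        rw [div_eq_mul_inv, ENNReal.ofReal_mul']; positivity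
    _ ≤ (∫⁻ v in Metric.ball (0 : Space) R, ENNReal.ofReal (g (y, v))) *
          ENNReal.ofReal ((‖x - y‖ ^ 2)⁻¹) := by
        gcongr
        refine (ENNReal.ofReal_le_ofReal (le_abs_self _)).trans ?_
        rw [← Real.norm_eq_abs, ofReal_norm, rhoLow]
        refine (enorm_integral_le_lintegral_enorm _).trans_eq ?_
        simp_rw [Real.enorm_eq_ofReal (hg.nonneg _)]
    _ = ∫⁻ v in Metric.ball (0 : Space) R, ENNReal.ofReal (g (y, v)) *
          ENNReal.ofReal ((‖x - y‖ ^ 2)⁻¹) := by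
        rw [lintegral_mul_const' _ _ ENNReal.ofReal_ne_top]
    _ ≤ _ := by
        rw [← lintegral_indicator measurableSet_ball]
        apply lintegral_mono
        intro v
        by_cases hv : v ∈ Metric.ball (0 : Space) R
        · have hv' : (y, v) ∈ {p : Phase | ‖p.2 - 0‖ < s ^ 3} := by
            change ‖v - 0‖ < s ^ 3
            rw [hs3]; simpa using hv
          simp only [indicator_of_mem hv, indicator_of_mem hv']
          rfl
        · rw [indicator_of_notMem hv]; exact zero_le

/-! ### Boundedness and log-Lipschitz continuity of Coulomb fields -/

lemma norm_coulomb (x : Space) : ‖coulomb x‖ = (‖x‖ ^ 2)⁻¹ := by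
  rw [coulomb, norm_smul, norm_inv, norm_pow, norm_norm]
  rcases (norm_nonneg x).eq_or_lt with h | h
  · rw [← h]; norm_num
  · field_simp

lemma measurable_coulomb : Measurable coulomb := by
  unfold coulomb; fun_prop

lemma enorm_coulomb (x : Space) : ‖coulomb x‖ₑ = ENNReal.ofReal ((‖x‖ ^ 2)⁻¹) := by
  rw [← ofReal_norm, norm_coulomb]

/-- The numbers `α` and `β` stand for the norms of `a` and `b`, or for these norms truncated from
below, so one computation serves both `coulomb` and `cutCoulomb`. The constant is `1 + 7`, with `α²
+ αβ + β² ≤ 7β²` from `α ≤ 2β`. -/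
lemma norm_inv_cube_smul_sub_le (a b : Space) (α β : ℝ) (hα : 0 < α) (hβ : 0 < β)
    (hb : ‖b‖ ≤ β) (h : |β - α| ≤ ‖a - b‖) (h2 : α ≤ 2 * β) :
    ‖(α ^ 3)⁻¹ • a - (β ^ 3)⁻¹ • b‖ ≤ 8 * ‖a - b‖ / α ^ 3 := by
  have e : (α ^ 3)⁻¹ • a - (β ^ 3)⁻¹ • b = (α ^ 3)⁻¹ • (a - b) + ((α ^ 3)⁻¹ - (β ^ 3)⁻¹) • b := by
    module
  rw [e]
  refine (norm_add_le _ _).trans ?_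
  rw [norm_smul, norm_smul, Real.norm_eq_abs, Real.norm_eq_abs, abs_of_pos (by positivity)]
  have e2 : (α ^ 3)⁻¹ - (β ^ 3)⁻¹
      = (β - α) * ((α ^ 2 + α * β + β ^ 2) / (α ^ 3 * β ^ 3)) := by
    field_simp
    ring
  have h3 : α ^ 2 + α * β + β ^ 2 ≤ 7 * β ^ 2 := by nlinarith
  rw [e2, abs_mul, abs_of_pos (show 0 < (α ^ 2 + α * β + β ^ 2) / (α ^ 3 * β ^ 3) by positivity)]
  calc _ ≤ (α ^ 3)⁻¹ * ‖a - b‖ + ‖a - b‖ * (7 * β ^ 2 / (α ^ 3 * β ^ 3)) * β := by gcongr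
    _ = _ := by field_simp; ring

lemma norm_coulomb_sub_le {a b : Space} (ha : a ≠ 0) (h : 2 * ‖a - b‖ ≤ ‖a‖) :
    ‖coulomb a - coulomb b‖ ≤ 8 * ‖a - b‖ * (‖a‖ ^ 3)⁻¹ := by
  have ha' : 0 < ‖a‖ := norm_pos_iff.2 ha
  have h1 : ‖a‖ ≤ ‖a - b‖ + ‖b‖ := by simpa using norm_add_le (a - b) b
  have h2 : |‖b‖ - ‖a‖| ≤ ‖a - b‖ := by rw [norm_sub_rev]; exact abs_norm_sub_norm_le b a
  rw [← div_eq_mul_inv]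
  exact norm_inv_cube_smul_sub_le a b ‖a‖ ‖b‖ ha' (by linarith) le_rfl h2 (by linarith)

/-- The Coulomb kernel, cut off near the origin. -/
def cutCoulomb (δ : ℝ) (x : Space) : Space := ((max ‖x‖ δ) ^ 3)⁻¹ • x

lemma cutCoulomb_eq {δ : ℝ} {x : Space} (h : δ ≤ ‖x‖) : cutCoulomb δ x = coulomb x := by
  rw [cutCoulomb, coulomb, max_eq_left h]

lemma norm_cutCoulomb_le {δ : ℝ} (hδ : 0 < δ) (x : Space) : ‖cutCoulomb δ x‖ ≤ (δ ^ 2)⁻¹ := by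
  have hm : 0 < max ‖x‖ δ := lt_max_of_lt_right hδ
  rw [cutCoulomb, norm_smul, Real.norm_eq_abs, abs_of_pos (by positivity)]
  calc _ ≤ ((max ‖x‖ δ) ^ 3)⁻¹ * max ‖x‖ δ := by gcongr; exact le_max_left _ _
    _ = ((max ‖x‖ δ) ^ 2)⁻¹ := by field_simp
    _ ≤ _ := by gcongr; exact le_max_right _ _

lemma norm_cutCoulomb_sub_le {δ : ℝ} (hδ : 0 < δ) (a b : Space) :
    ‖cutCoulomb δ a - cutCoulomb δ b‖ ≤ 8 / δ ^ 3 * ‖a - b‖ := by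
  have key : ∀ a b : Space, ‖a‖ ≤ ‖b‖ →
      ‖cutCoulomb δ a - cutCoulomb δ b‖ ≤ 8 / δ ^ 3 * ‖a - b‖ := by
    intro a b hab
    have hm : 0 < max ‖a‖ δ := lt_max_of_lt_right hδ
    have hm' : 0 < max ‖b‖ δ := lt_max_of_lt_right hδ
    have h1 : max ‖a‖ δ ≤ max ‖b‖ δ := max_le_max_right _ hab
    have h2 : |max ‖b‖ δ - max ‖a‖ δ| ≤ ‖a - b‖ := by
      refine (abs_max_sub_max_le_abs _ _ _).trans ?_
      rw [norm_sub_rev]; exact abs_norm_sub_norm_le b a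
    refine (norm_inv_cube_smul_sub_le a b _ _ hm hm' (le_max_left _ _) h2 (by linarith)).trans ?_
    rw [div_mul_eq_mul_div]
    gcongr
    exact le_max_right _ _
  rcases le_total ‖a‖ ‖b‖ with h | h
  · exact key a b h
  · rw [norm_sub_rev, norm_sub_rev a]; exact key b a h

section BoundedDensity

variable {σ : Measure Space} {B : ℝ≥0}

lemma lintegral_inv_sq_le (hσ : σ ≤ B • volume) (hσ1 : σ univ ≤ B) (x : Space) :
    ∫⁻ z, ENNReal.ofReal ((‖x - z‖ ^ 2)⁻¹) ∂σ ≤ ENNReal.ofReal (B * (sphereArea + 1)) := by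
  have hA := sphereArea_nonneg
  rw [← lintegral_add_compl _ (measurableSet_ball (x := x) (ε := 1))]
  calc _ ≤ (B : ℝ≥0∞) * ENNReal.ofReal (sphereArea * 1) + B := by
        gcongr
        · calc _ ≤ ∫⁻ z in Metric.ball x 1, ENNReal.ofReal ((‖x - z‖ ^ 2)⁻¹) ∂(B • volume) :=
                lintegral_mono' (Measure.restrict_mono le_rfl hσ) le_rfl
            _ = B * ∫⁻ z in Metric.ball x 1, ENNReal.ofReal ((‖x - z‖ ^ 2)⁻¹) := by
                rw [Measure.restrict_smul, lintegral_smul_measure]; rfl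
            _ ≤ _ := by gcongr; exact lintegral_ball_inv_sq_le x zero_le_one
        · calc _ ≤ ∫⁻ z in (Metric.ball x 1)ᶜ, 1 ∂σ := by
                refine setLIntegral_mono measurable_const fun z hz => ?_
                have hz' : 1 ≤ ‖x - z‖ := by
                  rwa [mem_compl_iff, Metric.mem_ball, dist_comm, dist_eq_norm, not_lt] at hz
                rw [← ENNReal.ofReal_one]
                apply ENNReal.ofReal_le_ofReal
                exact inv_le_one_of_one_le₀ (one_le_pow₀ hz')
            _ ≤ σ univ := by
                rw [lintegral_const, one_mul]
                exact (Measure.restrict_apply_univ _).trans_le (measure_mono (subset_univ _))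
            _ ≤ B := hσ1
    _ = _ := by
        rw [← ENNReal.ofReal_coe_nnreal, ← ENNReal.ofReal_mul (by positivity),
          ← ENNReal.ofReal_add (by positivity) (by positivity)]
        congr 1
        ring

/-- The parameter `Λ` replaces `log (1 / ‖x - y‖)`. For each fixed `Λ` the modulus is affine in the
distance, so errors can be iterated linearly and `Λ` can be chosen at the end. -/
lemma lintegral_coulomb_sub_le (hσ : σ ≤ B • volume) (hσ1 : σ univ ≤ B) {Λ : ℝ} (hΛ : 1 ≤ Λ)
    (x y : Space) :
    ∫⁻ z, ‖coulomb (x - z) - coulomb (y - z)‖ₑ ∂σ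
      ≤ ENNReal.ofReal (B * (16 * (sphereArea + 1)) * (Λ * ‖x - y‖ + Real.exp (-Λ))) := by
  have hA := sphereArea_nonneg
  have hexp := Real.exp_pos (-Λ)
  have hmeas : ∀ x : Space, Measurable fun z => coulomb (x - z) := fun x =>
    measurable_coulomb.comp (by fun_prop)
  set r := ‖x - y‖ with hr
  have hr0 : 0 ≤ r := norm_nonneg _
  have hsum : ∀ S : Set Space, ∫⁻ z in S, ‖coulomb (x - z) - coulomb (y - z)‖ₑ ∂σ
      ≤ ∫⁻ z in S, ENNReal.ofReal ((‖x - z‖ ^ 2)⁻¹) ∂σ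
        + ∫⁻ z in S, ENNReal.ofReal ((‖y - z‖ ^ 2)⁻¹) ∂σ := by
    intro S
    rw [← lintegral_add_left (by fun_prop)]
    refine lintegral_mono fun z => ?_
    rw [← enorm_coulomb, ← enorm_coulomb]
    exact enorm_sub_le
  -- For distant points `Λ * r` is bounded below, and the plain bound of each field is enough.
  rcases le_or_gt (1 / 4) r with hr4 | hr4
  · have := hsum univ
    simp only [Measure.restrict_univ] at this
    refine this.trans ((add_le_add (lintegral_inv_sq_le hσ hσ1 x)
      (lintegral_inv_sq_le hσ hσ1 y)).trans ?_)
    rw [← ENNReal.ofReal_add (by positivity) (by positivity)]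
    apply ENNReal.ofReal_le_ofReal
    have h1 : 1 / 4 ≤ Λ * r + Real.exp (-Λ) := by nlinarith
    have h2 : 0 ≤ (B : ℝ) * (sphereArea + 1) := by positivity
    nlinarith [mul_le_mul_of_nonneg_left h1 h2]
  -- The part `2 * r` makes the mean value bound `norm_coulomb_sub_le` available outside the ball;
  -- the part `exp (-Λ)` ensures that `-log d ≤ Λ` on the annulus up to radius one.
  set d : ℝ := max (Real.exp (-Λ)) (2 * r) with hd
  have hde : Real.exp (-Λ) ≤ d := le_max_left _ _
  have hdr : 2 * r ≤ d := le_max_right _ _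
  have hd0 : 0 < d := hexp.trans_le hde
  have hd1 : d ≤ 1 := by
    refine max_le ?_ (by linarith)
    rw [← Real.exp_zero]; exact Real.exp_le_exp.2 (by linarith)
  have hdsum : d ≤ Real.exp (-Λ) + 2 * r := max_le (by linarith) (by linarith)
  have hvol : ∀ (S : Set Space) (g : Space → ℝ≥0∞), ∫⁻ z in S, g z ∂σ ≤ B * ∫⁻ z in S, g z := by
    intro S g
    calc _ ≤ ∫⁻ z in S, g z ∂(B • volume) :=
          lintegral_mono' (Measure.restrict_mono le_rfl hσ) le_rfl
      _ = _ := by rw [Measure.restrict_smul, lintegral_smul_measure]; rfl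
  have hnear : ∫⁻ z in Metric.ball x d, ‖coulomb (x - z) - coulomb (y - z)‖ₑ ∂σ
      ≤ ENNReal.ofReal (B * (3 * sphereArea * d)) := by
    refine (hsum _).trans ?_
    calc _ ≤ B * ENNReal.ofReal (sphereArea * d) + B * ENNReal.ofReal (sphereArea * (2 * d)) := by
          gcongr
          · exact (hvol _ _).trans (by gcongr; exact lintegral_ball_inv_sq_le x hd0.le)
          · refine (hvol _ _).trans ?_
            gcongr
            refine le_trans (lintegral_mono_set ?_) (lintegral_ball_inv_sq_le y (by positivity))
            apply Metric.ball_subset_ball'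
            rw [dist_eq_norm, ← hr]; linarith
      _ = _ := by
          rw [← ENNReal.ofReal_coe_nnreal, ← ENNReal.ofReal_mul (by positivity),
            ← ENNReal.ofReal_mul (by positivity),
            ← ENNReal.ofReal_add (by positivity) (by positivity)]
          congr 1
          ring
  have hker : ∀ z ∈ (Metric.ball x d)ᶜ, ‖coulomb (x - z) - coulomb (y - z)‖ₑ
      ≤ ENNReal.ofReal (8 * r) * ENNReal.ofReal ((‖x - z‖ ^ 3)⁻¹) := by
    intro z hz
    have hz' : d ≤ ‖x - z‖ := by
      rwa [mem_compl_iff, Metric.mem_ball, dist_comm, dist_eq_norm, not_lt] at hz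
    have he : (x - z) - (y - z) = x - y := by abel
    have := norm_coulomb_sub_le (a := x - z) (b := y - z)
      (norm_pos_iff.1 (hd0.trans_le hz')) (by rw [he]; linarith)
    rw [he] at this
    rw [← ofReal_norm, ← ENNReal.ofReal_mul (by positivity)]
    exact ENNReal.ofReal_le_ofReal this
  have hmid : ∫⁻ z in Metric.ball x 1 \ Metric.ball x d,
      ‖coulomb (x - z) - coulomb (y - z)‖ₑ ∂σ
      ≤ ENNReal.ofReal (B * (8 * r * (sphereArea * Λ))) := by
    refine (setLIntegral_mono' (measurableSet_ball.diff measurableSet_ball)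
      fun z hz => hker z hz.2).trans ?_
    rw [lintegral_const_mul _ (by fun_prop)]
    calc _ ≤ ENNReal.ofReal (8 * r) * (B * ENNReal.ofReal (sphereArea * Λ)) := by
          gcongr
          refine (hvol _ _).trans ?_
          gcongr
          refine (lintegral_annulus_inv_cube_le x hd0 hd1).trans (ENNReal.ofReal_le_ofReal ?_)
          gcongr
          have := Real.log_le_log hexp hde
          rw [Real.log_exp] at this
          linarith
      _ = _ := by
          rw [← ENNReal.ofReal_coe_nnreal, ← ENNReal.ofReal_mul (by positivity),
            ← ENNReal.ofReal_mul (by positivity)]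
          congr 1
          ring
  have hfar : ∫⁻ z in (Metric.ball x 1)ᶜ, ‖coulomb (x - z) - coulomb (y - z)‖ₑ ∂σ
      ≤ ENNReal.ofReal (B * (8 * r)) := by
    calc _ ≤ ∫⁻ z in (Metric.ball x 1)ᶜ, ENNReal.ofReal (8 * r) ∂σ := by
          refine setLIntegral_mono' measurableSet_ball.compl fun z hz => ?_
          refine (hker z (compl_subset_compl.2 (Metric.ball_subset_ball hd1) hz)).trans ?_
          have hz' : 1 ≤ ‖x - z‖ := by
            rwa [mem_compl_iff, Metric.mem_ball, dist_comm, dist_eq_norm, not_lt] at hz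
          rw [← ENNReal.ofReal_mul (by positivity)]
          apply ENNReal.ofReal_le_ofReal
          exact mul_le_of_le_one_right (by positivity) (inv_le_one_of_one_le₀ (one_le_pow₀ hz'))
      _ ≤ ENNReal.ofReal (8 * r) * σ univ := by
          rw [lintegral_const]
          gcongr
          exact Measure.restrict_le_self
      _ ≤ ENNReal.ofReal (8 * r) * B := by gcongr
      _ = _ := by
          rw [← ENNReal.ofReal_coe_nnreal, ← ENNReal.ofReal_mul (by positivity)]
          congr 1
          ring
  rw [← lintegral_add_compl _ (measurableSet_ball (x := x) (ε := 1)),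
    ← lintegral_inter_add_sdiff _ (Metric.ball x 1) (measurableSet_ball (x := x) (ε := d)),
    inter_eq_right.2 (Metric.ball_subset_ball hd1)]
  refine (add_le_add (add_le_add hnear hmid) hfar).trans ?_
  rw [← ENNReal.ofReal_add (by positivity) (by positivity),
    ← ENNReal.ofReal_add (by positivity) (by positivity)]
  apply ENNReal.ofReal_le_ofReal
  rw [← mul_add, ← mul_add, mul_assoc (B : ℝ) (16 * _)]
  apply mul_le_mul_of_nonneg_left _ B.2
  have h1 : sphereArea * d ≤ sphereArea * (Real.exp (-Λ) + 2 * r) := by gcongr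
  have h2 : sphereArea * r ≤ sphereArea * r * Λ := le_mul_of_one_le_right (by positivity) hΛ
  have h3 : r ≤ r * Λ := le_mul_of_one_le_right (by positivity) hΛ
  have h4 : 0 ≤ sphereArea * Real.exp (-Λ) := by positivity
  nlinarith

end BoundedDensity

/-! ### Functions with an almost everywhere bounded derivative -/

section Deriv

variable {E : Type*} [NormedAddCommGroup E] [NormedSpace ℝ E] [CompleteSpace E]
  {g g' : ℝ → E} {a b C : ℝ}

/-- The equations of motion hold at every time but the bounds on the field at almost every time
only. Measurability of `g'` comes for free, since inside the interval it is a derivative. -/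
lemma intervalIntegrable_of_hasDerivWithinAt (hab : a ≤ b)
    (hd : ∀ t ∈ Icc a b, HasDerivWithinAt g (g' t) (Icc a b) t)
    (hC : ∀ᵐ t, t ∈ Icc a b → ‖g' t‖ ≤ C) : IntervalIntegrable g' volume a b := by
  rw [intervalIntegrable_iff_integrableOn_Ioo_of_le hab]
  have hm : AEStronglyMeasurable g' (volume.restrict (Ioo a b)) := by
    refine (aestronglyMeasurable_deriv g _).congr ?_
    filter_upwards [ae_restrict_mem measurableSet_Ioo] with t ht
    exact ((hd t (Ioo_subset_Icc_self ht)).hasDerivAt (Icc_mem_nhds ht.1 ht.2)).deriv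
  refine Integrable.of_bound hm C ?_
  rw [ae_restrict_iff' measurableSet_Ioo]
  filter_upwards [hC] with t ht h using ht (Ioo_subset_Icc_self h)

lemma integral_eq_sub_of_hasDerivWithinAt (hab : a ≤ b)
    (hd : ∀ t ∈ Icc a b, HasDerivWithinAt g (g' t) (Icc a b) t)
    (hC : ∀ᵐ t, t ∈ Icc a b → ‖g' t‖ ≤ C) : ∫ t in a..b, g' t = g b - g a := by
  refine intervalIntegral.integral_eq_sub_of_hasDeriv_right_of_le hab
    (fun t ht => (hd t ht).continuousWithinAt) (fun t ht => ?_)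
    (intervalIntegrable_of_hasDerivWithinAt hab hd hC)
  exact ((hd t (Ioo_subset_Icc_self ht)).hasDerivAt (Icc_mem_nhds ht.1 ht.2)).hasDerivWithinAt

lemma norm_sub_le_of_hasDerivWithinAt (hab : a ≤ b)
    (hd : ∀ t ∈ Icc a b, HasDerivWithinAt g (g' t) (Icc a b) t)
    (hC : ∀ᵐ t, t ∈ Icc a b → ‖g' t‖ ≤ C) : ‖g b - g a‖ ≤ C * (b - a) := by
  rw [← integral_eq_sub_of_hasDerivWithinAt hab hd hC]
  have := intervalIntegral.norm_integral_le_of_norm_le_const_ae (a := a) (b := b) (f := g')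
    (C := C) (by
      filter_upwards [hC] with t ht h
      rw [uIoc_of_le hab] at h
      exact ht (Ioc_subset_Icc_self h))
  rwa [abs_of_nonneg (sub_nonneg.2 hab)] at this

end Deriv

/-! ### Newtonian flows with a log-Lipschitz force preserve the volume -/

/-- A bounded force on the time interval `[0, L]`, log-Lipschitz in the position. -/
structure IsForce (L B C : ℝ) (F : ℝ → Space → Space) : Prop where
  measurable : ∀ x, AEStronglyMeasurable (fun s => F s x) (volume.restrict (Icc 0 L))
  bound : ∀ᵐ s ∂(volume.restrict (Icc 0 L)), ∀ x, ‖F s x‖ ≤ B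
  modulus : ∀ᵐ s ∂(volume.restrict (Icc 0 L)), ∀ x y, ∀ Λ : ℝ, 1 ≤ Λ →
    ‖F s x - F s y‖ ≤ C * (Λ * ‖x - y‖ + Real.exp (-Λ))

/-- Trajectories, of speed at most `P`, of Newton's equation on `[0, L]`. -/
structure IsTrajectory (L P : ℝ) (F : ℝ → Space → Space) (γ : ℝ → Phase) : Prop where
  pos : ∀ t ∈ Icc 0 L, HasDerivWithinAt (fun s => (γ s).1) (γ t).2 (Icc 0 L) t
  vel : ∀ t ∈ Icc 0 L, HasDerivWithinAt (fun s => (γ s).2) (F t (γ t).1) (Icc 0 L) t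
  speed : ∀ t ∈ Icc 0 L, ‖(γ t).2‖ ≤ P

/-- The momentum transferred at the position `x` during `[a, b]`. -/
def kick (F : ℝ → Space → Space) (a b : ℝ) (x : Space) : Space := ∫ s in a..b, F s x

/-- One step of the symplectic Euler scheme. -/
def eulerStep (F : ℝ → Space → Space) (h a : ℝ) (p : Phase) : Phase :=
  (p.1 + h • p.2, p.2 + kick F a (a + h) (p.1 + h • p.2))

/-- The symplectic Euler scheme. -/
def euler (F : ℝ → Space → Space) (h : ℝ) : ℕ → Phase → Phase
  | 0 => id
  | k + 1 => eulerStep F h (k * h) ∘ euler F h k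

section Euler

variable {L B C P h a b : ℝ} {F : ℝ → Space → Space} {γ : ℝ → Phase}

lemma IsForce.intervalIntegrable (hF : IsForce L B C F) (ha : 0 ≤ a) (hab : a ≤ b) (hb : b ≤ L)
    (x : Space) : IntervalIntegrable (fun s => F s x) volume a b := by
  rw [intervalIntegrable_iff_integrableOn_Icc_of_le hab]
  have hs : Icc a b ⊆ Icc 0 L := Icc_subset_Icc ha hb
  have : IntegrableOn (fun s => F s x) (Icc 0 L) :=
    Integrable.of_bound (hF.measurable x) B
      (by filter_upwards [hF.bound] with s hs using hs x)
  exact this.mono_set hs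

lemma IsForce.norm_kick_sub_le (hF : IsForce L B C F) (ha : 0 ≤ a) (hab : a ≤ b) (hb : b ≤ L)
    (x y : Space) {Λ : ℝ} (hΛ : 1 ≤ Λ) :
    ‖kick F a b x - kick F a b y‖ ≤ C * (Λ * ‖x - y‖ + Real.exp (-Λ)) * (b - a) := by
  unfold kick
  rw [← intervalIntegral.integral_sub (hF.intervalIntegrable ha hab hb x)
    (hF.intervalIntegrable ha hab hb y)]
  have := intervalIntegral.norm_integral_le_of_norm_le_const_ae (a := a) (b := b)
    (f := fun s => F s x - F s y) (C := C * (Λ * ‖x - y‖ + Real.exp (-Λ))) (by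
      have h1 := hF.modulus
      rw [ae_restrict_iff' measurableSet_Icc] at h1
      filter_upwards [h1] with s hs h
      rw [uIoc_of_le hab] at h
      exact hs ⟨ha.trans h.1.le, h.2.trans hb⟩ x y Λ hΛ)
  rwa [abs_of_nonneg (sub_nonneg.2 hab)] at this

lemma IsForce.continuous_kick (hF : IsForce L B C F) (hC : 1 ≤ C) (ha : 0 ≤ a) (hab : a ≤ b)
    (hb : b ≤ L) : Continuous (kick F a b) := by
  rw [Metric.continuous_iff]
  intro x ε hε
  have hlim : Filter.Tendsto (fun Λ : ℝ => C * Real.exp (-Λ) * (b - a)) Filter.atTop (nhds 0) := by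
    have := (Real.tendsto_exp_neg_atTop_nhds_zero.const_mul C).mul_const (b - a)
    simpa using this
  -- First `Λ` absorbs half of `ε` through the exponential; with `Λ` fixed the remaining term is
  -- Lipschitz.
  obtain ⟨Λ, hΛ, hΛ1⟩ := ((hlim.eventually (gt_mem_nhds (half_pos hε))).and
    (Filter.eventually_ge_atTop 1)).exists
  have hba : 0 ≤ b - a := sub_nonneg.2 hab
  set D := C * Λ * (b - a) with hD
  have hD0 : 0 ≤ D := by positivity
  refine ⟨ε / (2 * (D + 1)), by positivity, fun y hy => ?_⟩
  rw [dist_eq_norm] at hy ⊢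
  refine (hF.norm_kick_sub_le ha hab hb y x hΛ1).trans_lt ?_
  rw [lt_div_iff₀ (by positivity)] at hy
  have : C * (Λ * ‖y - x‖ + Real.exp (-Λ)) * (b - a)
      = D * ‖y - x‖ + C * Real.exp (-Λ) * (b - a) := by rw [hD]; ring
  rw [this]
  nlinarith [norm_nonneg (y - x)]

lemma measurePreserving_shear_snd {k : Space → Space} (hk : Measurable k) :
    MeasurePreserving (fun p : Phase => (p.1, p.2 + k p.1)) volume volume := by
  rw [Measure.volume_eq_prod]
  refine (MeasurePreserving.id volume).skew_product (g := fun x v => v + k x) (by fun_prop) ?_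
  exact .of_forall fun x => (measurePreserving_add_right volume (k x)).map_eq

lemma measurePreserving_shear_fst {k : Space → Space} (hk : Measurable k) :
    MeasurePreserving (fun p : Phase => (p.1 + k p.2, p.2)) volume volume := by
  have hs : MeasurePreserving (Prod.swap : Phase → Phase) volume volume := by
    rw [Measure.volume_eq_prod]; exact Measure.measurePreserving_swap
  exact hs.comp ((measurePreserving_shear_snd hk).comp hs)

/-- A step is the composition of two shears, a drift and a kick. Shears preserve the volume as soon
as they are measurable, so no differentiability of the force is required. -/
lemma IsForce.measurePreserving_euler (hF : IsForce L B C F) (hC : 1 ≤ C) (hh : 0 ≤ h) (k : ℕ)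
    (hk : k * h ≤ L) :
    MeasurePreserving (euler F h k) volume volume ∧ Continuous (euler F h k) := by
  induction k with
  | zero => exact ⟨MeasurePreserving.id _, continuous_id⟩
  | succ k ih =>
    have hk' : k * h + h ≤ L := by push_cast at hk; linarith
    have hc := hF.continuous_kick hC (a := k * h) (b := k * h + h) (by positivity) (by linarith) hk'
    obtain ⟨h1, h2⟩ := ih (by linarith)
    have h3 : eulerStep F h (k * h) = (fun p : Phase => (p.1, p.2 + kick F (k * h) (k * h + h) p.1))
        ∘ (fun p : Phase => (p.1 + h • p.2, p.2)) := rfl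
    refine ⟨?_, ?_⟩
    · refine MeasurePreserving.comp ?_ h1
      rw [h3]
      exact (measurePreserving_shear_snd hc.measurable).comp
        (measurePreserving_shear_fst (k := fun v => h • v) (by fun_prop))
    · refine Continuous.comp ?_ h2
      unfold eulerStep
      fun_prop

lemma IsTrajectory.norm_pos_sub_le (hγ : IsTrajectory L P F γ) (ha : 0 ≤ a) (hab : a ≤ b)
    (hb : b ≤ L) : ‖(γ b).1 - (γ a).1‖ ≤ P * (b - a) := by
  have hs : Icc a b ⊆ Icc 0 L := Icc_subset_Icc ha hb
  exact norm_sub_le_of_hasDerivWithinAt (g := fun s => (γ s).1) hab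
    (fun t ht => (hγ.pos t (hs ht)).mono hs) (.of_forall fun t ht => hγ.speed t (hs ht))

lemma IsTrajectory.ae_bound (hF : IsForce L B C F) (ha : 0 ≤ a) (hb : b ≤ L) :
    ∀ᵐ t, t ∈ Icc a b → ‖F t (γ t).1‖ ≤ B := by
  have h1 := hF.bound
  rw [ae_restrict_iff' measurableSet_Icc] at h1
  filter_upwards [h1] with t ht h using ht (Icc_subset_Icc ha hb h) _

lemma IsTrajectory.norm_vel_sub_le (hγ : IsTrajectory L P F γ) (hF : IsForce L B C F)
    (ha : 0 ≤ a) (hab : a ≤ b) (hb : b ≤ L) : ‖(γ b).2 - (γ a).2‖ ≤ B * (b - a) := by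
  have hs : Icc a b ⊆ Icc 0 L := Icc_subset_Icc ha hb
  exact norm_sub_le_of_hasDerivWithinAt (g := fun s => (γ s).2) hab
    (fun t ht => (hγ.vel t (hs ht)).mono hs) (IsTrajectory.ae_bound hF ha hb)

lemma IsTrajectory.norm_drift_error_le (hγ : IsTrajectory L P F γ) (hF : IsForce L B C F)
    (ha : 0 ≤ a) (hh : 0 ≤ h) (hb : a + h ≤ L) :
    ‖(γ (a + h)).1 - (γ a).1 - h • (γ a).2‖ ≤ B * h * h := by
  have hs : Icc a (a + h) ⊆ Icc 0 L := Icc_subset_Icc ha hb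
  have hd : ∀ t ∈ Icc a (a + h), HasDerivWithinAt (fun s => (γ s).1 - (s - a) • (γ a).2)
      ((γ t).2 - (γ a).2) (Icc a (a + h)) t := by
    intro t ht
    have := ((hasDerivAt_id' t).hasDerivWithinAt (s := Icc a (a + h)) |>.sub_const a).smul_const (γ a).2
    exact (((hγ.pos t (hs ht)).mono hs).fun_sub this).congr_deriv (by simp)
  have := norm_sub_le_of_hasDerivWithinAt (C := B * h) (by linarith) hd
    (.of_forall fun t ht => (hγ.norm_vel_sub_le hF ha ht.1 (ht.2.trans hb)).trans (by
      -- The sign of `B` is not assumed: on an interval of positive length it follows from the bound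
      -- on the velocity increment.
      have hB : 0 ≤ B ∨ h = 0 := by
        by_contra hc
        push Not at hc
        have hpos : 0 < h := lt_of_le_of_ne hh (Ne.symm hc.2)
        have h1 := hγ.norm_vel_sub_le hF ha (by linarith : a ≤ a + h) hb
        have h2 := norm_nonneg ((γ (a + h)).2 - (γ a).2)
        nlinarith
      rcases hB with hB | hB
      · exact mul_le_mul_of_nonneg_left (by linarith [ht.2]) hB
      · have : t = a := le_antisymm (by linarith [ht.2]) ht.1
        rw [this, hB]; simp))
  have e : (γ (a + h)).1 - (a + h - a) • (γ a).2 - ((γ a).1 - (a - a) • (γ a).2)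
      = (γ (a + h)).1 - (γ a).1 - h • (γ a).2 := by
    simp only [add_sub_cancel_left, sub_self, zero_smul, sub_zero]; abel
  rw [e] at this
  simpa using this

lemma IsTrajectory.norm_kick_error_le (hγ : IsTrajectory L P F γ) (hF : IsForce L B C F)
    (hC : 0 ≤ C) (ha : 0 ≤ a) (hh : 0 ≤ h) (hb : a + h ≤ L) (x : Space) {Λ : ℝ} (hΛ : 1 ≤ Λ) :
    ‖(γ (a + h)).2 - (γ a).2 - kick F a (a + h) x‖
      ≤ C * (Λ * (‖(γ (a + h)).1 - x‖ + P * h) + Real.exp (-Λ)) * h := by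
  have hs : Icc a (a + h) ⊆ Icc 0 L := Icc_subset_Icc ha hb
  have hd : ∀ t ∈ Icc a (a + h), HasDerivWithinAt (fun s => (γ s).2) (F t (γ t).1)
      (Icc a (a + h)) t := fun t ht => (hγ.vel t (hs ht)).mono hs
  have hP : 0 ≤ P := (norm_nonneg _).trans (hγ.speed a ⟨ha, by linarith⟩)
  unfold kick
  rw [← integral_eq_sub_of_hasDerivWithinAt (by linarith) hd (IsTrajectory.ae_bound hF ha hb),
    ← intervalIntegral.integral_sub
      (intervalIntegrable_of_hasDerivWithinAt (by linarith) hd (IsTrajectory.ae_bound hF ha hb))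
      (hF.intervalIntegrable ha (by linarith) hb x)]
  have := intervalIntegral.norm_integral_le_of_norm_le_const_ae (a := a) (b := a + h)
    (f := fun s => F s (γ s).1 - F s x)
    (C := C * (Λ * (‖(γ (a + h)).1 - x‖ + P * h) + Real.exp (-Λ))) (by
      have h1 := hF.modulus
      rw [ae_restrict_iff' measurableSet_Icc] at h1
      filter_upwards [h1] with s hs' hsm
      rw [uIoc_of_le (by linarith)] at hsm
      refine (hs' (hs ⟨hsm.1.le, hsm.2⟩) (γ s).1 x Λ hΛ).trans ?_
      gcongr
      have h2 := hγ.norm_pos_sub_le (ha.trans hsm.1.le) hsm.2 hb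
      calc ‖(γ s).1 - x‖ ≤ ‖(γ s).1 - (γ (a + h)).1‖ + ‖(γ (a + h)).1 - x‖ :=
            norm_sub_le_norm_sub_add_norm_sub _ _ _
        _ ≤ P * h + ‖(γ (a + h)).1 - x‖ := by
            rw [norm_sub_rev]
            have : P * (a + h - s) ≤ P * h := mul_le_mul_of_nonneg_left (by linarith [hsm.1]) hP
            linarith
        _ = _ := add_comm _ _)
  simpa [abs_of_nonneg hh] using this

/-- With the weight `l`, where `l ^ 2 = C * Λ`, drift and kick each amplify the error by at most `1
+ h * l`. The total growth is then exponential in `√Λ` rather than in `Λ`, so the defect `exp (-Λ)`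
wins on time intervals of any length. -/
lemma IsTrajectory.euler_error_le (hγ : IsTrajectory L P F γ) (hF : IsForce L B C F)
    (hB : 0 ≤ B) (hP : 0 ≤ P) (hC : 0 ≤ C) (hh : 0 ≤ h) {Λ l τ : ℝ} (hΛ : 1 ≤ Λ) (hl : 0 ≤ l)
    (hl2 : l ^ 2 = C * Λ)
    (hτ : τ = (1 + h * l) * l * (B * h) + C * (Λ * (P * h) + Real.exp (-Λ)))
    (k : ℕ) (hk : k * h ≤ L) :
    l * ‖(γ (k * h)).1 - (euler F h k (γ 0)).1‖ + ‖(γ (k * h)).2 - (euler F h k (γ 0)).2‖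
      ≤ k * h * τ * (1 + h * l) ^ (2 * k) := by
  have hτ0 : 0 ≤ τ := by rw [hτ]; positivity
  induction k with
  | zero => simp [euler]
  | succ k ih =>
    have hk' : k * h + h ≤ L := by push_cast at hk; linarith
    have hkh : (0 : ℝ) ≤ k * h := by positivity
    specialize ih (by linarith)
    have e1 : ((k + 1 : ℕ) : ℝ) * h = k * h + h := by push_cast; ring
    rw [e1]
    set q := euler F h k (γ 0) with hq
    set x1 := q.1 + h • q.2 with hx1
    have e2 : euler F h (k + 1) (γ 0) = (x1, q.2 + kick F (k * h) (k * h + h) x1) := rfl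
    rw [e2]
    simp only
    set e := ‖(γ (k * h)).1 - q.1‖
    set g := ‖(γ (k * h)).2 - q.2‖
    set e' := ‖(γ (k * h + h)).1 - x1‖ with he'
    have he0 : 0 ≤ e := norm_nonneg _
    have hg0 : 0 ≤ g := norm_nonneg _
    have hdr : e' ≤ e + h * g + B * h * h := by
      have := hγ.norm_drift_error_le hF hkh hh hk'
      calc e' = ‖((γ (k * h + h)).1 - (γ (k * h)).1 - h • (γ (k * h)).2)
            + (((γ (k * h)).1 - q.1) + h • ((γ (k * h)).2 - q.2))‖ := by
            rw [he', hx1]; congr 1; module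
        _ ≤ B * h * h + (e + h * g) := by
            refine (norm_add_le _ _).trans (add_le_add this ((norm_add_le _ _).trans ?_))
            rw [norm_smul, Real.norm_eq_abs, abs_of_nonneg hh]
        _ = _ := by ring
    have hki := hγ.norm_kick_error_le hF hC hkh hh hk' x1 hΛ
    have hg' : ‖(γ (k * h + h)).2 - (q.2 + kick F (k * h) (k * h + h) x1)‖
        ≤ g + C * (Λ * (e' + P * h) + Real.exp (-Λ)) * h := by
      calc _ = ‖((γ (k * h + h)).2 - (γ (k * h)).2 - kick F (k * h) (k * h + h) x1)
            + ((γ (k * h)).2 - q.2)‖ := by congr 1; module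
        _ ≤ _ := (norm_add_le _ _).trans (by rw [add_comm]; gcongr)
    have hstep : l * e' + ‖(γ (k * h + h)).2 - (q.2 + kick F (k * h) (k * h + h) x1)‖
        ≤ (1 + h * l) ^ 2 * (l * e + g) + h * τ := by
      calc _ ≤ l * e' + (g + C * (Λ * (e' + P * h) + Real.exp (-Λ)) * h) := by gcongr
        _ = l * (1 + h * l) * e' + g + h * (C * (Λ * (P * h) + Real.exp (-Λ))) := by
            linear_combination (- h * e') * hl2
        _ ≤ l * (1 + h * l) * (e + h * g + B * h * h) + g
              + h * (C * (Λ * (P * h) + Real.exp (-Λ))) := by gcongr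
        _ = (1 + h * l) * (l * e) + (1 + (1 + h * l) * (h * l)) * g + h * τ := by
            rw [hτ]; ring
        _ ≤ _ := by
            have hhl : 0 ≤ h * l := by positivity
            have h1 : (1 + h * l) * (l * e) ≤ (1 + h * l) ^ 2 * (l * e) := by
              apply mul_le_mul_of_nonneg_right _ (by positivity)
              nlinarith
            have h2 : (1 + (1 + h * l) * (h * l)) * g ≤ (1 + h * l) ^ 2 * g := by
              apply mul_le_mul_of_nonneg_right _ hg0
              nlinarith
            linarith
    refine hstep.trans ?_
    have hone : (1 : ℝ) ≤ (1 + h * l) ^ (2 * (k + 1)) :=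
      one_le_pow₀ (by nlinarith [mul_nonneg hh hl])
    calc _ ≤ (1 + h * l) ^ 2 * (k * h * τ * (1 + h * l) ^ (2 * k)) + h * τ := by gcongr
      _ ≤ (1 + h * l) ^ 2 * (k * h * τ * (1 + h * l) ^ (2 * k))
          + h * τ * (1 + h * l) ^ (2 * (k + 1)) :=
          add_le_add le_rfl (le_mul_of_one_le_right (by positivity) hone)
      _ = _ := by ring

/-- The symplectic Euler scheme converges, uniformly on the trajectories of bounded speed. -/
lemma IsForce.exists_euler_close (hF : IsForce L B C F) (hL : 0 ≤ L) (hB : 0 ≤ B) (hP : 0 ≤ P)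
    (hC : 1 ≤ C) {ε : ℝ} (hε : 0 < ε) :
    ∃ S : Phase → Phase, MeasurePreserving S volume volume ∧ Continuous S ∧
      ∀ γ, IsTrajectory L P F γ → dist (S (γ 0)) (γ L) ≤ ε := by
  set a := 2 * L * √C with ha
  have ha0 : 0 ≤ a := by positivity
  have hlim : Filter.Tendsto (fun m : ℝ => L * C * Real.exp (-m)) Filter.atTop (nhds 0) := by
    simpa using Real.tendsto_exp_neg_atTop_nhds_zero.const_mul (L * C)
  -- Here `m` is the square root of `Λ`, so the error growth is `exp (a * m)`. The condition `m ≥ a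
  -- + 1` gives `-m ^ 2 + a * m ≤ -m`.
  obtain ⟨m, hm, hm1⟩ := ((hlim.eventually (gt_mem_nhds (half_pos hε))).and
    (Filter.eventually_ge_atTop (a + 1))).exists
  have hm0 : 0 ≤ m := by linarith
  set Λ := m ^ 2 with hΛd
  have hΛ : 1 ≤ Λ := by nlinarith
  set l := √C * m with hl
  have hl1 : 1 ≤ l := by
    have : 1 ≤ √C := Real.one_le_sqrt.2 hC
    nlinarith
  have hl2 : l ^ 2 = C * Λ := by rw [hl, mul_pow, Real.sq_sqrt (by linarith)]
  have hexp : L * C * Real.exp (-Λ) * Real.exp (2 * L * l) ≤ L * C * Real.exp (-m) := by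
    rw [mul_assoc, ← Real.exp_add]
    gcongr
    have : 2 * L * l = a * m := by rw [hl, ha]; ring
    rw [this]
    nlinarith
  -- With `Λ` now fixed, the remaining discretization error is at most `D` times the time step, and
  -- it vanishes as the number of steps grows.
  set D := L * ((1 + L * l) * l * B + C * Λ * P) * Real.exp (2 * L * l) with hD
  have hlim2 : Filter.Tendsto (fun N : ℕ => D * (L / N)) Filter.atTop (nhds 0) := by
    simpa using (tendsto_const_div_atTop_nhds_zero_nat L).const_mul D
  obtain ⟨N, hN, hN1⟩ := ((hlim2.eventually (gt_mem_nhds (half_pos hε))).and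
    (Filter.eventually_ge_atTop 1)).exists
  have hNpos : (0 : ℝ) < N := by exact_mod_cast hN1
  set h := L / N with hh
  have hh0 : 0 ≤ h := by positivity
  have hhL : h ≤ L := div_le_self hL (by exact_mod_cast hN1)
  have hNh : N * h = L := by rw [hh]; field_simp
  obtain ⟨h1, h2⟩ := hF.measurePreserving_euler hC hh0 N hNh.le
  refine ⟨_, h1, h2, fun γ hγ => ?_⟩
  have key := hγ.euler_error_le hF hB hP (by linarith) hh0 hΛ (by linarith) hl2 rfl N hNh.le
  rw [hNh] at key
  have hpow : (1 + h * l) ^ (2 * N) ≤ Real.exp (2 * L * l) := by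
    calc (1 + h * l) ^ (2 * N) ≤ (Real.exp (h * l)) ^ (2 * N) := by
          gcongr
          rw [add_comm]; exact Real.add_one_le_exp _
      _ = Real.exp (2 * L * l) := by
          rw [← Real.exp_nat_mul]
          congr 1
          push_cast
          rw [← hNh]; ring
  have hfin : l * ‖(γ L).1 - (euler F h N (γ 0)).1‖ + ‖(γ L).2 - (euler F h N (γ 0)).2‖ ≤ ε := by
    refine key.trans ?_
    calc _ ≤ L * ((1 + L * l) * l * (B * h) + C * (Λ * (P * h) + Real.exp (-Λ)))
          * Real.exp (2 * L * l) := by gcongr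
      _ = D * h + L * C * Real.exp (-Λ) * Real.exp (2 * L * l) := by rw [hD]; ring
      _ ≤ ε := by linarith
  have n1 := norm_nonneg ((γ L).1 - (euler F h N (γ 0)).1)
  have n2 := norm_nonneg ((γ L).2 - (euler F h N (γ 0)).2)
  rw [dist_comm, Prod.dist_eq, dist_eq_norm, dist_eq_norm]
  exact max_le (by nlinarith) (by nlinarith)

/-- The time `L` map of a Newtonian flow, on a set of bounded trajectories, is continuous. -/
lemma IsForce.continuousOn_flow (hF : IsForce L B C F) (hL : 0 ≤ L) (hB : 0 ≤ B) (hP : 0 ≤ P)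
    (hC : 1 ≤ C) {A : Set Phase} {γ : Phase → ℝ → Phase}
    (hγ : ∀ p ∈ A, IsTrajectory L P F (γ p)) (h0 : ∀ p ∈ A, γ p 0 = p) :
    ContinuousOn (fun p => γ p L) A := by
  refine continuousOn_of_uniform_approx_of_continuousOn fun u hu => ?_
  obtain ⟨ε, hε, hu'⟩ := Metric.mem_uniformity_dist.1 hu
  obtain ⟨S, -, hS, hclose⟩ := hF.exists_euler_close hL hB hP hC (half_pos hε)
  refine ⟨S, hS.continuousOn, fun p hp => hu' ?_⟩
  have := hclose _ (hγ p hp)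
  rw [h0 p hp, dist_comm] at this
  exact this.trans_lt (half_lt_self hε)

/-- The time `L` map of a Newtonian flow does not decrease the volume of compact sets. -/
lemma IsForce.volume_le_volume_image (hF : IsForce L B C F) (hL : 0 ≤ L) (hB : 0 ≤ B)
    (hP : 0 ≤ P) (hC : 1 ≤ C) {A : Set Phase} (hA : IsCompact A) {γ : Phase → ℝ → Phase}
    (hγ : ∀ p ∈ A, IsTrajectory L P F (γ p)) (h0 : ∀ p ∈ A, γ p 0 = p) :
    volume A ≤ volume ((fun p => γ p L) '' A) := by
  have hc := hA.image_of_continuousOn (hF.continuousOn_flow hL hB hP hC hγ h0)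
  -- The approximating map `S` preserves the volume and sends `A` into the `ε`-thickening of the
  -- image, whose volume tends to that of the compact image.
  have hlim := tendsto_measure_cthickening_of_isCompact (μ := (volume : Measure Phase)) hc
  have hlim' := hlim.mono_left (nhdsWithin_le_nhds (s := Ioi 0))
  refine ge_of_tendsto hlim' ?_
  filter_upwards [self_mem_nhdsWithin] with ε (hε : 0 < ε)
  obtain ⟨S, hS, -, hclose⟩ := hF.exists_euler_close hL hB hP hC hε
  have hm : MeasurableSet (Metric.cthickening ε ((fun p => γ p L) '' A)) :=
    Metric.isClosed_cthickening.measurableSet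
  have hsub : A ⊆ S ⁻¹' (Metric.cthickening ε ((fun p => γ p L) '' A)) := by
    intro p hp
    have := hclose _ (hγ p hp)
    rw [h0 p hp] at this
    exact Metric.mem_cthickening_of_dist_le (S p) (γ p L) ε _ ⟨p, hp, rfl⟩ this
  exact (measure_mono hsub).trans (hS.measure_preimage hm.nullMeasurableSet).le

end Euler

/-! ### Time reversal and transport of the Lebesgue measure -/

/-- Reversal of the velocity. -/
def flipVel (p : Phase) : Phase := (p.1, -p.2)

lemma flipVel_flipVel (p : Phase) : flipVel (flipVel p) = p := by simp [flipVel]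

lemma continuous_flipVel : Continuous flipVel := by unfold flipVel; fun_prop

lemma volume_flipVel_image (S : Set Phase) : volume (flipVel '' S) = volume S := by
  have hmp : MeasurePreserving flipVel volume volume := by
    rw [Measure.volume_eq_prod]
    exact (MeasurePreserving.id volume).prod (Measure.measurePreserving_neg volume)
  have he : MeasurableEmbedding flipVel :=
    (Homeomorph.mk ⟨flipVel, flipVel, flipVel_flipVel, flipVel_flipVel⟩ continuous_flipVel
      continuous_flipVel).measurableEmbedding
  have himg : flipVel '' S = flipVel ⁻¹' S := by
    ext p
    constructor
    · rintro ⟨q, hq, rfl⟩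
      rwa [mem_preimage, flipVel_flipVel]
    · intro hp
      exact ⟨flipVel p, hp, flipVel_flipVel p⟩
  rw [himg, hmp.measure_preimage_emb he]

section Reverse

variable {L B C P : ℝ} {F : ℝ → Space → Space} {γ : ℝ → Phase}

lemma measurePreserving_reverse (L : ℝ) :
    MeasurePreserving (fun s : ℝ => L - s) (volume.restrict (Icc 0 L))
      (volume.restrict (Icc 0 L)) := by
  have := (Measure.measurePreserving_sub_left volume L).restrict_preimage
    (measurableSet_Icc (a := (0 : ℝ)) (b := L))
  have e : (fun s : ℝ => L - s) ⁻¹' Icc 0 L = Icc 0 L := by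
    ext s; simp only [mem_preimage, mem_Icc]; constructor <;> intro h <;> constructor <;> linarith [h.1, h.2]
  rwa [e] at this

lemma IsForce.reverse (hF : IsForce L B C F) : IsForce L B C (fun s => F (L - s)) where
  measurable x := (hF.measurable x).comp_measurePreserving (measurePreserving_reverse L)
  bound := (measurePreserving_reverse L).quasiMeasurePreserving.ae hF.bound
  modulus := (measurePreserving_reverse L).quasiMeasurePreserving.ae hF.modulus

lemma IsTrajectory.reverse (hγ : IsTrajectory L P F γ) :
    IsTrajectory L P (fun s => F (L - s)) (fun s => flipVel (γ (L - s))) := by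
  have hm : MapsTo (fun s : ℝ => L - s) (Icc 0 L) (Icc 0 L) := fun s hs =>
    ⟨by linarith [hs.2], by linarith [hs.1]⟩
  have hd : ∀ t, HasDerivWithinAt (fun s : ℝ => L - s) (-1) (Icc 0 L) t := fun t => by
    simpa using ((hasDerivAt_id t).const_sub L).hasDerivWithinAt
  refine ⟨fun t ht => ?_, fun t ht => ?_, fun t ht => ?_⟩
  · have := (hγ.pos (L - t) (hm ht)).scomp t (hd t) hm
    exact this.congr_deriv (by simp [flipVel])
  · have := ((hγ.vel (L - t) (hm ht)).scomp t (hd t) hm).fun_neg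
    exact this.congr_deriv (by simp [flipVel])
  · simpa [flipVel] using hγ.speed _ (hm ht)

end Reverse

/-- A continuous injective map of a compact set that preserves the volume of compact sets
transports the Lebesgue measure. -/
lemma map_restrict_of_volume_image {A : Set Phase} (hA : IsCompact A) {Ψ : Phase → Phase}
    (hc : ContinuousOn Ψ A) (hv : ∀ A' ⊆ A, IsCompact A' → volume (Ψ '' A') = volume A') :
    (volume.restrict A).map Ψ = volume.restrict (Ψ '' A) := by
  have hAm := hA.measurableSet
  have hΨ : AEMeasurable Ψ (volume.restrict A) := hc.aemeasurable hAm
  have hAfin : volume A < ∞ := hA.measure_lt_top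
  have hfin : IsFiniteMeasure (volume.restrict A) := ⟨by simpa using hAfin⟩
  have hfin' : IsFiniteMeasure ((volume.restrict A).map Ψ) := Measure.isFiniteMeasure_map _ _
  have hcl : ∀ S, IsClosed S → (volume.restrict A).map Ψ S = volume.restrict (Ψ '' A) S := by
    intro S hS
    have hK : IsCompact (A ∩ Ψ ⁻¹' S) :=
      hA.of_isClosed_subset (hc.preimage_isClosed_of_isClosed hA.isClosed hS) inter_subset_left
    rw [Measure.map_apply_of_aemeasurable hΨ hS.measurableSet, Measure.restrict_apply' hAm,
      Measure.restrict_apply hS.measurableSet, inter_comm, ← hv _ inter_subset_left hK,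
      image_inter_preimage, inter_comm]
  refine ext_of_generate_finite _ ?_ isPiSystem_isClosed hcl (hcl _ isClosed_univ)
  rw [← borel_eq_generateFrom_isClosed]
  exact BorelSpace.measurable_eq

/-- The time `L` map of a Newtonian flow, injective on a compact set of bounded trajectories,
transports the Lebesgue measure. -/
lemma IsForce.map_restrict {L B C P : ℝ} {F : ℝ → Space → Space} (hF : IsForce L B C F)
    (hL : 0 ≤ L) (hB : 0 ≤ B) (hP : 0 ≤ P) (hC : 1 ≤ C) {A : Set Phase} (hA : IsCompact A)
    {γ : Phase → ℝ → Phase} (hγ : ∀ p ∈ A, IsTrajectory L P F (γ p)) (h0 : ∀ p ∈ A, γ p 0 = p)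
    (hinj : InjOn (fun p => γ p L) A) :
    (volume.restrict A).map (fun p => γ p L) = volume.restrict ((fun p => γ p L) '' A) := by
  have hc := hF.continuousOn_flow hL hB hP hC hγ h0
  refine map_restrict_of_volume_image hA hc fun A' hA' hK => le_antisymm ?_ ?_
  · set Ψ : Phase → Phase := fun p => γ p L with hΨ
    -- The opposite inequality is the same lemma for the reversed motion: the image with reversed
    -- velocities is carried back to `A'` with reversed velocities. The map `κ` recovers the initial
    -- point by injectivity.
    set A₁ : Set Phase := flipVel '' (Ψ '' A') with hA₁
    have hK₁ : IsCompact A₁ :=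
      (hK.image_of_continuousOn (hc.mono hA')).image continuous_flipVel
    set κ : Phase → Phase := fun q => Function.invFunOn Ψ A (flipVel q) with hκ
    have hκ' : ∀ p ∈ A', κ (flipVel (Ψ p)) = p := by
      intro p hp
      simp only [hκ, flipVel_flipVel]
      exact hinj.leftInvOn_invFunOn (hA' hp)
    have h1 := hF.reverse.volume_le_volume_image hL hB hP hC hK₁
      (γ := fun q s => flipVel (γ (κ q) (L - s))) (by
        rintro _ ⟨_, ⟨p, hp, rfl⟩, rfl⟩
        rw [hκ' p hp]
        exact (hγ p (hA' hp)).reverse) (by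
        rintro _ ⟨_, ⟨p, hp, rfl⟩, rfl⟩
        rw [hκ' p hp, sub_zero])
    have h2 : (fun q => flipVel (γ (κ q) (L - L))) '' A₁ = flipVel '' A' := by
      rw [hA₁, image_image, image_image]
      refine image_congr fun p hp => ?_
      rw [hκ' p hp, sub_self, h0 p (hA' hp)]
    rw [h2, volume_flipVel_image, volume_flipVel_image] at h1
    exact h1
  · exact hF.volume_le_volume_image hL hB hP hC hK (fun p hp => hγ p (hA' hp))
      (fun p hp => h0 p (hA' hp))

/-! ### The field of a density in `L¹ ∩ L^∞` -/

section DensityField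

variable {ρ : Space → ℝ} {B : ℝ≥0}

lemma withDensity_enorm_le (hB : eLpNorm ρ ⊤ volume ≤ B) :
    volume.withDensity (fun z => ‖ρ z‖ₑ) ≤ B • volume := by
  change _ ≤ (B : ℝ≥0∞) • volume
  rw [← withDensity_const]
  refine withDensity_mono ?_
  have := ae_le_eLpNormEssSup (f := ρ) (μ := volume)
  rw [← eLpNorm_exponent_top] at this
  filter_upwards [this] with p hp using hp.trans hB

lemma withDensity_enorm_univ_le (hB : eLpNorm ρ 1 volume ≤ B) :
    volume.withDensity (fun z => ‖ρ z‖ₑ) univ ≤ B := by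
  rwa [withDensity_apply _ MeasurableSet.univ, Measure.restrict_univ,
    ← eLpNorm_one_eq_lintegral_enorm]

lemma lintegral_enorm_smul {k : Space → Space} (hρ : AEStronglyMeasurable ρ volume)
    (hk : Measurable k) :
    ∫⁻ z, ‖ρ z • k z‖ₑ = ∫⁻ z, ‖k z‖ₑ ∂(volume.withDensity fun z => ‖ρ z‖ₑ) := by
  rw [lintegral_withDensity_eq_lintegral_mul₀ hρ.enorm (by fun_prop)]
  simp_rw [enorm_smul, Pi.mul_apply]

lemma measurable_coulomb_sub (x : Space) : Measurable fun z => coulomb (x - z) :=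
  measurable_coulomb.comp (by fun_prop)

lemma integrable_smul_coulomb (hρ : AEStronglyMeasurable ρ volume)
    (h1 : eLpNorm ρ 1 volume ≤ B) (h2 : eLpNorm ρ ⊤ volume ≤ B) (x : Space) :
    Integrable fun z => ρ z • coulomb (x - z) := by
  refine ⟨hρ.smul (measurable_coulomb_sub x).aestronglyMeasurable, ?_⟩
  rw [hasFiniteIntegral_iff_enorm, lintegral_enorm_smul hρ (measurable_coulomb_sub x)]
  simp_rw [enorm_coulomb]
  exact (lintegral_inv_sq_le (withDensity_enorm_le h2) (withDensity_enorm_univ_le h1) x).trans_lt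
    ENNReal.ofReal_lt_top

lemma norm_integral_smul_coulomb_le (hρ : AEStronglyMeasurable ρ volume)
    (h1 : eLpNorm ρ 1 volume ≤ B) (h2 : eLpNorm ρ ⊤ volume ≤ B) (x : Space) :
    ‖∫ z, ρ z • coulomb (x - z)‖ ≤ B * (sphereArea + 1) := by
  have hA := sphereArea_nonneg
  have h := enorm_integral_le_lintegral_enorm (μ := volume) fun z => ρ z • coulomb (x - z)
  rw [lintegral_enorm_smul hρ (measurable_coulomb_sub x)] at h
  simp_rw [enorm_coulomb] at h
  have := h.trans
    (lintegral_inv_sq_le (withDensity_enorm_le h2) (withDensity_enorm_univ_le h1) x)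
  rwa [← ofReal_norm, ENNReal.ofReal_le_ofReal_iff (by positivity)] at this

lemma norm_integral_smul_coulomb_sub_le (hρ : AEStronglyMeasurable ρ volume)
    (h1 : eLpNorm ρ 1 volume ≤ B) (h2 : eLpNorm ρ ⊤ volume ≤ B) (x y : Space) {Λ : ℝ}
    (hΛ : 1 ≤ Λ) :
    ‖(∫ z, ρ z • coulomb (x - z)) - ∫ z, ρ z • coulomb (y - z)‖
      ≤ B * (16 * (sphereArea + 1)) * (Λ * ‖x - y‖ + Real.exp (-Λ)) := by
  have hA := sphereArea_nonneg
  rw [← integral_sub (integrable_smul_coulomb hρ h1 h2 x) (integrable_smul_coulomb hρ h1 h2 y)]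
  simp_rw [← smul_sub]
  have h := enorm_integral_le_lintegral_enorm (μ := volume)
    fun z => ρ z • (coulomb (x - z) - coulomb (y - z))
  rw [lintegral_enorm_smul (k := fun z => coulomb (x - z) - coulomb (y - z)) hρ
    ((measurable_coulomb_sub x).sub (measurable_coulomb_sub y))] at h
  have := h.trans (lintegral_coulomb_sub_le (withDensity_enorm_le h2)
    (withDensity_enorm_univ_le h1) hΛ x y)
  rwa [← ofReal_norm, ENNReal.ofReal_le_ofReal_iff (by positivity)] at this

end DensityField

/-! ### Basic properties of solutions -/

section Solution

variable {T : ℝ} {f₀ : Phase → ℝ} {ξ₀ η₀ : Space} {ξ η : ℝ → Space} {f : ℝ → Phase → ℝ}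
  {Φ : ℝ → ℝ → Phase → Phase}

lemma IsSolution.aestronglyMeasurable_rho (hs : IsSolution T f₀ ξ₀ η₀ ξ η f Φ) :
    AEStronglyMeasurable (fun q : ℝ × Space => rho (f q.1) q.2)
      ((volume.restrict (Icc 0 T)).prod volume) := by
  have h1 := hs.measurable
  rw [Measure.volume_eq_prod] at h1
  have h2 := h1.comp_measurePreserving
    (measurePreserving_prodAssoc (volume.restrict (Icc 0 T)) (volume : Measure Space)
      (volume : Measure Space))
  exact h2.integral_prod_right'

lemma IsSolution.aestronglyMeasurable_field (hs : IsSolution T f₀ ξ₀ η₀ ξ η f Φ) (x : Space) :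
    AEStronglyMeasurable (fun s => field (f s) x) (volume.restrict (Icc 0 T)) := by
  have h1 : AEStronglyMeasurable (fun q : ℝ × Space => rho (f q.1) q.2 • coulomb (x - q.2))
      ((volume.restrict (Icc 0 T)).prod volume) :=
    hs.aestronglyMeasurable_rho.smul
      ((measurable_coulomb_sub x).comp measurable_snd).aestronglyMeasurable
  exact h1.integral_prod_right'

lemma IsSolution.exists_field_bound (hs : IsSolution T f₀ ξ₀ η₀ ξ η f Φ) :
    ∃ B : ℝ, 0 ≤ B ∧ ∀ᵐ t ∂(volume.restrict (Icc 0 T)), (∀ x, ‖field (f t) x‖ ≤ B) ∧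
      ∀ x y, ∀ Λ : ℝ, 1 ≤ Λ →
        ‖field (f t) x - field (f t) y‖ ≤ B * (Λ * ‖x - y‖ + Real.exp (-Λ)) := by
  have hA := sphereArea_nonneg
  obtain ⟨B, hB⟩ := hs.bounded
  refine ⟨B * (16 * (sphereArea + 1)), by positivity, ?_⟩
  filter_upwards [hB, hs.aestronglyMeasurable_rho.prodMk_left] with t ht hm
  refine ⟨fun x => ?_, fun x y Λ hΛ => ?_⟩
  · refine (norm_integral_smul_coulomb_le hm ht.2.2.1 ht.2.2.2 x).trans ?_
    gcongr
    linarith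
  · exact norm_integral_smul_coulomb_sub_le hm ht.2.2.1 ht.2.2.2 x y hΛ

/-- Transport says nothing at phase points located at the charge; there both densities vanish,
because their supports avoid the charge. -/
lemma IsSolution.initial_eq (hT : 0 < T) (hd : IsInitialDatum f₀ ξ₀)
    (hs : IsSolution T f₀ ξ₀ η₀ ξ η f Φ) : f 0 = f₀ := by
  have h0 : (0 : ℝ) ∈ Icc 0 T := ⟨le_rfl, hT.le⟩
  obtain ⟨δ₀, hδ₀, hδ⟩ := hd.away
  funext p
  by_cases hp : p ∈ phaseDomain (ξ 0)
  · have := hs.transport 0 h0 p hp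
    rwa [hs.flow_self 0 h0 p hp] at this
  · have h1 : p ∉ tsupport (f 0) := fun h => hp (hs.supp_subset 0 h0 h)
    have h2 : p ∉ tsupport f₀ := fun h => by
      have h3 := hδ p h
      have h4 : p.1 = ξ 0 := not_not.1 hp
      rw [h4, hs.charge_init.1, sub_self, norm_zero] at h3
      linarith
    rw [image_eq_zero_of_notMem_tsupport h1, image_eq_zero_of_notMem_tsupport h2]

lemma IsSolution.support_subset_domain (hT : 0 < T) (hd : IsInitialDatum f₀ ξ₀)
    (hs : IsSolution T f₀ ξ₀ η₀ ξ η f Φ) : tsupport f₀ ⊆ phaseDomain (ξ 0) := by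
  have := hs.supp_subset 0 ⟨le_rfl, hT.le⟩
  rwa [hs.initial_eq hT hd] at this

lemma IsSolution.exists_speed_bound (hT : 0 < T) (hd : IsInitialDatum f₀ ξ₀)
    (hs : IsSolution T f₀ ξ₀ η₀ ξ η f Φ) :
    ∃ δ P D : ℝ, 0 < δ ∧ 0 ≤ P ∧ 0 ≤ D ∧ (∀ t ∈ Icc 0 T, ∀ p ∈ tsupport f₀,
      δ ≤ ‖(Φ 0 t p).1 - ξ t‖ ∧ ‖(Φ 0 t p).2‖ ≤ P) ∧
      ∀ s ∈ Icc 0 T, ∀ t ∈ Icc 0 T, ∀ p ∈ tsupport f₀,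
        ‖(Φ 0 t p).2 - (Φ 0 s p).2‖ ≤ D * |t - s| := by
  have h0 : (0 : ℝ) ∈ Icc 0 T := ⟨le_rfl, hT.le⟩
  have hdom := hs.support_subset_domain hT hd
  obtain ⟨δ, hδ, hlow⟩ := hs.lower
  obtain ⟨B, hB0, hB⟩ := hs.exists_field_bound
  rw [ae_restrict_iff' measurableSet_Icc] at hB
  obtain ⟨R, hR⟩ := (hd.compact.isCompact.image continuous_snd).isBounded.exists_norm_le
  have hlow' : ∀ t ∈ Icc 0 T, ∀ p ∈ tsupport f₀, δ ≤ ‖(Φ 0 t p).1 - ξ t‖ := by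
    intro t ht p hp
    exact hlow 0 h0 t ht p (by rwa [hs.initial_eq hT hd])
  have hle : ∀ s ∈ Icc 0 T, ∀ t ∈ Icc 0 T, ∀ p ∈ tsupport f₀, s ≤ t →
      ‖(Φ 0 t p).2 - (Φ 0 s p).2‖ ≤ (B + (δ ^ 2)⁻¹) * (t - s) := by
    intro s hs' t ht p hp hst
    have hsub : Icc s t ⊆ Icc 0 T := Icc_subset_Icc hs'.1 ht.2
    refine norm_sub_le_of_hasDerivWithinAt (g := fun r => (Φ 0 r p).2) hst
      (fun r hr => (hs.flow_vel 0 h0 p (hdom hp) r (hsub hr)).mono hsub) ?_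
    filter_upwards [hB] with r hr hrm
    refine (norm_add_le _ _).trans (add_le_add ((hr (hsub hrm)).1 _) ?_)
    rw [norm_coulomb]
    have := hlow' r (hsub hrm) p hp
    gcongr
  have habs : ∀ s ∈ Icc 0 T, ∀ t ∈ Icc 0 T, ∀ p ∈ tsupport f₀,
      ‖(Φ 0 t p).2 - (Φ 0 s p).2‖ ≤ (B + (δ ^ 2)⁻¹) * |t - s| := by
    intro s hs' t ht p hp
    rcases le_total s t with h | h
    · rw [abs_of_nonneg (sub_nonneg.2 h)]; exact hle s hs' t ht p hp h
    · rw [norm_sub_rev, abs_sub_comm, abs_of_nonneg (sub_nonneg.2 h)]; exact hle t ht s hs' p hp h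
  refine ⟨δ, |R| + (B + (δ ^ 2)⁻¹) * T, B + (δ ^ 2)⁻¹, hδ, by positivity, by positivity,
    fun t ht p hp => ⟨hlow' t ht p hp, ?_⟩, habs⟩
  have h1 := habs 0 h0 t ht p hp
  rw [hs.flow_self 0 h0 p (hdom hp), sub_zero, abs_of_nonneg ht.1] at h1
  have h2 : ‖p.2‖ ≤ |R| := (hR _ ⟨p, hp, rfl⟩).trans (le_abs_self R)
  calc ‖(Φ 0 t p).2‖ ≤ ‖p.2‖ + ‖(Φ 0 t p).2 - p.2‖ := by
        simpa using norm_add_le p.2 ((Φ 0 t p).2 - p.2)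
    _ ≤ |R| + (B + (δ ^ 2)⁻¹) * T := by
        gcongr
        exact h1.trans (by gcongr; exact ht.2)

/-- The force of the charge is singular, but trajectories at distance at least `δ` from it do not
see the cutoff. With the cutoff the force is bounded and log-Lipschitz on the whole space, as the
Euler scheme requires. -/
lemma IsSolution.exists_isForce (hs : IsSolution T f₀ ξ₀ η₀ ξ η f Φ) {δ : ℝ} (hδ : 0 < δ) :
    ∃ B C : ℝ, 0 ≤ B ∧ 1 ≤ C ∧ ∀ L ∈ Icc 0 T,
      IsForce L B C fun t x => field (f t) x + cutCoulomb δ (x - ξ t) := by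
  obtain ⟨B, hB0, hB⟩ := hs.exists_field_bound
  have hcont : ContinuousOn ξ (Icc 0 T) := fun t ht => (hs.charge_pos t ht).continuousWithinAt
  refine ⟨B + (δ ^ 2)⁻¹, B + 8 / δ ^ 3 + 1, by positivity, ?_, fun L hL => ?_⟩
  · have : 0 ≤ 8 / δ ^ 3 := by positivity
    linarith
  have hsub : Icc 0 L ⊆ Icc 0 T := Icc_subset_Icc_right hL.2
  have hmono : volume.restrict (Icc 0 L) ≤ volume.restrict (Icc 0 T) :=
    Measure.restrict_mono hsub le_rfl
  have hae := hB.filter_mono (ae_mono hmono)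
  refine ⟨fun x => ?_, ?_, ?_⟩
  · refine (AEStronglyMeasurable.mono_measure (hs.aestronglyMeasurable_field x) hmono).add ?_
    have hm : Measurable (cutCoulomb δ) := by unfold cutCoulomb; fun_prop
    have h1 : AEMeasurable ξ (volume.restrict (Icc 0 L)) :=
      (hcont.mono hsub).aemeasurable measurableSet_Icc
    exact (hm.comp_aemeasurable (h1.const_sub x)).aestronglyMeasurable
  · filter_upwards [hae] with t ht x
    exact (norm_add_le _ _).trans (add_le_add (ht.1 x) (norm_cutCoulomb_le hδ _))
  · filter_upwards [hae] with t ht x y Λ hΛ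
    have h1 := ht.2 x y Λ hΛ
    have h2 := norm_cutCoulomb_sub_le hδ (x - ξ t) (y - ξ t)
    rw [sub_sub_sub_cancel_right] at h2
    have hexp := Real.exp_pos (-Λ)
    calc _ = ‖(field (f t) x - field (f t) y)
          + (cutCoulomb δ (x - ξ t) - cutCoulomb δ (y - ξ t))‖ := by congr 1; abel
      _ ≤ B * (Λ * ‖x - y‖ + Real.exp (-Λ)) + 8 / δ ^ 3 * ‖x - y‖ :=
          (norm_add_le _ _).trans (add_le_add h1 h2)
      _ ≤ B * (Λ * ‖x - y‖ + Real.exp (-Λ))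
          + 8 / δ ^ 3 * (Λ * ‖x - y‖ + Real.exp (-Λ)) + 1 * (Λ * ‖x - y‖ + Real.exp (-Λ)) := by
          have h3 : ‖x - y‖ ≤ Λ * ‖x - y‖ := le_mul_of_one_le_left (norm_nonneg _) hΛ
          have h4 : 8 / δ ^ 3 * ‖x - y‖ ≤ 8 / δ ^ 3 * (Λ * ‖x - y‖ + Real.exp (-Λ)) := by
            gcongr; linarith
          have h5 := norm_nonneg (x - y)
          linarith
      _ = _ := by ring

/-- The characteristic flow transports the Lebesgue measure of the initial support. -/
lemma IsSolution.flow_transport (hT : 0 < T) (hd : IsInitialDatum f₀ ξ₀)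
    (hs : IsSolution T f₀ ξ₀ η₀ ξ η f Φ) {t : ℝ} (ht : t ∈ Icc 0 T) :
    ContinuousOn (Φ 0 t) (tsupport f₀) ∧
      (volume.restrict (tsupport f₀)).map (Φ 0 t) = volume.restrict (Φ 0 t '' tsupport f₀) := by
  have h0 : (0 : ℝ) ∈ Icc 0 T := ⟨le_rfl, hT.le⟩
  have hdom := hs.support_subset_domain hT hd
  obtain ⟨δ, P, D, hδ, hP, hD, hb, -⟩ := hs.exists_speed_bound hT hd
  obtain ⟨B, C, hB, hC, hF⟩ := hs.exists_isForce hδ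
  have hsub : Icc 0 t ⊆ Icc 0 T := Icc_subset_Icc_right ht.2
  have hγ : ∀ p ∈ tsupport f₀, IsTrajectory t P
      (fun t x => field (f t) x + cutCoulomb δ (x - ξ t)) (fun s => Φ 0 s p) := by
    intro p hp
    refine ⟨fun s hst => ?_, fun s hst => ?_, fun s hst => (hb s (hsub hst) p hp).2⟩
    · exact (hs.flow_pos 0 h0 p (hdom hp) s (hsub hst)).mono hsub
    · rw [cutCoulomb_eq (hb s (hsub hst) p hp).1]
      exact (hs.flow_vel 0 h0 p (hdom hp) s (hsub hst)).mono hsub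
  have hz : ∀ p ∈ tsupport f₀, Φ 0 0 p = p := fun p hp => hs.flow_self 0 h0 p (hdom hp)
  exact ⟨(hF t ht).continuousOn_flow ht.1 hB hP hC (γ := fun p s => Φ 0 s p) hγ hz,
    (hF t ht).map_restrict ht.1 hB hP hC hd.compact.isCompact (γ := fun p s => Φ 0 s p) hγ hz
      ((hs.flow_bij 0 h0 t ht).injOn.mono hdom)⟩

end Solution

/-! ### Lagrangian description of solutions -/

/-- The Coulomb field of the measure `μ` transported by `z`. -/
def selfField (μ : Measure Phase) (z : Phase → Phase) (x : Space) : Space :=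
  ∫ p, coulomb (x - (z p).1) ∂μ

/-- Lagrangian form of the Vlasov-Poisson system with one unit point charge: `Z t p` is the phase
at time `t` of the particle labelled by `p ∈ A`, and `μ` is the distribution of the labels. -/
structure CharFlow (T : ℝ) (M : ℝ≥0) (A : Set Phase) (μ : Measure Phase) (ξ η : ℝ → Space)
    (Z : ℝ → Phase → Phase) : Prop where
  prob : IsProbabilityMeasure μ
  null : ∀ᵐ p ∂μ, p ∈ A
  measurable : Measurable fun q : ℝ × Phase => Z q.1 q.2
  measurable_charge : Measurable ξ ∧ Measurable η
  density : ∀ t ∈ Icc 0 T, μ.map (Z t) ≤ M • volume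
  charge_pos : ∀ t ∈ Icc 0 T, HasDerivWithinAt ξ (η t) (Icc 0 T) t
  charge_vel : ∀ t ∈ Icc 0 T, HasDerivWithinAt η (selfField μ (Z t) (ξ t)) (Icc 0 T) t
  pos : ∀ p ∈ A, ∀ t ∈ Icc 0 T, HasDerivWithinAt (fun s => (Z s p).1) (Z t p).2 (Icc 0 T) t
  vel : ∀ p ∈ A, ∀ t ∈ Icc 0 T, HasDerivWithinAt (fun s => (Z s p).2)
    (selfField μ (Z t) (Z t p).1 + coulomb ((Z t p).1 - ξ t)) (Icc 0 T) t
  speed : ∃ P, 0 ≤ P ∧ ∀ t ∈ Icc 0 T, ∀ p ∈ A, ‖(Z t p).2‖ ≤ P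
  away : ∃ δ, 0 < δ ∧ ∀ t ∈ Icc 0 T, ∀ p ∈ A, δ ≤ ‖(Z t p).1 - ξ t‖

/-- Above each position the velocities fill at most a ball of radius `P`, so a bounded phase density
has a bounded spatial density. -/
lemma map_fst_le {ν : Measure Phase} {M : ℝ≥0} (hν : ν ≤ M • volume) {P : ℝ}
    (hP : ∀ᵐ p ∂ν, ‖p.2‖ ≤ P) :
    ν.map Prod.fst ≤ (M * (volume (Metric.closedBall (0 : Space) P)).toNNReal) • volume := by
  refine Measure.le_iff.2 fun S hS => ?_
  rw [Measure.map_apply measurable_fst hS]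
  have h1 : ν (Prod.fst ⁻¹' S) ≤ ν (S ×ˢ Metric.closedBall (0 : Space) P) := by
    refine measure_mono_ae ?_
    filter_upwards [hP] with p hp hpS
    exact ⟨hpS, by simpa using hp⟩
  refine h1.trans ((hν _).trans_eq ?_)
  have h2 : ((volume (Metric.closedBall (0 : Space) P)).toNNReal : ℝ≥0∞)
      = volume (Metric.closedBall (0 : Space) P) :=
    ENNReal.coe_toNNReal measure_closedBall_lt_top.ne
  simp only [Measure.smul_apply, ENNReal.smul_def, smul_eq_mul, ENNReal.coe_mul, h2]
  rw [Measure.volume_eq_prod, Measure.prod_prod, mul_assoc, mul_comm (volume S)]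

lemma lintegral_inv_sq_fst_le {ν : Measure Phase} {B : ℝ≥0} (hν : ν.map Prod.fst ≤ B • volume)
    (hν1 : ν univ ≤ B) (x : Space) :
    ∫⁻ p, ENNReal.ofReal ((‖x - p.1‖ ^ 2)⁻¹) ∂ν ≤ ENNReal.ofReal (B * (sphereArea + 1)) := by
  have := lintegral_inv_sq_le hν (by rwa [Measure.map_apply measurable_fst .univ]) x
  rwa [lintegral_map (by fun_prop) measurable_fst] at this

lemma integrable_coulomb_fst {ν : Measure Phase} {B : ℝ≥0} (hν : ν.map Prod.fst ≤ B • volume)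
    (hν1 : ν univ ≤ B) (x : Space) : Integrable (fun p : Phase => coulomb (x - p.1)) ν := by
  refine ⟨((measurable_coulomb_sub x).comp measurable_fst).aestronglyMeasurable, ?_⟩
  rw [hasFiniteIntegral_iff_enorm]
  simp_rw [enorm_coulomb]
  exact (lintegral_inv_sq_fst_le hν hν1 x).trans_lt ENNReal.ofReal_lt_top

lemma continuousOn_invFunOn_image {A : Set Phase} (hA : IsCompact A) {Ψ : Phase → Phase}
    (hc : ContinuousOn Ψ A) (hinj : InjOn Ψ A) :
    ContinuousOn (Function.invFunOn Ψ A) (Ψ '' A) := by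
  rw [continuousOn_iff_isClosed]
  intro S hS
  refine ⟨Ψ '' (A ∩ S), ((hA.inter_right hS).image_of_continuousOn
    (hc.mono inter_subset_left)).isClosed, ?_⟩
  ext q
  constructor
  · rintro ⟨hq, p, hp, rfl⟩
    rw [mem_preimage, hinj.leftInvOn_invFunOn hp] at hq
    exact ⟨⟨p, ⟨hp, hq⟩, rfl⟩, ⟨p, hp, rfl⟩⟩
  · rintro ⟨⟨p, hp, rfl⟩, -⟩
    refine ⟨?_, ⟨p, hp.1, rfl⟩⟩
    rw [mem_preimage, hinj.leftInvOn_invFunOn hp.1]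
    exact hp.2

section Solution

variable {T : ℝ} {f₀ : Phase → ℝ} {ξ₀ η₀ : Space} {ξ η : ℝ → Space} {f : ℝ → Phase → ℝ}
  {Φ : ℝ → ℝ → Phase → Phase}

/-- The characteristics issued at time `0` from the support of the initial density. -/
def labelFlow (T : ℝ) (f₀ : Phase → ℝ) (Φ : ℝ → ℝ → Phase → Phase) (t : ℝ) (p : Phase) : Phase :=
  open Classical in (Icc 0 T ×ˢ tsupport f₀).piecewise (fun q : ℝ × Phase => Φ 0 q.1 q.2) 0 (t, p)

/-- The distribution of the labels. -/
def labelMeasure (f₀ : Phase → ℝ) : Measure Phase :=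
  volume.withDensity fun p => ENNReal.ofReal (f₀ p)

lemma labelFlow_eq {t : ℝ} (ht : t ∈ Icc 0 T) {p : Phase} (hp : p ∈ tsupport f₀) :
    labelFlow T f₀ Φ t p = Φ 0 t p := by
  classical
  exact piecewise_eq_of_mem _ _ _ (mk_mem_prod ht hp)

lemma IsSolution.continuousOn_flow (hT : 0 < T) (hd : IsInitialDatum f₀ ξ₀)
    (hs : IsSolution T f₀ ξ₀ η₀ ξ η f Φ) :
    ContinuousOn (fun q : ℝ × Phase => Φ 0 q.1 q.2) (Icc 0 T ×ˢ tsupport f₀) := by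
  have h0 : (0 : ℝ) ∈ Icc 0 T := ⟨le_rfl, hT.le⟩
  have hdom := hs.support_subset_domain hT hd
  obtain ⟨δ, P, D, hδ, hP, hD, hb, hlip⟩ := hs.exists_speed_bound hT hd
  refine continuousOn_prod_of_continuousOn_lipschitzOnWith _ (max P D).toNNReal
    (fun t ht => (hs.flow_transport hT hd ht).1) fun p hp => ?_
  refine LipschitzOnWith.of_dist_le_mul fun s hs' t ht => ?_
  rw [Real.coe_toNNReal _ (hP.trans (le_max_left _ _)), Prod.dist_eq, dist_eq_norm, dist_eq_norm,
    Real.dist_eq]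
  refine max_le ?_ ?_
  · have := (convex_Icc 0 T).norm_image_sub_le_of_norm_hasDerivWithin_le
      (fun r hr => hs.flow_pos 0 h0 p (hdom hp) r hr) (fun r hr => (hb r hr p hp).2) ht hs'
    refine this.trans ?_
    rw [Real.norm_eq_abs]
    gcongr
    exact le_max_left _ _
  · refine (hlip t ht s hs' p hp).trans ?_
    gcongr
    exact le_max_right _ _

lemma IsSolution.measurable_labelFlow (hT : 0 < T) (hd : IsInitialDatum f₀ ξ₀)
    (hs : IsSolution T f₀ ξ₀ η₀ ξ η f Φ) :
    Measurable fun q : ℝ × Phase => labelFlow T f₀ Φ q.1 q.2 := by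
  classical
  have := (hs.continuousOn_flow hT hd).measurable_piecewise (g := 0)
    continuous_zero.continuousOn (measurableSet_Icc.prod (isClosed_tsupport f₀).measurableSet)
  unfold labelFlow
  convert this

lemma IsSolution.support_eq (hT : 0 < T) (hd : IsInitialDatum f₀ ξ₀)
    (hs : IsSolution T f₀ ξ₀ η₀ ξ η f Φ) {t : ℝ} (ht : t ∈ Icc 0 T) :
    tsupport (f t) = Φ 0 t '' tsupport f₀ := by
  have h0 : (0 : ℝ) ∈ Icc 0 T := ⟨le_rfl, hT.le⟩
  have hdom := hs.support_subset_domain hT hd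
  have hc := (hs.flow_transport hT hd ht).1
  apply Subset.antisymm
  · refine closure_minimal ?_ (hd.compact.isCompact.image_of_continuousOn hc).isClosed
    intro q hq
    obtain ⟨p, hp, rfl⟩ := (hs.flow_bij 0 h0 t ht).surjOn
      (hs.supp_subset t ht (subset_tsupport _ hq))
    refine ⟨p, subset_tsupport _ ?_, rfl⟩
    rw [Function.mem_support] at hq ⊢
    rwa [hs.transport t ht p hp] at hq
  · refine (ContinuousOn.image_closure hc).trans (closure_mono ?_)
    rintro _ ⟨p, hp, rfl⟩
    rw [Function.mem_support] at hp ⊢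
    rwa [hs.transport t ht p (hdom (subset_tsupport _ hp))]

lemma IsSolution.nonneg (hT : 0 < T) (hd : IsInitialDatum f₀ ξ₀)
    (hs : IsSolution T f₀ ξ₀ η₀ ξ η f Φ) {t : ℝ} (ht : t ∈ Icc 0 T) (q : Phase) : 0 ≤ f t q := by
  by_cases hq : q ∈ tsupport (f t)
  · rw [hs.support_eq hT hd ht] at hq
    obtain ⟨p, hp, rfl⟩ := hq
    rw [hs.transport t ht p (hs.support_subset_domain hT hd hp)]
    exact hd.density.nonneg p
  · rw [image_eq_zero_of_notMem_tsupport hq]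

lemma ae_labelMeasure_mem (f₀ : Phase → ℝ) : ∀ᵐ p ∂(labelMeasure f₀), p ∈ tsupport f₀ := by
  have hm := (isClosed_tsupport f₀).measurableSet
  rw [ae_iff]
  change labelMeasure f₀ (tsupport f₀)ᶜ = 0
  rw [labelMeasure, withDensity_apply _ hm.compl, setLIntegral_eq_zero_iff' hm.compl]
  · exact .of_forall fun p hp => by rw [image_eq_zero_of_notMem_tsupport hp]; simp
  · refine AEMeasurable.congr (f := fun _ => 0) aemeasurable_const ?_
    filter_upwards [ae_restrict_mem hm.compl] with p hp
    rw [image_eq_zero_of_notMem_tsupport hp]; simp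

lemma labelMeasure_eq_restrict (f₀ : Phase → ℝ) : labelMeasure f₀
    = (volume.restrict (tsupport f₀)).withDensity fun p => ENNReal.ofReal (f₀ p) := by
  rw [← restrict_withDensity (isClosed_tsupport f₀).measurableSet]
  exact (Measure.restrict_eq_self_of_ae_mem (ae_labelMeasure_mem f₀)).symm

/-- Joint measurability gives measurable time slices for almost every time only. At every time the
density is `f₀` composed with the inverse flow, and the composition is legitimate because the
inverse flow also transports the Lebesgue measure. -/
lemma IsSolution.aemeasurable_density (hT : 0 < T) (hd : IsInitialDatum f₀ ξ₀)
    (hs : IsSolution T f₀ ξ₀ η₀ ξ η f Φ) {t : ℝ} (ht : t ∈ Icc 0 T) :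
    AEMeasurable (f t) (volume.restrict (tsupport (f t))) := by
  have h0 : (0 : ℝ) ∈ Icc 0 T := ⟨le_rfl, hT.le⟩
  have hdom := hs.support_subset_domain hT hd
  have hK := hd.compact.isCompact
  obtain ⟨hc, hmap⟩ := hs.flow_transport hT hd ht
  have hinj := (hs.flow_bij 0 h0 t ht).injOn.mono hdom
  rw [hs.support_eq hT hd ht]
  have hKt := hK.image_of_continuousOn hc
  set κ := Function.invFunOn (Φ 0 t) (tsupport f₀) with hκ
  have hκm : AEMeasurable κ (volume.restrict (Φ 0 t '' tsupport f₀)) :=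
    (continuousOn_invFunOn_image hK hc hinj).aemeasurable hKt.measurableSet
  have hκmap : (volume.restrict (Φ 0 t '' tsupport f₀)).map κ = volume.restrict (tsupport f₀) := by
    rw [← hmap] at hκm ⊢
    rw [AEMeasurable.map_map_of_aemeasurable hκm (hc.aemeasurable hK.measurableSet)]
    conv_rhs => rw [← Measure.map_id (μ := volume.restrict (tsupport f₀))]
    refine Measure.map_congr ?_
    filter_upwards [ae_restrict_mem hK.measurableSet] with p hp
    exact hinj.leftInvOn_invFunOn hp
  have h1 : AEMeasurable (f₀ ∘ κ) (volume.restrict (Φ 0 t '' tsupport f₀)) := by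
    refine AEMeasurable.comp_aemeasurable ?_ hκm
    rw [hκmap]
    exact hd.density.integrable.aestronglyMeasurable.aemeasurable.restrict
  refine h1.congr ?_
  filter_upwards [ae_restrict_mem hKt.measurableSet] with q hq
  obtain ⟨p, hp, rfl⟩ := hq
  rw [Function.comp_apply, hκ, hinj.leftInvOn_invFunOn hp, hs.transport t ht p (hdom hp)]

lemma IsSolution.aemeasurable_ofReal (hT : 0 < T) (hd : IsInitialDatum f₀ ξ₀)
    (hs : IsSolution T f₀ ξ₀ η₀ ξ η f Φ) {t : ℝ} (ht : t ∈ Icc 0 T) :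
    AEMeasurable (f t) volume := by
  have h1 := hs.aemeasurable_density hT hd ht
  rw [← aemeasurable_indicator_iff (isClosed_tsupport _).measurableSet] at h1
  rwa [indicator_eq_self.2 (subset_tsupport _)] at h1

/-- The density at time `t` is the image of the initial one under the characteristic flow. -/
lemma IsSolution.map_labelFlow (hT : 0 < T) (hd : IsInitialDatum f₀ ξ₀)
    (hs : IsSolution T f₀ ξ₀ η₀ ξ η f Φ) {t : ℝ} (ht : t ∈ Icc 0 T) :
    (labelMeasure f₀).map (labelFlow T f₀ Φ t) = labelMeasure (f t) := by
  have hdom := hs.support_subset_domain hT hd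
  have hK := hd.compact.isCompact
  obtain ⟨hc, hmap⟩ := hs.flow_transport hT hd ht
  have hZ : Measurable (labelFlow T f₀ Φ t) :=
    (hs.measurable_labelFlow hT hd).comp measurable_prodMk_left
  have hΦ : AEMeasurable (Φ 0 t) (volume.restrict (tsupport f₀)) :=
    hc.aemeasurable hK.measurableSet
  ext S hS
  rw [Measure.map_apply hZ hS, labelMeasure_eq_restrict f₀, labelMeasure_eq_restrict (f t),
    hs.support_eq hT hd ht, ← hmap, withDensity_apply _ (hZ hS), withDensity_apply _ hS,
    ← lintegral_indicator (hZ hS), ← lintegral_indicator hS, lintegral_map' _ hΦ]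
  · refine setLIntegral_congr_fun hK.measurableSet fun p hp => ?_
    have h : p ∈ labelFlow T f₀ Φ t ⁻¹' S ↔ Φ 0 t p ∈ S := by
      rw [mem_preimage, labelFlow_eq ht hp]
    by_cases hm : Φ 0 t p ∈ S
    · simp only [indicator_of_mem hm, indicator_of_mem (h.2 hm), hs.transport t ht p (hdom hp)]
    · simp only [indicator_of_notMem hm, indicator_of_notMem (mt h.1 hm)]
  · rw [hmap, ← hs.support_eq hT hd ht]
    exact ((hs.aemeasurable_density hT hd ht).ennreal_ofReal).indicator hS

lemma IsInitialDatum.isProbabilityMeasure (hd : IsInitialDatum f₀ ξ₀) :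
    IsProbabilityMeasure (labelMeasure f₀) := by
  refine ⟨?_⟩
  rw [labelMeasure, withDensity_apply _ .univ, Measure.restrict_univ,
    ← ofReal_integral_eq_lintegral_ofReal hd.density.integrable
      (.of_forall hd.density.nonneg), hd.density.integral_eq_one, ENNReal.ofReal_one]

lemma IsInitialDatum.labelMeasure_le (hd : IsInitialDatum f₀ ξ₀) {M : ℝ}
    (hM : eLpNorm f₀ ⊤ volume = ENNReal.ofReal M) : labelMeasure f₀ ≤ M.toNNReal • volume :=
  withDensity_ofReal_le hd.density.nonneg hM.le

lemma IsSolution.density_le (hT : 0 < T) (hd : IsInitialDatum f₀ ξ₀)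
    (hs : IsSolution T f₀ ξ₀ η₀ ξ η f Φ) {M : ℝ} (hM : eLpNorm f₀ ⊤ volume = ENNReal.ofReal M)
    {t : ℝ} (ht : t ∈ Icc 0 T) :
    (labelMeasure f₀).map (labelFlow T f₀ Φ t) ≤ M.toNNReal • volume := by
  have hK := hd.compact.isCompact
  obtain ⟨hc, hmap⟩ := hs.flow_transport hT hd ht
  have hZ : Measurable (labelFlow T f₀ Φ t) :=
    (hs.measurable_labelFlow hT hd).comp measurable_prodMk_left
  have h1 : labelMeasure f₀ ≤ M.toNNReal • volume.restrict (tsupport f₀) := by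
    have h := Measure.restrict_mono (Subset.refl (tsupport f₀)) (hd.labelMeasure_le hM)
    rwa [Measure.restrict_eq_self_of_ae_mem (ae_labelMeasure_mem f₀), Measure.restrict_smul] at h
  refine (Measure.map_mono h1 hZ).trans ?_
  have h2 : (volume.restrict (tsupport f₀)).map (labelFlow T f₀ Φ t)
      = (volume.restrict (tsupport f₀)).map (Φ 0 t) := by
    refine Measure.map_congr ?_
    filter_upwards [ae_restrict_mem hK.measurableSet] with p hp using labelFlow_eq ht hp
  rw [Measure.map_smul, h2, hmap]
  gcongr
  exact Measure.restrict_le_self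

lemma IsSolution.exists_marginal_bound (hT : 0 < T) (hd : IsInitialDatum f₀ ξ₀)
    (hs : IsSolution T f₀ ξ₀ η₀ ξ η f Φ) {M : ℝ} (hM : eLpNorm f₀ ⊤ volume = ENNReal.ofReal M) :
    ∃ B : ℝ≥0, 1 ≤ B ∧ ∀ t ∈ Icc 0 T, (labelMeasure (f t)).map Prod.fst ≤ B • volume ∧
      labelMeasure (f t) univ ≤ B := by
  obtain ⟨δ, P, D, hδ, hP, hD, hb, -⟩ := hs.exists_speed_bound hT hd
  have hprob := hd.isProbabilityMeasure
  set B₀ : ℝ≥0 := M.toNNReal * (volume (Metric.closedBall (0 : Space) P)).toNNReal with hB₀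
  refine ⟨max B₀ 1, le_max_right _ _, fun t ht => ?_⟩
  have hZ : Measurable (labelFlow T f₀ Φ t) :=
    (hs.measurable_labelFlow hT hd).comp measurable_prodMk_left
  have hle := hs.density_le hT hd hM ht
  rw [← hs.map_labelFlow hT hd ht]
  refine ⟨(map_fst_le hle (P := P) ?_).trans ?_, ?_⟩
  · rw [ae_map_iff hZ.aemeasurable (measurableSet_le (by fun_prop) (by fun_prop))]
    filter_upwards [ae_labelMeasure_mem f₀] with p hp
    rw [labelFlow_eq ht hp]
    exact (hb t ht p hp).2
  · rw [← hB₀]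
    gcongr
    exact le_max_left _ _
  · rw [Measure.map_apply hZ .univ, preimage_univ, measure_univ]
    exact_mod_cast le_max_right _ _

/-- Integrate out the velocity, then change variables by `map_labelFlow`; the bound on the spatial
marginal provides the integrability for Fubini. The identity holds at every time and position, which
upgrades the almost everywhere bounds on solutions to bounds at all times. -/
lemma IsSolution.field_eq (hT : 0 < T) (hd : IsInitialDatum f₀ ξ₀)
    (hs : IsSolution T f₀ ξ₀ η₀ ξ η f Φ) {M : ℝ} (hM : eLpNorm f₀ ⊤ volume = ENNReal.ofReal M)
    {t : ℝ} (ht : t ∈ Icc 0 T) (x : Space) :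
    field (f t) x = selfField (labelMeasure f₀) (labelFlow T f₀ Φ t) x := by
  obtain ⟨B, -, hB⟩ := hs.exists_marginal_bound hT hd hM
  obtain ⟨hB1, hB2⟩ := hB t ht
  have hZ : Measurable (labelFlow T f₀ Φ t) :=
    (hs.measurable_labelFlow hT hd).comp measurable_prodMk_left
  have hcm : Measurable fun q : Phase => coulomb (x - q.1) :=
    (measurable_coulomb_sub x).comp measurable_fst
  have hfm := hs.aemeasurable_ofReal hT hd ht
  have hintg := integrable_coulomb_fst hB1 hB2 x
  rw [selfField, ← integral_map (φ := labelFlow T f₀ Φ t) hZ.aemeasurable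
    (f := fun q : Phase => coulomb (x - q.1)) hcm.aestronglyMeasurable,
    hs.map_labelFlow hT hd ht, labelMeasure,
    integral_withDensity_eq_integral_toReal_smul₀ hfm.ennreal_ofReal (by simp)]
  have hi2 : Integrable (fun q : Phase => f t q • coulomb (x - q.1)) := by
    rw [labelMeasure, integrable_withDensity_iff_integrable_smul₀' hfm.ennreal_ofReal
      (by simp)] at hintg
    simpa only [ENNReal.toReal_ofReal (hs.nonneg hT hd ht _)] using hintg
  simp only [ENNReal.toReal_ofReal (hs.nonneg hT hd ht _)]
  rw [Measure.volume_eq_prod] at hi2 ⊢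
  rw [integral_prod _ hi2]
  simp only [integral_smul_const]
  rfl

/-- Solutions in Lagrangian form; the motion of the charge is extended by zero. -/
lemma IsSolution.charFlow (hT : 0 < T) (hd : IsInitialDatum f₀ ξ₀)
    (hs : IsSolution T f₀ ξ₀ η₀ ξ η f Φ) {M : ℝ} (hM : eLpNorm f₀ ⊤ volume = ENNReal.ofReal M) :
    CharFlow T M.toNNReal (tsupport f₀) (labelMeasure f₀) ((Icc 0 T).indicator ξ)
      ((Icc 0 T).indicator η) (labelFlow T f₀ Φ) := by
  have h0 : (0 : ℝ) ∈ Icc 0 T := ⟨le_rfl, hT.le⟩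
  have hdom := hs.support_subset_domain hT hd
  have hmeas : ∀ {g g' : ℝ → Space}, (∀ t ∈ Icc 0 T, HasDerivWithinAt g (g' t) (Icc 0 T) t) →
      Measurable ((Icc 0 T).indicator g) := by
    classical
    intro g g' hg
    have hc : ContinuousOn g (Icc 0 T) := fun t ht => (hg t ht).continuousWithinAt
    have := hc.measurable_piecewise (g := 0) continuous_zero.continuousOn
      (measurableSet_Icc (a := (0 : ℝ)) (b := T))
    rwa [piecewise_eq_indicator] at this
  obtain ⟨δ, P, D, hδ, hP, hD, hb, -⟩ := hs.exists_speed_bound hT hd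
  refine ⟨hd.isProbabilityMeasure, ae_labelMeasure_mem f₀, hs.measurable_labelFlow hT hd,
    ⟨hmeas hs.charge_pos, hmeas hs.charge_vel⟩,
    fun t ht => hs.density_le hT hd hM ht, fun t ht => ?_, fun t ht => ?_, fun p hp t ht => ?_,
    fun p hp t ht => ?_, ⟨P, hP, fun t ht p hp => ?_⟩, ⟨δ, hδ, fun t ht p hp => ?_⟩⟩
  · rw [indicator_of_mem ht]
    exact (hs.charge_pos t ht).congr (fun s hs' => indicator_of_mem hs' _) (indicator_of_mem ht _)
  · rw [indicator_of_mem ht, ← hs.field_eq hT hd hM ht]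
    exact (hs.charge_vel t ht).congr (fun s hs' => indicator_of_mem hs' _) (indicator_of_mem ht _)
  · rw [labelFlow_eq ht hp]
    exact (hs.flow_pos 0 h0 p (hdom hp) t ht).congr (fun s hs' => by rw [labelFlow_eq hs' hp])
      (by rw [labelFlow_eq ht hp])
  · rw [← hs.field_eq hT hd hM ht, labelFlow_eq ht hp, indicator_of_mem ht]
    exact (hs.flow_vel 0 h0 p (hdom hp) t ht).congr (fun s hs' => by rw [labelFlow_eq hs' hp])
      (by rw [labelFlow_eq ht hp])
  · rw [labelFlow_eq ht hp]; exact (hb t ht p hp).2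
  · rw [labelFlow_eq ht hp, indicator_of_mem ht]; exact (hb t ht p hp).1

end Solution

/-! ### Regularized Coulomb interaction -/

/-- Regularization of the Coulomb potential. -/
def regPot (ε : ℝ) (z : Space) : ℝ := (√(‖z‖ ^ 2 + ε ^ 2))⁻¹

/-- Regularization of the Coulomb kernel. -/
def regCoulomb (ε : ℝ) (z : Space) : Space := ((√(‖z‖ ^ 2 + ε ^ 2)) ^ 3)⁻¹ • z

lemma regPot_zero (z : Space) : regPot 0 z = ‖z‖⁻¹ := by simp [regPot]

lemma regCoulomb_zero (z : Space) : regCoulomb 0 z = coulomb z := by simp [regCoulomb, coulomb]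

lemma regCoulomb_neg (ε : ℝ) (z : Space) : regCoulomb ε (-z) = -regCoulomb ε z := by
  simp [regCoulomb]

lemma measurable_regPot (ε : ℝ) : Measurable (regPot ε) := by unfold regPot; fun_prop

lemma measurable_regCoulomb (ε : ℝ) : Measurable (regCoulomb ε) := by unfold regCoulomb; fun_prop

lemma le_sqrt_reg (ε : ℝ) (z : Space) : ε ≤ √(‖z‖ ^ 2 + ε ^ 2) := by
  apply Real.le_sqrt_of_sq_le; nlinarith [sq_nonneg ‖z‖]

lemma norm_le_sqrt_reg (ε : ℝ) (z : Space) : ‖z‖ ≤ √(‖z‖ ^ 2 + ε ^ 2) := by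
  apply Real.le_sqrt_of_sq_le; nlinarith [sq_nonneg ε]

lemma regPot_nonneg (ε : ℝ) (z : Space) : 0 ≤ regPot ε z := by unfold regPot; positivity

lemma regPot_le {ε : ℝ} (hε : 0 < ε) (z : Space) : regPot ε z ≤ ε⁻¹ := by
  unfold regPot
  have := le_sqrt_reg ε z
  gcongr

lemma norm_regCoulomb_le {ε : ℝ} (hε : 0 < ε) (z : Space) : ‖regCoulomb ε z‖ ≤ (ε ^ 2)⁻¹ := by
  have h1 := le_sqrt_reg ε z
  have h2 := norm_le_sqrt_reg ε z
  have h3 : 0 < √(‖z‖ ^ 2 + ε ^ 2) := hε.trans_le h1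
  rw [regCoulomb, norm_smul, Real.norm_eq_abs, abs_of_pos (by positivity)]
  calc _ ≤ ((√(‖z‖ ^ 2 + ε ^ 2)) ^ 3)⁻¹ * √(‖z‖ ^ 2 + ε ^ 2) := by gcongr
    _ = ((√(‖z‖ ^ 2 + ε ^ 2)) ^ 2)⁻¹ := by field_simp
    _ ≤ _ := by gcongr

/-- The first bound is integrable near the origin, the second is small away from it. With `ε = r ^
4` and the cut at radius `r`, both regions contribute `O(r)`. -/
lemma norm_coulomb_sub_regCoulomb_le {ε : ℝ} (hε : 0 < ε) (z : Space) :
    ‖coulomb z - regCoulomb ε z‖ ≤ (‖z‖ ^ 2)⁻¹ ∧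
      ‖coulomb z - regCoulomb ε z‖ ≤ 3 * ε * (‖z‖ ^ 3)⁻¹ := by
  rcases (norm_nonneg z).eq_or_lt with hz | hz
  · have : z = 0 := norm_eq_zero.1 hz.symm
    simp [this, coulomb, regCoulomb]
  set s := √(‖z‖ ^ 2 + ε ^ 2) with hs
  set a := ‖z‖ with ha
  have h1 : a ≤ s := norm_le_sqrt_reg ε z
  have h2 : s ≤ a + ε := by
    rw [hs, Real.sqrt_le_left (by positivity)]
    nlinarith
  have hs0 : 0 < s := hz.trans_le h1
  have e : coulomb z - regCoulomb ε z = ((a ^ 3)⁻¹ - (s ^ 3)⁻¹) • z := by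
    rw [coulomb, regCoulomb, sub_smul]
  have h3 : (s ^ 3)⁻¹ ≤ (a ^ 3)⁻¹ := by gcongr
  rw [e, norm_smul, Real.norm_eq_abs, abs_of_nonneg (sub_nonneg.2 h3), ← ha]
  constructor
  · have : ((a ^ 3)⁻¹ - (s ^ 3)⁻¹) * a ≤ (a ^ 3)⁻¹ * a := by
      gcongr
      have : 0 < (s ^ 3)⁻¹ := by positivity
      linarith
    refine this.trans_eq ?_
    field_simp
  · have e2 : ((a ^ 3)⁻¹ - (s ^ 3)⁻¹) * a
        = (s - a) * (s ^ 2 + s * a + a ^ 2) * (a ^ 2 * s ^ 3)⁻¹ := by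
      field_simp
      ring
    rw [e2]
    calc _ ≤ ε * (s ^ 2 + s * s + s ^ 2) * (a ^ 2 * s ^ 3)⁻¹ := by
          gcongr
          · linarith
      _ = 3 * ε * (a ^ 2 * s)⁻¹ := by field_simp; ring
      _ ≤ 3 * ε * (a ^ 2 * a)⁻¹ := by gcongr
      _ = _ := by ring

lemma hasDerivWithinAt_regPot {ε : ℝ} {D : ℝ → Space} {D' : Space} {s : Set ℝ} {t : ℝ}
    (hD : HasDerivWithinAt D D' s t) (h : 0 < ‖D t‖ ^ 2 + ε ^ 2) :
    HasDerivWithinAt (fun r => regPot ε (D r)) (-inner ℝ (regCoulomb ε (D t)) D') s t := by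
  have h1 : HasDerivWithinAt (fun r => ‖D r‖ ^ 2 + ε ^ 2) (2 * inner ℝ (D t) D') s t :=
    hD.norm_sq.add_const _
  have h2 := (h1.sqrt h.ne').inv (Real.sqrt_pos.2 h).ne'
  refine h2.congr_deriv ?_
  have h3 : 0 < √(‖D t‖ ^ 2 + ε ^ 2) := Real.sqrt_pos.2 h
  rw [regCoulomb, inner_smul_left]
  simp only [conj_trivial]
  field_simp

/-! ### Conservation of energy -/

/-- Fundamental theorem of calculus under the integral sign. -/
lemma integral_sub_integral_eq {α : Type*} [MeasurableSpace α] {ν : Measure α} [IsFiniteMeasure ν]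
    {g g' : ℝ → α → ℝ} {t C : ℝ} (ht : 0 ≤ t) (hm : Measurable fun q : ℝ × α => g' q.1 q.2)
    (hd : ∀ᵐ a ∂ν, ∀ s ∈ Icc 0 t, HasDerivWithinAt (fun s => g s a) (g' s a) (Icc 0 t) s)
    (hC : ∀ᵐ a ∂ν, ∀ s ∈ Icc 0 t, ‖g' s a‖ ≤ C) (h0 : Integrable (g 0) ν)
    (h1 : Integrable (g t) ν) :
    (∫ a, g t a ∂ν) - ∫ a, g 0 a ∂ν = ∫ s in 0..t, ∫ a, g' s a ∂ν := by
  rw [← integral_sub h1 h0, intervalIntegral.integral_of_le ht]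
  have hi : Integrable (Function.uncurry fun a s => g' s a)
      (ν.prod (volume.restrict (Ioc 0 t))) := by
    have hm' : Measurable (Function.uncurry fun a s => g' s a) := hm.comp measurable_swap
    refine Integrable.of_bound hm'.aestronglyMeasurable C ?_
    rw [Measure.ae_prod_iff_ae_ae (measurableSet_le hm'.norm measurable_const)]
    filter_upwards [hC] with a ha
    filter_upwards [ae_restrict_mem measurableSet_Ioc] with s hs
    exact ha s (Ioc_subset_Icc_self hs)
  rw [← integral_integral_swap hi]
  refine integral_congr_ae ?_
  filter_upwards [hd, hC] with a ha hCa
  rw [← intervalIntegral.integral_of_le ht,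
    integral_eq_sub_of_hasDerivWithinAt ht ha (.of_forall hCa)]

namespace CharFlow

variable {T : ℝ} {M : ℝ≥0} {A : Set Phase} {μ : Measure Phase} {ξ η : ℝ → Space}
  {Z : ℝ → Phase → Phase}

lemma measurable_at (h : CharFlow T M A μ ξ η Z) (t : ℝ) : Measurable (Z t) :=
  h.measurable.comp measurable_prodMk_left

lemma exists_marginal_bound (h : CharFlow T M A μ ξ η Z) :
    ∃ B : ℝ≥0, ∀ t ∈ Icc 0 T, (μ.map (Z t)).map Prod.fst ≤ B • volume ∧
      μ.map (Z t) univ ≤ B := by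
  have := h.prob
  obtain ⟨P, hP, hb⟩ := h.speed
  set B₀ : ℝ≥0 := M * (volume (Metric.closedBall (0 : Space) P)).toNNReal with hB₀
  refine ⟨max B₀ 1, fun t ht => ⟨(map_fst_le (h.density t ht) (P := P) ?_).trans ?_, ?_⟩⟩
  · rw [ae_map_iff (h.measurable_at t).aemeasurable (measurableSet_le (by fun_prop) (by fun_prop))]
    filter_upwards [h.null] with p hp using hb t ht p hp
  · rw [← hB₀]
    gcongr
    exact le_max_left _ _
  · rw [Measure.map_apply (h.measurable_at t) .univ, preimage_univ, measure_univ]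
    exact_mod_cast le_max_right _ _

lemma measurable_selfField (h : CharFlow T M A μ ξ η Z) :
    Measurable fun r : ℝ × Space => selfField μ (Z r.1) r.2 := by
  have := h.prob
  have hm : Measurable fun q : (ℝ × Space) × Phase => coulomb (q.1.2 - (Z q.1.1 q.2).1) := by
    have hZ : Measurable fun q : (ℝ × Space) × Phase => Z q.1.1 q.2 :=
      h.measurable.comp (f := fun q : (ℝ × Space) × Phase => (q.1.1, q.2)) (by fun_prop)
    exact measurable_coulomb.comp ((measurable_snd.comp measurable_fst).sub
      (measurable_fst.comp hZ))
  exact (hm.stronglyMeasurable.integral_prod_right').measurable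

/-- Total absolute field. -/
def absField (μ : Measure Phase) (z : Phase → Phase) (x : Space) : ℝ≥0∞ :=
  ∫⁻ p, ENNReal.ofReal ((‖x - (z p).1‖ ^ 2)⁻¹) ∂μ

lemma enorm_selfField_le (μ : Measure Phase) (z : Phase → Phase) (x : Space) :
    ‖selfField μ z x‖ₑ ≤ absField μ z x := by
  refine (enorm_integral_le_lintegral_enorm _).trans_eq ?_
  simp_rw [enorm_coulomb]
  rfl

lemma absField_eq_map (h : CharFlow T M A μ ξ η Z) (t : ℝ) (x : Space) :
    absField μ (Z t) x = ∫⁻ p, ENNReal.ofReal ((‖x - p.1‖ ^ 2)⁻¹) ∂(μ.map (Z t)) := by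
  rw [lintegral_map (by fun_prop) (h.measurable_at t)]
  rfl

lemma integrable_coulomb (h : CharFlow T M A μ ξ η Z) {t : ℝ} (ht : t ∈ Icc 0 T) (x : Space) :
    Integrable (fun p => coulomb (x - (Z t p).1)) μ := by
  obtain ⟨B, hB⟩ := h.exists_marginal_bound
  have := integrable_coulomb_fst (hB t ht).1 (hB t ht).2 x
  exact this.comp_measurable (h.measurable_at t)

lemma exists_field_bound (h : CharFlow T M A μ ξ η Z) :
    ∃ S : ℝ, 0 ≤ S ∧ ∀ t ∈ Icc 0 T, ∀ x, ‖selfField μ (Z t) x‖ ≤ S := by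
  have hA := sphereArea_nonneg
  obtain ⟨B, hB⟩ := h.exists_marginal_bound
  refine ⟨B * (sphereArea + 1), by positivity, fun t ht x => ?_⟩
  have h1 := (enorm_selfField_le μ (Z t) x).trans_eq (h.absField_eq_map t x)
  have h2 := h1.trans (lintegral_inv_sq_fst_le (hB t ht).1 (hB t ht).2 x)
  rwa [← ofReal_norm, ENNReal.ofReal_le_ofReal_iff (by positivity)] at h2

/-- The field converges uniformly when the kernel is regularized. -/
lemma exists_reg_field_bound (h : CharFlow T M A μ ξ η Z) :
    ∃ S : ℝ, 0 ≤ S ∧ ∀ t ∈ Icc 0 T, ∀ x, ∀ r : ℝ, 0 < r →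
      ‖selfField μ (Z t) x - ∫ p, regCoulomb (r ^ 4) (x - (Z t p).1) ∂μ‖ ≤ S * r := by
  have := h.prob
  have hA := sphereArea_nonneg
  obtain ⟨B, hB⟩ := h.exists_marginal_bound
  refine ⟨B * sphereArea + 3, by positivity, fun t ht x r hr => ?_⟩
  have hε : 0 < r ^ 4 := by positivity
  have hreg : Integrable (fun p => regCoulomb (r ^ 4) (x - (Z t p).1)) μ := by
    refine Integrable.of_bound ((measurable_regCoulomb _).comp (measurable_const.sub
      (measurable_fst.comp (h.measurable_at t)))).aestronglyMeasurable (((r ^ 4) ^ 2)⁻¹) ?_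
    exact .of_forall fun p => norm_regCoulomb_le hε _
  rw [selfField, ← integral_sub (h.integrable_coulomb ht x) hreg]
  set σ := (μ.map (Z t)).map Prod.fst with hσ
  have hk : Measurable fun z : Space => ‖coulomb (x - z) - regCoulomb (r ^ 4) (x - z)‖ₑ :=
    ((measurable_coulomb_sub x).sub ((measurable_regCoulomb _).comp (by fun_prop))).enorm
  have h1 : ‖∫ p, (coulomb (x - (Z t p).1) - regCoulomb (r ^ 4) (x - (Z t p).1)) ∂μ‖ₑ
      ≤ ∫⁻ z, ‖coulomb (x - z) - regCoulomb (r ^ 4) (x - z)‖ₑ ∂σ := by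
    rw [hσ, lintegral_map hk measurable_fst,
      lintegral_map (f := fun a : Phase => ‖coulomb (x - a.1) - regCoulomb (r ^ 4) (x - a.1)‖ₑ)
        (hk.comp measurable_fst) (h.measurable_at t)]
    exact enorm_integral_le_lintegral_enorm _
  have h2 : ∫⁻ z, ‖coulomb (x - z) - regCoulomb (r ^ 4) (x - z)‖ₑ ∂σ
      ≤ ENNReal.ofReal ((B * sphereArea + 3) * r) := by
    rw [← lintegral_add_compl _ (measurableSet_ball (x := x) (ε := r))]
    calc _ ≤ (B : ℝ≥0∞) * ENNReal.ofReal (sphereArea * r) + ENNReal.ofReal (3 * r) := by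
          gcongr
          · calc _ ≤ ∫⁻ z in Metric.ball x r, ENNReal.ofReal ((‖x - z‖ ^ 2)⁻¹) ∂(B • volume) := by
                  refine lintegral_mono' (Measure.restrict_mono le_rfl (hB t ht).1) fun z => ?_
                  rw [← ofReal_norm]
                  exact ENNReal.ofReal_le_ofReal (norm_coulomb_sub_regCoulomb_le hε _).1
              _ = B * ∫⁻ z in Metric.ball x r, ENNReal.ofReal ((‖x - z‖ ^ 2)⁻¹) := by
                  rw [Measure.restrict_smul, lintegral_smul_measure]; rfl
              _ ≤ _ := by gcongr; exact lintegral_ball_inv_sq_le x hr.le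
          · calc _ ≤ ∫⁻ z in (Metric.ball x r)ᶜ, ENNReal.ofReal (3 * r) ∂σ := by
                  refine setLIntegral_mono measurable_const fun z hz => ?_
                  have hz' : r ≤ ‖x - z‖ := by
                    rwa [mem_compl_iff, Metric.mem_ball, dist_comm, dist_eq_norm, not_lt] at hz
                  rw [← ofReal_norm]
                  refine ENNReal.ofReal_le_ofReal
                    ((norm_coulomb_sub_regCoulomb_le hε _).2.trans ?_)
                  calc _ ≤ 3 * r ^ 4 * (r ^ 3)⁻¹ := by gcongr
                    _ = 3 * r := by field_simp
              _ ≤ ENNReal.ofReal (3 * r) * σ univ := by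
                  rw [lintegral_const]
                  gcongr
                  exact Measure.restrict_le_self
              _ = _ := by
                  rw [hσ, Measure.map_apply measurable_fst .univ, preimage_univ,
                    Measure.map_apply (h.measurable_at t) .univ, preimage_univ, measure_univ,
                    mul_one]
      _ = _ := by
          rw [← ENNReal.ofReal_coe_nnreal, ← ENNReal.ofReal_mul (by positivity),
            ← ENNReal.ofReal_add (by positivity) (by positivity)]
          congr 1
          ring
  have h3 := h1.trans h2
  rwa [← ofReal_norm, ENNReal.ofReal_le_ofReal_iff (by positivity)] at h3

/-- Energy of the particles in the field of the charge. -/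
def labelEnergy (Z : ℝ → Phase → Phase) (ξ : ℝ → Space) (t : ℝ) (p : Phase) : ℝ :=
  ‖(Z t p).2‖ ^ 2 / 2 + ‖(Z t p).1 - ξ t‖⁻¹

lemma integrable_labelEnergy (h : CharFlow T M A μ ξ η Z) {t : ℝ} (ht : t ∈ Icc 0 T) :
    Integrable (labelEnergy Z ξ t) μ := by
  have := h.prob
  obtain ⟨P, hP, hb⟩ := h.speed
  obtain ⟨δ, hδ, ha⟩ := h.away
  have hm := h.measurable_at t
  refine Integrable.of_bound (C := P ^ 2 / 2 + δ⁻¹) ?_ ?_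
  · unfold labelEnergy
    exact Measurable.aestronglyMeasurable (by fun_prop)
  · filter_upwards [h.null] with p hp
    have h1 := hb t ht p hp
    have h2 := ha t ht p hp
    rw [Real.norm_eq_abs, abs_of_nonneg (by unfold labelEnergy; positivity)]
    unfold labelEnergy
    gcongr

/-- The power of an odd pair interaction and of external forces, for a distribution `μ` of
particles with positions `X`, velocities `V` and subject to the forces `E`. -/
lemma integral_power_eq {α : Type*} [MeasurableSpace α] {μ : Measure α} [IsProbabilityMeasure μ]
    {X V E W : α → Space} {k : Space → Space} {D P S : ℝ} (hX : Measurable X) (hV : Measurable V)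
    (hE : Measurable E) (hk : Measurable k) (hodd : ∀ z, k (-z) = -k z) (hkD : ∀ z, ‖k z‖ ≤ D)
    (hVP : ∀ᵐ p ∂μ, ‖V p‖ ≤ P) (hES : ∀ p, ‖E p‖ ≤ S) (hW : Integrable W μ) {e c : Space}
    (hWe : ∫ p, W p ∂μ = -e) :
    ∫ z : α × α, (inner ℝ (V z.1) (E z.1) + inner ℝ (W z.1) c + inner ℝ c e
        - inner ℝ (k (X z.1 - X z.2)) (V z.1 - V z.2) / 2) ∂(μ.prod μ)
      = ∫ p, (inner ℝ (V p) (E p - ∫ q, k (X p - X q) ∂μ) : ℝ) ∂μ := by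
  have hD : 0 ≤ D := (norm_nonneg _).trans (hkD 0)
  have i1 : Integrable (fun p => (inner ℝ (V p) (E p) : ℝ)) μ := by
    refine Integrable.of_bound (hV.inner hE).aestronglyMeasurable (P * S) ?_
    filter_upwards [hVP] with p hp
    have := (norm_nonneg _).trans hp
    exact (norm_inner_le_norm _ _).trans (by gcongr; exact hES p)
  have i2 : Integrable (fun p => (inner ℝ (W p) c : ℝ)) μ := hW.inner_const _
  have e2 : ∫ p, (inner ℝ (W p) c : ℝ) ∂μ = -inner ℝ c e := by
    rw [← inner_neg_right, ← hWe, ← integral_inner hW]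
    exact integral_congr_ae (.of_forall fun q => real_inner_comm _ _)
  have hkm : Measurable fun z : α × α => k (X z.1 - X z.2) := hk.comp (by fun_prop)
  have i4 : Integrable (fun z : α × α => (inner ℝ (k (X z.1 - X z.2)) (V z.1) : ℝ))
      (μ.prod μ) := by
    refine Integrable.of_bound (hkm.inner (by fun_prop)).aestronglyMeasurable (D * P) ?_
    filter_upwards [Measure.quasiMeasurePreserving_fst.ae hVP] with z hz
    exact (norm_inner_le_norm _ _).trans (by gcongr; exact hkD _)
  -- Exchanging the two particles changes the sign of the odd kernel, so the symmetrized power of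
  -- the pair forces is twice that of one particle of the pair.
  have hsw : ∀ z : α × α, (inner ℝ (k (X z.1 - X z.2)) (V z.2) : ℝ)
      = -inner ℝ (k (X z.swap.1 - X z.swap.2)) (V z.swap.1) := by
    intro z
    rw [Prod.fst_swap, Prod.snd_swap, ← inner_neg_left, ← hodd, neg_sub]
  have i4' : Integrable (fun z : α × α => (inner ℝ (k (X z.1 - X z.2)) (V z.2) : ℝ))
      (μ.prod μ) := by
    simp_rw [hsw]
    exact i4.swap.neg
  have e4 : ∫ z : α × α, (inner ℝ (k (X z.1 - X z.2)) (V z.2) : ℝ) ∂(μ.prod μ)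
      = -∫ z : α × α, (inner ℝ (k (X z.1 - X z.2)) (V z.1) : ℝ) ∂(μ.prod μ) := by
    simp_rw [hsw]
    rw [integral_neg, integral_prod_swap fun z : α × α => (inner ℝ (k (X z.1 - X z.2)) (V z.1) : ℝ)]
  have hin : ∀ p, ∫ q, (inner ℝ (k (X p - X q)) (V p) : ℝ) ∂μ
      = inner ℝ (V p) (∫ q, k (X p - X q) ∂μ) := by
    intro p
    have hi : Integrable (fun q => k (X p - X q)) μ :=
      Integrable.of_bound ((hk.comp (by fun_prop)).aestronglyMeasurable) D
        (.of_forall fun q => hkD _)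
    rw [← integral_inner hi]
    exact integral_congr_ae (.of_forall fun q => real_inner_comm _ _)
  have e5 : ∫ z : α × α, (inner ℝ (k (X z.1 - X z.2)) (V z.1) : ℝ) ∂(μ.prod μ)
      = ∫ p, (inner ℝ (V p) (∫ q, k (X p - X q) ∂μ) : ℝ) ∂μ := by
    rw [integral_prod _ i4]
    exact integral_congr_ae (.of_forall hin)
  have i5 : Integrable (fun p => (inner ℝ (V p) (∫ q, k (X p - X q) ∂μ) : ℝ)) μ :=
    i4.integral_prod_left.congr (.of_forall hin)
  simp only [inner_sub_right, sub_div]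
  have j1 : Integrable (fun z : α × α => (inner ℝ (V z.1) (E z.1) : ℝ)) (μ.prod μ) :=
    i1.comp_fst μ
  have j2 : Integrable (fun z : α × α => (inner ℝ (W z.1) c : ℝ)) (μ.prod μ) := i2.comp_fst μ
  have j12 : Integrable (fun z : α × α => (inner ℝ (V z.1) (E z.1) : ℝ) + inner ℝ (W z.1) c)
      (μ.prod μ) := j1.add j2
  have j3 : Integrable (fun z : α × α => (inner ℝ (V z.1) (E z.1) : ℝ) + inner ℝ (W z.1) c
      + inner ℝ c e) (μ.prod μ) := j12.add (integrable_const _)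
  have j4 : Integrable (fun z : α × α => (inner ℝ (k (X z.1 - X z.2)) (V z.1) : ℝ) / 2
      - inner ℝ (k (X z.1 - X z.2)) (V z.2) / 2) (μ.prod μ) :=
    (i4.div_const 2).sub (i4'.div_const 2)
  rw [integral_sub j3 j4, integral_add j12 (integrable_const _), integral_add j1 j2,
    integral_sub (i4.div_const 2) (i4'.div_const 2), integral_div, integral_div, e4, e5,
    integral_sub i1 i5, integral_fun_fst (f := fun p => (inner ℝ (V p) (E p) : ℝ)),
    integral_fun_fst (f := fun p => (inner ℝ (W p) c : ℝ)), e2]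
  simp
  ring

/-- The production of regularized energy. -/
lemma abs_integral_power_le (h : CharFlow T M A μ ξ η Z) {S P r : ℝ} (hr : 0 < r)
    (hS : ∀ t ∈ Icc 0 T, ∀ x,
      ‖selfField μ (Z t) x - ∫ p, regCoulomb (r ^ 4) (x - (Z t p).1) ∂μ‖ ≤ S * r)
    (hP0 : 0 ≤ P) (hP : ∀ t ∈ Icc 0 T, ∀ p ∈ A, ‖(Z t p).2‖ ≤ P) {t : ℝ} (ht : t ∈ Icc 0 T) :
    |∫ z : Phase × Phase, (inner ℝ (Z t z.1).2 (selfField μ (Z t) (Z t z.1).1)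
        + inner ℝ (coulomb ((Z t z.1).1 - ξ t)) (η t) + inner ℝ (η t) (selfField μ (Z t) (ξ t))
        - inner ℝ (regCoulomb (r ^ 4) ((Z t z.1).1 - (Z t z.2).1))
            ((Z t z.1).2 - (Z t z.2).2) / 2) ∂(μ.prod μ)| ≤ P * (S * r) := by
  have := h.prob
  have hm := h.measurable_at t
  have hε : 0 < r ^ 4 := by positivity
  obtain ⟨S', hS'0, hS'⟩ := h.exists_field_bound
  have hE : Measurable fun p => selfField μ (Z t) (Z t p).1 :=
    h.measurable_selfField.comp (f := fun p => (t, (Z t p).1)) (by fun_prop)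
  have hmP : ∀ᵐ p ∂μ, ‖(Z t p).2‖ ≤ P := by filter_upwards [h.null] with p hp using hP t ht p hp
  have hodd : ∀ p, coulomb ((Z t p).1 - ξ t) = -coulomb (ξ t - (Z t p).1) := by
    intro p
    rw [← regCoulomb_zero, ← regCoulomb_zero, ← regCoulomb_neg, neg_sub]
  have i2 : Integrable (fun p => coulomb ((Z t p).1 - ξ t)) μ := by
    simp_rw [hodd]
    exact (h.integrable_coulomb ht (ξ t)).neg
  have e2 : ∫ p, coulomb ((Z t p).1 - ξ t) ∂μ = -selfField μ (Z t) (ξ t) := by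
    simp_rw [hodd]
    rw [selfField, integral_neg]
  rw [integral_power_eq (X := fun p => (Z t p).1) (V := fun p => (Z t p).2)
    (E := fun p => selfField μ (Z t) (Z t p).1) (W := fun p => coulomb ((Z t p).1 - ξ t))
    (k := regCoulomb (r ^ 4)) (by fun_prop) (by fun_prop) hE
    (measurable_regCoulomb _) (regCoulomb_neg _) (norm_regCoulomb_le hε) hmP
    (fun p => hS' t ht _) i2 e2, ← Real.norm_eq_abs]
  have := norm_integral_le_of_norm_le_const (μ := μ) (C := P * (S * r))
    (f := fun p => (inner ℝ (Z t p).2 (selfField μ (Z t) (Z t p).1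
          - ∫ q, regCoulomb (r ^ 4) ((Z t p).1 - (Z t q).1) ∂μ) : ℝ)) (by
      filter_upwards [hmP] with p hp
      refine (norm_inner_le_norm _ _).trans ?_
      gcongr
      exact hS t ht _)
  simpa using this

/-- The energy does not exceed its initial value. -/
lemma energy_le (h : CharFlow T M A μ ξ η Z) {H : ℝ}
    (hH : ∀ ε : ℝ, 0 < ε → (∫ p, labelEnergy Z ξ 0 p ∂μ) + ‖η 0‖ ^ 2 / 2
      + (∫ z : Phase × Phase, regPot ε ((Z 0 z.1).1 - (Z 0 z.2).1) ∂(μ.prod μ)) / 2 ≤ H)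
    {t : ℝ} (ht : t ∈ Icc 0 T) : (∫ p, labelEnergy Z ξ t p ∂μ) + ‖η t‖ ^ 2 / 2 ≤ H := by
  have := h.prob
  obtain ⟨P, hP0, hP⟩ := h.speed
  obtain ⟨δ, hδ, ha⟩ := h.away
  obtain ⟨S, hS0, hS⟩ := h.exists_reg_field_bound
  obtain ⟨S', hS'0, hS'⟩ := h.exists_field_bound
  have h0 : (0 : ℝ) ∈ Icc 0 T := ⟨le_rfl, ht.1.trans ht.2⟩
  have hsub : Icc 0 t ⊆ Icc 0 T := Icc_subset_Icc_right ht.2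
  have hηc : ContinuousOn η (Icc 0 T) := fun s hs => (h.charge_vel s hs).continuousWithinAt
  obtain ⟨N, hN⟩ := isCompact_Icc.exists_bound_of_continuousOn hηc
  have hN0 : 0 ≤ N := (norm_nonneg _).trans (hN 0 h0)
  have hA2 : ∀ᵐ z ∂(μ.prod μ), z.1 ∈ A ∧ z.2 ∈ A :=
    (Measure.quasiMeasurePreserving_fst.ae h.null).and
      (Measure.quasiMeasurePreserving_snd.ae h.null)
  have hmE := h.measurable_selfField
  have hmξ := h.measurable_charge.1
  have hmη := h.measurable_charge.2
  have hmZ := h.measurable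
  have hmc := measurable_coulomb
  -- The energy with a pair interaction regularized at scale `r ^ 4` is almost conserved: the
  -- mismatch between exact and regularized field produces at most `P * (S * r)` per unit time. The
  -- pair energy at time `t` is nonnegative and is dropped, so only an inequality results.
  have key : ∀ r : ℝ, 0 < r →
      (∫ p, labelEnergy Z ξ t p ∂μ) + ‖η t‖ ^ 2 / 2 ≤ H + P * (S * r) * t := by
    intro r hr
    have hε : 0 < r ^ 4 := by positivity
    have hmr := measurable_regCoulomb (r ^ 4)
    have hmp := measurable_regPot (r ^ 4)
    set g : ℝ → Phase × Phase → ℝ := fun s z => labelEnergy Z ξ s z.1 + ‖η s‖ ^ 2 / 2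
      + regPot (r ^ 4) ((Z s z.1).1 - (Z s z.2).1) / 2 with hg
    have hgi : ∀ s ∈ Icc 0 T, Integrable (fun z : Phase × Phase =>
        regPot (r ^ 4) ((Z s z.1).1 - (Z s z.2).1)) (μ.prod μ) := by
      intro s hs
      have hm := h.measurable_at s
      refine Integrable.of_bound (Measurable.aestronglyMeasurable (hmp.comp (by fun_prop)))
        ((r ^ 4)⁻¹) (.of_forall fun z => ?_)
      rw [Real.norm_eq_abs, abs_of_nonneg (regPot_nonneg _ _)]
      exact regPot_le hε _
    have hintg : ∀ s ∈ Icc 0 T, Integrable (g s) (μ.prod μ) := fun s hs =>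
      (((h.integrable_labelEnergy hs).comp_fst μ).add (integrable_const _)).add
        ((hgi s hs).div_const 2)
    have hval : ∀ s ∈ Icc 0 T, ∫ z, g s z ∂(μ.prod μ) = (∫ p, labelEnergy Z ξ s p ∂μ)
        + ‖η s‖ ^ 2 / 2 + (∫ z : Phase × Phase,
          regPot (r ^ 4) ((Z s z.1).1 - (Z s z.2).1) ∂(μ.prod μ)) / 2 := by
      intro s hs
      have i1 := (h.integrable_labelEnergy hs).comp_fst μ
      simp only [hg]
      rw [integral_add, integral_add i1 (integrable_const _),
        integral_fun_fst (f := labelEnergy Z ξ s), integral_div 2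
          (fun z : Phase × Phase => regPot (r ^ 4) ((Z s z.1).1 - (Z s z.2).1))]
      · simp
      · exact i1.add (integrable_const _)
      · exact (hgi s hs).div_const 2
    have hftc := integral_sub_integral_eq (ν := μ.prod μ) (g := g) (t := t)
      (g' := fun s z => inner ℝ (Z s z.1).2 (selfField μ (Z s) (Z s z.1).1)
        + inner ℝ (coulomb ((Z s z.1).1 - ξ s)) (η s) + inner ℝ (η s) (selfField μ (Z s) (ξ s))
        - inner ℝ (regCoulomb (r ^ 4) ((Z s z.1).1 - (Z s z.2).1))
            ((Z s z.1).2 - (Z s z.2).2) / 2)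
      (C := P * S' + (δ ^ 2)⁻¹ * N + N * S' + ((r ^ 4) ^ 2)⁻¹ * (P + P) / 2) ht.1 ?_ ?_ ?_
      (hintg 0 h0) (hintg t ht)
    · have hb : ‖∫ s in 0..t, ∫ z : Phase × Phase,
          (inner ℝ (Z s z.1).2 (selfField μ (Z s) (Z s z.1).1)
          + inner ℝ (coulomb ((Z s z.1).1 - ξ s)) (η s) + inner ℝ (η s) (selfField μ (Z s) (ξ s))
          - inner ℝ (regCoulomb (r ^ 4) ((Z s z.1).1 - (Z s z.2).1))
              ((Z s z.1).2 - (Z s z.2).2) / 2) ∂(μ.prod μ)‖ ≤ P * (S * r) * |t - 0| := by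
        refine intervalIntegral.norm_integral_le_of_norm_le_const fun s hs => ?_
        rw [uIoc_of_le ht.1] at hs
        exact h.abs_integral_power_le hr (fun t ht x => hS t ht x r hr) hP0 hP
          (hsub (Ioc_subset_Icc_self hs))
      rw [← hftc, hval t ht, hval 0 h0, sub_zero, abs_of_nonneg ht.1] at hb
      have hb' := (le_abs_self _).trans hb
      have hH' := hH (r ^ 4) hε
      have hnn : 0 ≤ ∫ z : Phase × Phase,
          regPot (r ^ 4) ((Z t z.1).1 - (Z t z.2).1) ∂(μ.prod μ) :=
        integral_nonneg fun z => regPot_nonneg _ _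
      linarith
    · have m1 : Measurable fun q : ℝ × Phase × Phase => Z q.1 q.2.1 :=
        hmZ.comp (f := fun q : ℝ × Phase × Phase => (q.1, q.2.1)) (by fun_prop)
      have m2 : Measurable fun q : ℝ × Phase × Phase => Z q.1 q.2.2 :=
        hmZ.comp (f := fun q : ℝ × Phase × Phase => (q.1, q.2.2)) (by fun_prop)
      have m3 : Measurable fun q : ℝ × Phase × Phase => selfField μ (Z q.1) (Z q.1 q.2.1).1 :=
        hmE.comp (f := fun q : ℝ × Phase × Phase => (q.1, (Z q.1 q.2.1).1)) (by fun_prop)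
      have m4 : Measurable fun q : ℝ × Phase × Phase => selfField μ (Z q.1) (ξ q.1) :=
        hmE.comp (f := fun q : ℝ × Phase × Phase => (q.1, ξ q.1)) (by fun_prop)
      have m5 : Measurable fun q : ℝ × Phase × Phase => coulomb ((Z q.1 q.2.1).1 - ξ q.1) :=
        hmc.comp (by fun_prop)
      have m6 : Measurable fun q : ℝ × Phase × Phase =>
          regCoulomb (r ^ 4) ((Z q.1 q.2.1).1 - (Z q.1 q.2.2).1) := hmr.comp (by fun_prop)
      fun_prop
    · filter_upwards [hA2] with z hz s hs
      have hs' := hsub hs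
      have d1 := (h.pos z.1 hz.1 s hs').mono hsub
      have d2 := (h.vel z.1 hz.1 s hs').mono hsub
      have d3 := (h.pos z.2 hz.2 s hs').mono hsub
      have d4 := (h.charge_pos s hs').mono hsub
      have d5 := (h.charge_vel s hs').mono hsub
      have hne : 0 < ‖(Z s z.1).1 - ξ s‖ := hδ.trans_le (ha s hs' z.1 hz.1)
      have p1 := hasDerivWithinAt_regPot (ε := 0) (d1.fun_sub d4) (by positivity)
      have p2 := hasDerivWithinAt_regPot (ε := r ^ 4) (d1.fun_sub d3) (by positivity)
      simp only [regPot_zero, regCoulomb_zero] at p1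
      have q1 : HasDerivWithinAt (fun s => ‖(Z s z.1).2‖ ^ 2 / 2) _ (Icc 0 t) s :=
        d2.norm_sq.div_const 2
      have q2 : HasDerivWithinAt (fun s => ‖η s‖ ^ 2 / 2) _ (Icc 0 t) s := d5.norm_sq.div_const 2
      refine (((q1.fun_add p1).fun_add q2).fun_add (p2.div_const 2)).congr_deriv ?_
      rw [inner_add_right, inner_sub_right (coulomb _),
        real_inner_comm (coulomb ((Z s z.1).1 - ξ s)) (Z s z.1).2]
      ring
    · filter_upwards [hA2] with z hz s hs
      have hs' := hsub hs
      have b1 := hP s hs' z.1 hz.1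
      have b2 := hP s hs' z.2 hz.2
      have b3 := hN s hs'
      have b4 := ha s hs' z.1 hz.1
      have c1 : ‖(inner ℝ (Z s z.1).2 (selfField μ (Z s) (Z s z.1).1) : ℝ)‖ ≤ P * S' :=
        (norm_inner_le_norm _ _).trans (by gcongr; exact hS' s hs' _)
      have c2 : ‖(inner ℝ (coulomb ((Z s z.1).1 - ξ s)) (η s) : ℝ)‖ ≤ (δ ^ 2)⁻¹ * N := by
        refine (norm_inner_le_norm _ _).trans ?_
        rw [norm_coulomb]
        gcongr
      have c3 : ‖(inner ℝ (η s) (selfField μ (Z s) (ξ s)) : ℝ)‖ ≤ N * S' :=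
        (norm_inner_le_norm _ _).trans (by gcongr; exact hS' s hs' _)
      have c4 : ‖(inner ℝ (regCoulomb (r ^ 4) ((Z s z.1).1 - (Z s z.2).1))
            ((Z s z.1).2 - (Z s z.2).2) / 2 : ℝ)‖ ≤ ((r ^ 4) ^ 2)⁻¹ * (P + P) / 2 := by
        rw [norm_div, Real.norm_two]
        gcongr
        refine (norm_inner_le_norm _ _).trans ?_
        gcongr
        · exact norm_regCoulomb_le hε _
        · exact (norm_sub_le _ _).trans (add_le_add b1 b2)
      exact (norm_sub_le _ _).trans (add_le_add ((norm_add_le _ _).trans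
        (add_le_add ((norm_add_le _ _).trans (add_le_add c1 c2)) c3)) c4)
  refine le_of_forall_pos_le_add fun e he => ?_
  have hD : 0 ≤ P * S * t := mul_nonneg (mul_nonneg hP0 hS0) ht.1
  refine (key (e / (P * S * t + 1)) (by positivity)).trans ?_
  gcongr
  calc P * (S * (e / (P * S * t + 1))) * t = (P * S * t) / (P * S * t + 1) * e := by ring
    _ ≤ 1 * e := by
        gcongr
        rw [div_le_one (by positivity)]
        linarith
    _ = e := one_mul e

end CharFlow

/-! ### The energy of solutions -/

section Initial

variable {f₀ : Phase → ℝ} {ξ₀ : Space}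

lemma IsInitialDatum.integrable_rho (hd : IsInitialDatum f₀ ξ₀) : Integrable (rho f₀) := by
  have := hd.density.integrable
  rw [Measure.volume_eq_prod] at this
  exact this.integral_prod_left

lemma IsInitialDatum.rho_nonneg (hd : IsInitialDatum f₀ ξ₀) (x : Space) : 0 ≤ rho f₀ x :=
  integral_nonneg fun _ => hd.density.nonneg _

lemma IsInitialDatum.map_fst_labelMeasure (hd : IsInitialDatum f₀ ξ₀) :
    (labelMeasure f₀).map Prod.fst = volume.withDensity fun x => ENNReal.ofReal (rho f₀ x) := by
  have hi := hd.density.integrable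
  have hm : AEMeasurable (fun p => ENNReal.ofReal (f₀ p)) volume :=
    hi.aestronglyMeasurable.aemeasurable.ennreal_ofReal
  rw [Measure.volume_eq_prod] at hi hm
  ext S hS
  have hS' : MeasurableSet (Prod.fst ⁻¹' S : Set Phase) := measurable_fst hS
  rw [Measure.map_apply measurable_fst hS, labelMeasure, withDensity_apply _ hS',
    withDensity_apply _ hS, ← lintegral_indicator hS', ← lintegral_indicator hS,
    Measure.volume_eq_prod, lintegral_prod _ (hm.indicator hS')]
  refine lintegral_congr_ae ?_
  filter_upwards [hi.prod_right_ae] with x hx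
  by_cases hxS : x ∈ S
  · rw [indicator_of_mem hxS, rho, ofReal_integral_eq_lintegral_ofReal hx
      (.of_forall fun v => hd.density.nonneg _)]
    refine lintegral_congr fun v => ?_
    rw [indicator_of_mem (show (x, v) ∈ Prod.fst ⁻¹' S from hxS)]
  · rw [indicator_of_notMem hxS]
    refine (lintegral_congr fun v => ?_).trans lintegral_zero
    rw [indicator_of_notMem (show (x, v) ∉ Prod.fst ⁻¹' S from hxS)]

lemma IsInitialDatum.integral_labelMeasure (hd : IsInitialDatum f₀ ξ₀) (g : Phase → ℝ) :
    ∫ p, g p ∂(labelMeasure f₀) = ∫ p, f₀ p * g p := by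
  rw [labelMeasure, integral_withDensity_eq_integral_toReal_smul₀
    hd.density.integrable.aestronglyMeasurable.aemeasurable.ennreal_ofReal (by simp)]
  simp only [ENNReal.toReal_ofReal (hd.density.nonneg _), smul_eq_mul]

lemma IsInitialDatum.integral_rho_mul (hd : IsInitialDatum f₀ ξ₀) {g : Space → ℝ}
    (hg : Measurable g) : ∫ x, rho f₀ x * g x = ∫ p, g p.1 ∂(labelMeasure f₀) := by
  rw [← integral_map (φ := Prod.fst) measurable_fst.aemeasurable hg.aestronglyMeasurable,
    hd.map_fst_labelMeasure, integral_withDensity_eq_integral_toReal_smul₀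
      hd.integrable_rho.aestronglyMeasurable.aemeasurable.ennreal_ofReal (by simp)]
  simp only [ENNReal.toReal_ofReal (hd.rho_nonneg _), smul_eq_mul]

lemma IsInitialDatum.integral_rho_mul_rho_mul (hd : IsInitialDatum f₀ ξ₀)
    {g : Space × Space → ℝ} (hg : Measurable g) :
    ∫ q : Space × Space, rho f₀ q.1 * rho f₀ q.2 * g q
      = ∫ z : Phase × Phase, g (z.1.1, z.2.1) ∂((labelMeasure f₀).prod (labelMeasure f₀)) := by
  have := hd.isProbabilityMeasure
  have hm : AEMeasurable (fun x => ENNReal.ofReal (rho f₀ x)) volume :=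
    hd.integrable_rho.aestronglyMeasurable.aemeasurable.ennreal_ofReal
  have e : ((labelMeasure f₀).prod (labelMeasure f₀)).map (Prod.map Prod.fst Prod.fst)
      = (volume : Measure (Space × Space)).withDensity
        fun q => ENNReal.ofReal (rho f₀ q.1) * ENNReal.ofReal (rho f₀ q.2) := by
    rw [← Measure.map_prod_map _ _ measurable_fst measurable_fst, hd.map_fst_labelMeasure,
      prod_withDensity₀ hm hm]
    rfl
  have hm2 : AEMeasurable (fun q : Space × Space => ENNReal.ofReal (rho f₀ q.1)
      * ENNReal.ofReal (rho f₀ q.2)) volume := by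
    rw [Measure.volume_eq_prod]
    exact (hm.comp_quasiMeasurePreserving Measure.quasiMeasurePreserving_fst).mul
      (hm.comp_quasiMeasurePreserving Measure.quasiMeasurePreserving_snd)
  have := integral_map (φ := (Prod.map Prod.fst Prod.fst : Phase × Phase → Space × Space))
    (μ := (labelMeasure f₀).prod (labelMeasure f₀))
    (measurable_fst.prodMap measurable_fst).aemeasurable (f := g) hg.aestronglyMeasurable
  rw [e, integral_withDensity_eq_integral_toReal_smul₀ hm2
    (.of_forall fun q => ENNReal.mul_lt_top ENNReal.ofReal_lt_top ENNReal.ofReal_lt_top)] at this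
  simp only [ENNReal.toReal_mul, ENNReal.toReal_ofReal (hd.rho_nonneg _), smul_eq_mul] at this
  exact this

/-- The inverse distance is dominated by one plus its square, whose integral is bounded uniformly in
one of the two points. Integrability matters: otherwise the pair energy would be zero by convention
and could not dominate its regularizations. -/
lemma integrable_inv_norm_sub {μ : Measure Phase} [IsProbabilityMeasure μ] {B : ℝ≥0}
    (hB : μ.map Prod.fst ≤ B • volume) (hB1 : μ univ ≤ B) :
    Integrable (fun z : Phase × Phase => ‖z.1.1 - z.2.1‖⁻¹) (μ.prod μ) := by
  refine ⟨Measurable.aestronglyMeasurable (by fun_prop), ?_⟩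
  rw [hasFiniteIntegral_iff_enorm, lintegral_prod _ (Measurable.aemeasurable (by fun_prop))]
  calc _ ≤ ∫⁻ p : Phase, ∫⁻ q : Phase, (1 + ENNReal.ofReal ((‖p.1 - q.1‖ ^ 2)⁻¹)) ∂μ ∂μ := by
        refine lintegral_mono fun p => lintegral_mono fun q => ?_
        rw [← ENNReal.ofReal_one, ← ENNReal.ofReal_add zero_le_one (by positivity),
          ← ofReal_norm]
        apply ENNReal.ofReal_le_ofReal
        rw [norm_inv, norm_norm, ← inv_pow]
        nlinarith [sq_nonneg (‖p.1 - q.1‖⁻¹ - 1), sq_nonneg (‖p.1 - q.1‖⁻¹)]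
    _ ≤ ∫⁻ p : Phase, (1 + ENNReal.ofReal (B * (sphereArea + 1))) ∂μ := by
        refine lintegral_mono fun p => ?_
        rw [lintegral_add_left measurable_const, lintegral_const, measure_univ, one_mul]
        gcongr
        exact lintegral_inv_sq_fst_le hB hB1 p.1
    _ < ∞ := by
        rw [lintegral_const, measure_univ, mul_one]
        exact ENNReal.add_lt_top.2 ⟨ENNReal.one_lt_top, ENNReal.ofReal_lt_top⟩

/-- On the diagonal the inverse norm is zero by convention while `regPot` is not, so the comparison
of the two pair energies needs the diagonal to be null. -/
lemma ae_fst_ne {μ : Measure Phase} [SFinite μ] {B : ℝ≥0} (hB : μ.map Prod.fst ≤ B • volume) :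
    ∀ᵐ z ∂(μ.prod μ), z.1.1 ≠ z.2.1 := by
  have hm : MeasurableSet {z : Phase × Phase | z.1.1 ≠ z.2.1} :=
    (measurableSet_eq_fun (by fun_prop) (by fun_prop)).compl
  rw [Measure.ae_prod_iff_ae_ae hm]
  refine .of_forall fun p => ?_
  rw [ae_iff]
  have h := hB {p.1}
  rw [Measure.map_apply measurable_fst (measurableSet_singleton _)] at h
  simp only [Measure.smul_apply, measure_singleton, smul_zero, nonpos_iff_eq_zero] at h
  refine measure_mono_null (fun q hq => ?_) h
  exact (not_not.1 hq).symm

end Initial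

section Solution

variable {T : ℝ} {f₀ : Phase → ℝ} {ξ₀ η₀ : Space} {ξ η : ℝ → Space} {f : ℝ → Phase → ℝ}
  {Φ : ℝ → ℝ → Phase → Phase}

/-- At time zero the labels are the phase points, so kinetic and charge terms agree exactly with
those of `totalEnergy`, and each regularized pair energy is below the exact one. -/
lemma IsSolution.energy_le (hT : 0 < T) (hd : IsInitialDatum f₀ ξ₀)
    (hs : IsSolution T f₀ ξ₀ η₀ ξ η f Φ) {M : ℝ} (hM : eLpNorm f₀ ⊤ volume = ENNReal.ofReal M)
    {t : ℝ} (ht : t ∈ Icc 0 T) :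
    (∫ p, CharFlow.labelEnergy (labelFlow T f₀ Φ) ((Icc 0 T).indicator ξ) t p ∂(labelMeasure f₀))
      + ‖(Icc 0 T).indicator η t‖ ^ 2 / 2 ≤ totalEnergy f₀ ξ₀ η₀ := by
  have h0 : (0 : ℝ) ∈ Icc 0 T := ⟨le_rfl, hT.le⟩
  have hprob := hd.isProbabilityMeasure
  have hdom := hs.support_subset_domain hT hd
  have hF := hs.charFlow hT hd hM
  have hnull := ae_labelMeasure_mem f₀
  have hid : ∀ p ∈ tsupport f₀, labelFlow T f₀ Φ 0 p = p := fun p hp => by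
    rw [labelFlow_eq h0 hp, hs.flow_self 0 h0 p (hdom hp)]
  refine hF.energy_le (fun ε hε => ?_) ht
  set μ := labelMeasure f₀ with hμ
  obtain ⟨B, -, hB⟩ := hs.exists_marginal_bound hT hd hM
  obtain ⟨hB1, hB2⟩ := hB 0 h0
  rw [hs.initial_eq hT hd, ← hμ] at hB1 hB2
  have hpair : ∫ z : Phase × Phase, regPot ε ((labelFlow T f₀ Φ 0 z.1).1
      - (labelFlow T f₀ Φ 0 z.2).1) ∂(μ.prod μ)
      ≤ ∫ q : Space × Space, rho f₀ q.1 * rho f₀ q.2 / ‖q.1 - q.2‖ := by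
    simp_rw [div_eq_mul_inv]
    rw [hd.integral_rho_mul_rho_mul (g := fun q => ‖q.1 - q.2‖⁻¹) (by fun_prop)]
    refine integral_mono_of_nonneg (.of_forall fun z => regPot_nonneg _ _)
      (integrable_inv_norm_sub hB1 hB2) ?_
    filter_upwards [Measure.quasiMeasurePreserving_fst.ae hnull,
      Measure.quasiMeasurePreserving_snd.ae hnull, ae_fst_ne hB1] with z hz1 hz2 hz
    rw [hid _ hz1, hid _ hz2]
    have hz' : 0 < ‖z.1.1 - z.2.1‖ := norm_pos_iff.2 (sub_ne_zero.2 hz)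
    unfold regPot
    have := norm_le_sqrt_reg ε (z.1.1 - z.2.1)
    gcongr
  have hlab : ∫ p, CharFlow.labelEnergy (labelFlow T f₀ Φ) ((Icc 0 T).indicator ξ) 0 p ∂μ
      = kinetic f₀ + ∫ x, rho f₀ x / ‖x - ξ₀‖ := by
    obtain ⟨R, hR⟩ := (hd.compact.isCompact.image continuous_snd).isBounded.exists_norm_le
    obtain ⟨δ₀, hδ₀, hδ⟩ := hd.away
    have e1 : ∫ p, CharFlow.labelEnergy (labelFlow T f₀ Φ) ((Icc 0 T).indicator ξ) 0 p ∂μ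
        = ∫ p, (‖p.2‖ ^ 2 / 2 + ‖p.1 - ξ₀‖⁻¹) ∂μ := by
      refine integral_congr_ae ?_
      filter_upwards [hnull] with p hp
      rw [CharFlow.labelEnergy, hid p hp, indicator_of_mem h0, hs.charge_init.1]
    have i1 : Integrable (fun p : Phase => ‖p.2‖ ^ 2 / 2) μ := by
      refine Integrable.of_bound (Measurable.aestronglyMeasurable (by fun_prop)) (R ^ 2 / 2) ?_
      filter_upwards [hnull] with p hp
      have := hR _ ⟨p, hp, rfl⟩
      rw [Real.norm_eq_abs, abs_of_nonneg (by positivity)]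
      gcongr
    have i2 : Integrable (fun p : Phase => ‖p.1 - ξ₀‖⁻¹) μ := by
      refine Integrable.of_bound (Measurable.aestronglyMeasurable (by fun_prop)) (δ₀⁻¹) ?_
      filter_upwards [hnull] with p hp
      have := hδ p hp
      rw [norm_inv, norm_norm]
      gcongr
    rw [e1, integral_add i1 i2, integral_div, hd.integral_labelMeasure]
    simp_rw [div_eq_mul_inv (rho f₀ _)]
    rw [hd.integral_rho_mul (g := fun x => ‖x - ξ₀‖⁻¹) (by fun_prop), kinetic]
    simp_rw [mul_comm (f₀ _)]
    rw [← hμ]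
    ring
  rw [hlab, indicator_of_mem h0, hs.charge_init.2, totalEnergy]
  linarith

end Solution

/-! ### Flows with bounded energy -/

/-- A characteristic flow of energy at most `H`, along which `√h` is bounded by `Q = w ^ 12`. -/
structure LevelFlow (T : ℝ) (M : ℝ≥0) (A : Set Phase) (μ : Measure Phase) (ξ η : ℝ → Space)
    (Z : ℝ → Phase → Phase) (H K₁ w : ℝ) : Prop extends CharFlow T M A μ ξ η Z where
  energy : ∀ t ∈ Icc 0 T, (∫ p, CharFlow.labelEnergy Z ξ t p ∂μ) + ‖η t‖ ^ 2 / 2 ≤ H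
  one_le : 1 ≤ K₁
  energy_le_shift : 8 * H ≤ K₁
  scale : 1 ≤ w
  level_le : ∀ t ∈ Icc 0 T, ∀ p ∈ A, √(particleEnergy K₁ ξ η (Z t p) t) ≤ w ^ 12

/-- The value of `√h` at time `t` on the trajectory labelled by `p`. -/
def level (K₁ : ℝ) (ξ η : ℝ → Space) (Z : ℝ → Phase → Phase) (t : ℝ) (p : Phase) : ℝ :=
  √(particleEnergy K₁ ξ η (Z t p) t)

namespace LevelFlow

variable {T : ℝ} {M : ℝ≥0} {A : Set Phase} {μ : Measure Phase} {ξ η : ℝ → Space}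
  {Z : ℝ → Phase → Phase} {H K₁ w : ℝ}

lemma le_particleEnergy (h : LevelFlow T M A μ ξ η Z H K₁ w) (p : Phase) (t : ℝ) :
    1 ≤ particleEnergy K₁ ξ η p t ∧ K₁ ≤ particleEnergy K₁ ξ η p t := by
  have h1 : K₁ ≤ particleEnergy K₁ ξ η p t := by
    unfold particleEnergy
    have : 0 ≤ ‖p.2 - η t‖ ^ 2 / 2 + 1 / ‖p.1 - ξ t‖ := by positivity
    linarith
  exact ⟨h.one_le.trans h1, h1⟩

lemma level_sq (h : LevelFlow T M A μ ξ η Z H K₁ w) (t : ℝ) (p : Phase) :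
    level K₁ ξ η Z t p ^ 2 = particleEnergy K₁ ξ η (Z t p) t :=
  Real.sq_sqrt (zero_le_one.trans (h.le_particleEnergy _ _).1)

lemma one_le_level (h : LevelFlow T M A μ ξ η Z H K₁ w) (t : ℝ) (p : Phase) :
    1 ≤ level K₁ ξ η Z t p := Real.one_le_sqrt.2 (h.le_particleEnergy _ _).1

lemma norm_vel_sub_le (h : LevelFlow T M A μ ξ η Z H K₁ w) (t : ℝ) (p : Phase) :
    ‖(Z t p).2 - η t‖ ≤ 3 / 2 * level K₁ ξ η Z t p := by
  have h1 := h.level_sq t p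
  have h2 := h.one_le_level t p
  have h3 : ‖(Z t p).2 - η t‖ ^ 2 ≤ 2 * level K₁ ξ η Z t p ^ 2 := by
    rw [h1, particleEnergy]
    have : 0 ≤ 1 / ‖(Z t p).1 - ξ t‖ := by positivity
    linarith [h.one_le]
  refine le_of_sq_le_sq ?_ (by positivity)
  nlinarith

lemma integral_labelEnergy_nonneg (t : ℝ) : 0 ≤ ∫ p, CharFlow.labelEnergy Z ξ t p ∂μ :=
  integral_nonneg fun p => by simp only [CharFlow.labelEnergy, Pi.zero_apply]; positivity

/-- The condition `8 * H ≤ K₁` acts here: the charge is slow compared with every `√h`, so velocities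
in the frame of the charge and in the rest frame are comparable. -/
lemma norm_charge_vel_le (h : LevelFlow T M A μ ξ η Z H K₁ w) {t : ℝ} (ht : t ∈ Icc 0 T) :
    ‖η t‖ ^ 2 ≤ K₁ / 4 := by
  have h1 := h.energy t ht
  have h2 := integral_labelEnergy_nonneg (μ := μ) (Z := Z) (ξ := ξ) t
  have h3 := h.energy_le_shift
  linarith

lemma norm_charge_vel_le_level (h : LevelFlow T M A μ ξ η Z H K₁ w) {t : ℝ} (ht : t ∈ Icc 0 T)
    (p : Phase) : ‖η t‖ ≤ level K₁ ξ η Z t p / 2 := by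
  have h1 := h.norm_charge_vel_le ht
  have h2 := (h.le_particleEnergy (Z t p) t).2
  have h3 := h.one_le_level t p
  rw [← h.level_sq] at h2
  refine le_of_sq_le_sq ?_ (by positivity)
  nlinarith

lemma norm_vel_le (h : LevelFlow T M A μ ξ η Z H K₁ w) {t : ℝ} (ht : t ∈ Icc 0 T) (p : Phase) :
    ‖(Z t p).2‖ ≤ 2 * level K₁ ξ η Z t p := by
  have h1 := h.norm_vel_sub_le t p
  have h2 := h.norm_charge_vel_le_level ht p
  have h3 : ‖(Z t p).2‖ ≤ ‖(Z t p).2 - η t‖ + ‖η t‖ := by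
    simpa using norm_add_le ((Z t p).2 - η t) (η t)
  linarith

lemma energy_nonneg (h : LevelFlow T M A μ ξ η Z H K₁ w) {t : ℝ} (ht : t ∈ Icc 0 T) : 0 ≤ H := by
  have h1 := h.energy t ht
  have h2 := integral_labelEnergy_nonneg (μ := μ) (Z := Z) (ξ := ξ) t
  have h3 : 0 ≤ ‖η t‖ ^ 2 / 2 := by positivity
  linarith

lemma lintegral_vel_sq_le (h : LevelFlow T M A μ ξ η Z H K₁ w) {t : ℝ} (ht : t ∈ Icc 0 T) :
    ∫⁻ p, ENNReal.ofReal (‖p.2‖ ^ 2) ∂(μ.map (Z t)) ≤ ENNReal.ofReal (2 * H) := by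
  rw [lintegral_map (by fun_prop) (h.measurable_at t)]
  have hi := (h.integrable_labelEnergy ht).const_mul 2
  calc _ ≤ ∫⁻ p, ENNReal.ofReal (2 * CharFlow.labelEnergy Z ξ t p) ∂μ := by
        refine lintegral_mono fun p => ENNReal.ofReal_le_ofReal ?_
        unfold CharFlow.labelEnergy
        have : 0 ≤ ‖(Z t p).1 - ξ t‖⁻¹ := by positivity
        linarith
    _ = ENNReal.ofReal (∫ p, 2 * CharFlow.labelEnergy Z ξ t p ∂μ) := by
        rw [ofReal_integral_eq_lintegral_ofReal hi]
        exact .of_forall fun p => by simp only [CharFlow.labelEnergy, Pi.zero_apply]; positivity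
    _ ≤ _ := by
        apply ENNReal.ofReal_le_ofReal
        rw [integral_const_mul]
        have h1 := h.energy t ht
        have h3 : 0 ≤ ‖η t‖ ^ 2 / 2 := by positivity
        linarith

/-- The second moment of `√h` at a fixed time. A remaining fast particle will cost `O(h)`, and this
bound makes the total cost finite. -/
lemma lintegral_level_sq_le (h : LevelFlow T M A μ ξ η Z H K₁ w) {t : ℝ} (ht : t ∈ Icc 0 T) :
    ∫⁻ p, ENNReal.ofReal (level K₁ ξ η Z t p ^ 2) ∂μ ≤ ENNReal.ofReal (2 * H + K₁) := by
  have := h.prob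
  have hi := ((h.integrable_labelEnergy ht).const_mul 2).add
    (integrable_const (μ := μ) (‖η t‖ ^ 2 + K₁))
  have hi' : Integrable (fun p => 2 * CharFlow.labelEnergy Z ξ t p + (‖η t‖ ^ 2 + K₁)) μ := hi
  have h1 := h.one_le
  calc _ ≤ ∫⁻ p, ENNReal.ofReal (2 * CharFlow.labelEnergy Z ξ t p + (‖η t‖ ^ 2 + K₁)) ∂μ := by
        refine lintegral_mono fun p => ENNReal.ofReal_le_ofReal ?_
        rw [h.level_sq, particleEnergy, CharFlow.labelEnergy, one_div]
        have h2 : 0 ≤ ‖(Z t p).1 - ξ t‖⁻¹ := by positivity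
        have h3 := norm_sub_le (Z t p).2 (η t)
        have h4 := norm_nonneg ((Z t p).2 - η t)
        nlinarith [sq_nonneg (‖(Z t p).2‖ - ‖η t‖), mul_self_le_mul_self h4 h3]
    _ = ENNReal.ofReal (∫ p, (2 * CharFlow.labelEnergy Z ξ t p + (‖η t‖ ^ 2 + K₁)) ∂μ) := by
        rw [ofReal_integral_eq_lintegral_ofReal hi']
        refine .of_forall fun p => ?_
        simp only [CharFlow.labelEnergy, Pi.zero_apply]
        positivity
    _ ≤ _ := by
        apply ENNReal.ofReal_le_ofReal
        rw [integral_add ((h.integrable_labelEnergy ht).const_mul 2) (integrable_const _),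
          integral_const_mul, integral_const]
        simp only [probReal_univ, smul_eq_mul, one_mul]
        have h1 := h.energy t ht
        linarith

/-! ### Pointwise size of the plasma field and first bound on the variation of `√h`. -/

/-- The constant of the static estimates. -/
def staticConst (M : ℝ≥0) (H : ℝ) : ℝ := 2 * H + M * (2 * sphereArea ^ 2)

lemma staticConst_nonneg (h : LevelFlow T M A μ ξ η Z H K₁ w) {t : ℝ} (ht : t ∈ Icc 0 T) :
    0 ≤ staticConst M H := by
  have := h.energy_nonneg ht
  have := sphereArea_nonneg
  unfold staticConst
  positivity

lemma lintegral_slow_le (h : LevelFlow T M A μ ξ η Z H K₁ w) {t : ℝ} (ht : t ∈ Icc 0 T)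
    {s : ℝ} (hs : 0 < s) (x c : Space) :
    ∫⁻ p in {p | ‖(Z t p).2 - c‖ < s ^ 3}, ENNReal.ofReal ((‖x - (Z t p).1‖ ^ 2)⁻¹) ∂μ
      ≤ ENNReal.ofReal (staticConst M H * s ^ 4) := by
  have h0 := h.energy_nonneg ht
  have hm : MeasurableSet {p : Phase | ‖p.2 - c‖ < s ^ 3} :=
    measurableSet_lt (by fun_prop) (by fun_prop)
  have := lintegral_slow_inv_sq_le (h.density t ht) (by positivity) (h.lintegral_vel_sq_le ht)
    hs x c
  rwa [setLIntegral_map hm (by fun_prop) (h.measurable_at t)] at this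

/-- All speeds are at most `2 * w ^ 12 < (2 * w ^ 4) ^ 3`, so the whole plasma counts as slow at
radius `8 Q`. This is the bound `O(Q^{4/3})`, with `16 = 2 ^ 4`. -/
lemma absField_le (h : LevelFlow T M A μ ξ η Z H K₁ w) {t : ℝ} (ht : t ∈ Icc 0 T) (x : Space) :
    CharFlow.absField μ (Z t) x ≤ ENNReal.ofReal (16 * staticConst M H * w ^ 16) := by
  have hw : 0 < w := zero_lt_one.trans_le h.scale
  have := h.lintegral_slow_le ht (s := 2 * w ^ 4) (by positivity) x 0
  have e : (μ.restrict {p | ‖(Z t p).2 - 0‖ < (2 * w ^ 4) ^ 3}) = μ := by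
    refine Measure.restrict_eq_self_of_ae_mem ?_
    filter_upwards [h.null] with p hp
    have h1 := h.norm_vel_le ht p
    have h2 : level K₁ ξ η Z t p ≤ w ^ 12 := h.level_le t ht p hp
    have h3 : 0 < w ^ 12 := by positivity
    change ‖(Z t p).2 - 0‖ < _
    rw [sub_zero]
    calc _ ≤ 2 * w ^ 12 := by linarith
      _ < (2 * w ^ 4) ^ 3 := by ring_nf; linarith
  rw [e] at this
  refine this.trans_eq ?_
  congr 1
  ring

lemma norm_selfField_le (h : LevelFlow T M A μ ξ η Z H K₁ w) {t : ℝ} (ht : t ∈ Icc 0 T)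
    (x : Space) : ‖selfField μ (Z t) x‖ ≤ 16 * staticConst M H * w ^ 16 := by
  have hC := h.staticConst_nonneg ht
  have hw : 0 < w := zero_lt_one.trans_le h.scale
  have := (CharFlow.enorm_selfField_le μ (Z t) x).trans (h.absField_le ht x)
  rwa [← ofReal_norm, ENNReal.ofReal_le_ofReal_iff (by positivity)] at this

lemma norm_selfField_sub_le (h : LevelFlow T M A μ ξ η Z H K₁ w) {t : ℝ} (ht : t ∈ Icc 0 T)
    (x y : Space) :
    ‖selfField μ (Z t) x - selfField μ (Z t) y‖ ≤ 32 * staticConst M H * w ^ 16 := by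
  have h1 := h.norm_selfField_le ht x
  have h2 := h.norm_selfField_le ht y
  have h3 := norm_sub_le (selfField μ (Z t) x) (selfField μ (Z t) y)
  linarith

lemma dist_charge_pos (h : LevelFlow T M A μ ξ η Z H K₁ w) {t : ℝ} (ht : t ∈ Icc 0 T)
    {p : Phase} (hp : p ∈ A) : 0 < ‖(Z t p).1 - ξ t‖ := by
  obtain ⟨δ, hδ, ha⟩ := h.away
  exact hδ.trans_le (ha t ht p hp)

/-- Evolution of `√h`: the force exerted by the charge does not contribute. -/
lemma hasDerivWithinAt_level (h : LevelFlow T M A μ ξ η Z H K₁ w) {t : ℝ} (ht : t ∈ Icc 0 T)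
    {p : Phase} (hp : p ∈ A) :
    HasDerivWithinAt (fun s => level K₁ ξ η Z s p)
      (inner ℝ ((Z t p).2 - η t) (selfField μ (Z t) (Z t p).1 - selfField μ (Z t) (ξ t))
        / (2 * level K₁ ξ η Z t p)) (Icc 0 T) t := by
  have hne := h.dist_charge_pos ht hp
  have p1 := hasDerivWithinAt_regPot (ε := 0) ((h.pos p hp t ht).fun_sub (h.charge_pos t ht))
    (by positivity)
  simp only [regPot_zero, regCoulomb_zero] at p1
  have p2 : HasDerivWithinAt (fun s => ‖(Z s p).2 - η s‖ ^ 2 / 2) _ (Icc 0 T) t :=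
    ((h.vel p hp t ht).fun_sub (h.charge_vel t ht)).norm_sq.div_const 2
  have p3 : HasDerivWithinAt (fun s => particleEnergy K₁ ξ η (Z s p) s)
      (inner ℝ ((Z t p).2 - η t) (selfField μ (Z t) (Z t p).1 - selfField μ (Z t) (ξ t)))
      (Icc 0 T) t := by
    unfold particleEnergy
    simp only [one_div]
    refine ((p2.fun_add p1).add_const K₁).congr_deriv ?_
    rw [add_sub_right_comm, inner_add_right,
      real_inner_comm (coulomb ((Z t p).1 - ξ t)) ((Z t p).2 - η t)]
    ring
  exact p3.sqrt (zero_lt_one.trans_le (h.le_particleEnergy _ _).1).ne'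

lemma abs_deriv_level_le (h : LevelFlow T M A μ ξ η Z H K₁ w) (t : ℝ) (p : Phase) :
    ‖(inner ℝ ((Z t p).2 - η t) (selfField μ (Z t) (Z t p).1 - selfField μ (Z t) (ξ t))
        / (2 * level K₁ ξ η Z t p) : ℝ)‖
      ≤ ‖selfField μ (Z t) (Z t p).1‖ + ‖selfField μ (Z t) (ξ t)‖ := by
  have h1 := h.one_le_level t p
  have h2 := h.norm_vel_sub_le t p
  rw [norm_div, Real.norm_eq_abs (2 * _), abs_of_pos (by positivity), div_le_iff₀ (by positivity)]
  refine (norm_inner_le_norm _ _).trans ?_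
  have h3 := norm_sub_le (selfField μ (Z t) (Z t p).1) (selfField μ (Z t) (ξ t))
  have h4 := norm_nonneg (selfField μ (Z t) (Z t p).1)
  have h5 := norm_nonneg (selfField μ (Z t) (ξ t))
  calc _ ≤ 3 / 2 * level K₁ ξ η Z t p
        * (‖selfField μ (Z t) (Z t p).1‖ + ‖selfField μ (Z t) (ξ t)‖) := by gcongr
    _ ≤ _ := by nlinarith

/-- The pointwise field bound over a time `1 / (8 Q)` allows a growth `O(Q^{1/3})`. That is too much
for the theorem when `Q` is large, but negligible against `Q^{3/4}`, and it settles the case of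
bounded `Q`. -/
lemma abs_level_sub_le (h : LevelFlow T M A μ ξ η Z H K₁ w) {a b : ℝ} (ha : a ∈ Icc 0 T)
    (hb : b ∈ Icc 0 T) (hab : |b - a| ≤ 1 / (8 * w ^ 12)) {p : Phase} (hp : p ∈ A) :
    |level K₁ ξ η Z b p - level K₁ ξ η Z a p| ≤ 4 * staticConst M H * w ^ 4 := by
  have hC := h.staticConst_nonneg ha
  have hw : 0 < w := zero_lt_one.trans_le h.scale
  have := (convex_Icc 0 T).norm_image_sub_le_of_norm_hasDerivWithin_le
    (C := 32 * staticConst M H * w ^ 16)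
    (fun t ht => h.hasDerivWithinAt_level ht hp) (fun t ht => (h.abs_deriv_level_le t p).trans (by
      have h1 := h.norm_selfField_le ht (Z t p).1
      have h2 := h.norm_selfField_le ht (ξ t)
      linarith)) ha hb
  rw [Real.norm_eq_abs, Real.norm_eq_abs] at this
  refine this.trans ?_
  calc _ ≤ 32 * staticConst M H * w ^ 16 * (1 / (8 * w ^ 12)) := by gcongr
    _ = _ := by field_simp; ring

end LevelFlow

/-! ### One-variable estimates -/

/-- On one side of `m` and at distance at least `θ` from it, the inverse square has an
antiderivative that varies by at most `θ⁻¹`. -/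
lemma norm_sub_le_of_norm_deriv_le_inv_sq {v v' : ℝ → Space} {s t m θ c k : ℝ} (hst : s ≤ t)
    (hθ : 0 < θ) (hk : 0 ≤ k) (hm : θ ≤ s - m ∨ t - m ≤ -θ)
    (hv : ∀ r ∈ Icc s t, HasDerivWithinAt v (v' r) (Icc s t) r)
    (hb : ∀ r ∈ Icc s t, ‖v' r‖ ≤ c + k * ((r - m) ^ 2)⁻¹) :
    ‖v t - v s‖ ≤ c * (t - s) + k * θ⁻¹ := by
  have hne : ∀ r ∈ Icc s t, r - m ≠ 0 := fun r hr => by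
    rcases hm with hm | hm
    · have := hr.1
      exact ne_of_gt (by linarith)
    · have := hr.2
      exact ne_of_lt (by linarith)
  let B : ℝ → ℝ := fun r => c * (r - s) + k * ((s - m)⁻¹ - (r - m)⁻¹)
  have hB : ∀ r ∈ Icc s t, HasDerivAt B (c + k * ((r - m) ^ 2)⁻¹) r := fun r hr => by
    have h1 : HasDerivAt (fun r => r - m) 1 r := (hasDerivAt_id r).sub_const m
    have h2 := (h1.fun_inv (hne r hr)).const_sub (s - m)⁻¹
    have h3 : HasDerivAt (fun r => r - s) 1 r := (hasDerivAt_id r).sub_const s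
    refine ((h3.const_mul c).fun_add (h2.const_mul k)).congr_deriv ?_
    rw [neg_div, neg_neg, one_div, mul_one]
  have key := image_norm_le_of_norm_deriv_right_le_deriv_boundary' (f := fun r => v r - v s)
    (f' := v') (a := s) (b := t) (B := B) (B' := fun r => c + k * ((r - m) ^ 2)⁻¹)
    (fun r hr => ((hv r hr).continuousWithinAt.sub continuousWithinAt_const))
    (fun r hr => ((hv r ⟨hr.1, hr.2.le⟩).mono_of_mem_nhdsWithin
      (Icc_mem_nhdsGE_of_mem hr)).sub_const _)
    (by simp [B]) (fun r hr => (hB r hr).continuousAt.continuousWithinAt)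
    (fun r hr => (hB r ⟨hr.1, hr.2.le⟩).hasDerivWithinAt)
    (fun r hr => hb r ⟨hr.1, hr.2.le⟩) (right_mem_Icc.2 hst)
  refine key.trans ?_
  have : (s - m)⁻¹ - (t - m)⁻¹ ≤ θ⁻¹ := by
    rcases hm with hm | hm
    · have h1 : (s - m)⁻¹ ≤ θ⁻¹ := by gcongr
      have h2 : 0 ≤ (t - m)⁻¹ := inv_nonneg.2 (by linarith)
      linarith
    · have h1 : (m - t)⁻¹ ≤ θ⁻¹ := inv_anti₀ hθ (by linarith)
      have h2 : 0 ≤ (m - s)⁻¹ := inv_nonneg.2 (by linarith)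
      rw [← neg_sub m t, ← neg_sub m s, inv_neg, inv_neg]
      linarith
  have := mul_le_mul_of_nonneg_left this hk
  simp only [B]
  linarith

/-- A function of second derivative at least `k` grows quadratically away from its minimum. -/
lemma exists_quadratic_lower_bound {g g' g'' : ℝ → ℝ} {a b k : ℝ} (hab : a ≤ b)
    (h1 : ∀ t ∈ Icc a b, HasDerivWithinAt g (g' t) (Icc a b) t)
    (h2 : ∀ t ∈ Icc a b, HasDerivWithinAt g' (g'' t) (Icc a b) t)
    (hk : ∀ t ∈ Icc a b, k ≤ g'' t) :
    ∃ m ∈ Icc a b, ∀ t ∈ Icc a b, g m + k / 4 * (t - m) ^ 2 ≤ g t := by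
  have hc : ContinuousOn g (Icc a b) := fun t ht => (h1 t ht).continuousWithinAt
  obtain ⟨m, hm, hmin⟩ := isCompact_Icc.exists_isMinOn (nonempty_Icc.2 hab) hc
  refine ⟨m, hm, fun t ht => ?_⟩
  have hconv : ConvexOn ℝ (Icc a b) fun t => g t - k / 2 * t ^ 2 := by
    refine convexOn_of_hasDerivWithinAt2_nonneg (convex_Icc a b) (f' := fun t => g' t - k * t)
      (f'' := fun t => g'' t - k) (hc.sub (by fun_prop)) (fun t ht => ?_) (fun t ht => ?_)
      fun t ht => sub_nonneg.2 (hk t (interior_subset ht))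
    · have e := ((hasDerivAt_id t).pow 2).const_mul (k / 2)
      refine (((h1 t (interior_subset ht)).mono interior_subset).fun_sub
        e.hasDerivWithinAt).congr_deriv ?_
      simp
      ring
    · have e := (hasDerivAt_id t).const_mul k
      refine (((h2 t (interior_subset ht)).mono interior_subset).fun_sub
        e.hasDerivWithinAt).congr_deriv ?_
      simp
  -- Convexity at the midpoint of `m` and `t`, compared with minimality at `m`. This avoids
  -- discussing the sign of the derivative at a minimum on the boundary, at the price of `k / 4`
  -- instead of `k / 2`.
  have hmid := hconv.2 hm ht (by norm_num : (0 : ℝ) ≤ 1 / 2) (by norm_num : (0 : ℝ) ≤ 1 / 2)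
    (by norm_num)
  have hmem : (1 / 2 : ℝ) • m + (1 / 2 : ℝ) • t ∈ Icc a b :=
    convex_Icc a b hm ht (by norm_num) (by norm_num) (by norm_num)
  have := isMinOn_iff.1 hmin _ hmem
  simp only [smul_eq_mul] at hmid this
  nlinarith

lemma lintegral_inv_sq_add_sq {α s : ℝ} (hα : 0 < α) :
    ∫⁻ t : ℝ, ENNReal.ofReal (2 * (α ^ 2 + (t - s) ^ 2)⁻¹) = ENNReal.ofReal (2 * Real.pi / α) := by
  have e : ∀ t : ℝ, 2 * (α ^ 2 + (t - s) ^ 2)⁻¹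
      = 2 / α ^ 2 * (1 + (α⁻¹ * (t - s)) ^ 2)⁻¹ := fun t => by
    have : 0 < α ^ 2 + (t - s) ^ 2 := by positivity
    field_simp
  simp_rw [e]
  have hi : Integrable fun t : ℝ => (1 + (α⁻¹ * t) ^ 2)⁻¹ :=
    integrable_inv_one_add_sq.comp_mul_left' (inv_ne_zero hα.ne')
  have hi' : Integrable fun t : ℝ => 2 / α ^ 2 * (1 + (α⁻¹ * (t - s)) ^ 2)⁻¹ :=
    (hi.comp_sub_right s).const_mul _
  rw [← ofReal_integral_eq_lintegral_ofReal hi' (.of_forall fun t => by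
    simp only [Pi.zero_apply]; positivity)]
  congr 1
  rw [integral_const_mul, integral_sub_right_eq_self (fun t : ℝ => (1 + (α⁻¹ * t) ^ 2)⁻¹),
    Measure.integral_comp_mul_left (fun t : ℝ => (1 + t ^ 2)⁻¹), integral_univ_inv_one_add_sq,
    inv_inv, abs_of_pos hα, smul_eq_mul]
  field_simp

/-- An almost straight path of speed at least `4` spends little time near the origin. -/
lemma lintegral_inv_sq_path_le {g g' : ℝ → Space} {c d α : ℝ} {U : Space} {R : Set ℝ}
    (hα : 0 < α) (hg : ∀ t ∈ Icc c d, HasDerivWithinAt g (g' t) (Icc c d) t)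
    (hU : 4 ≤ ‖U‖) (hdir : ∀ t ∈ Icc c d, ‖g' t - U‖ ≤ ‖U‖ / 2)
    (hR : ∀ t ∈ Icc c d, t ∈ R → α ≤ ‖g t‖) :
    ∫⁻ t in Icc c d, R.indicator (fun t => ENNReal.ofReal ((‖g t‖ ^ 2)⁻¹)) t
      ≤ ENNReal.ofReal (2 * Real.pi / α) := by
  rcases (Icc c d).eq_empty_or_nonempty with he | hne
  · simp [he]
  have hc : ContinuousOn (fun t => ‖g t‖) (Icc c d) := fun t ht => (hg t ht).continuousWithinAt.norm
  obtain ⟨s, hs, hmin⟩ := isCompact_Icc.exists_isMinOn hne hc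
  -- Comparison with the straight motion of velocity `U` gives `‖U‖ |t - s| / 2 ≤ ‖g t‖ + ‖g s‖ ≤ 2
  -- ‖g t‖`, because `s` minimizes the norm; then `‖U‖ ≥ 4` is used.
  have hlow : ∀ t ∈ Icc c d, |t - s| ≤ ‖g t‖ := fun t ht => by
    have h1 : ∀ t ∈ Icc c d, HasDerivWithinAt (fun t => g t - t • U) (g' t - U) (Icc c d) t :=
      fun t ht => by
        have := (hasDerivWithinAt_id t (Icc c d)).smul_const U
        rw [one_smul] at this
        exact (hg t ht).fun_sub this
    have h2 := (convex_Icc c d).norm_image_sub_le_of_norm_hasDerivWithin_le h1 hdir hs ht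
    have h3 : ‖(t - s) • U‖ ≤ ‖g t - t • U - (g s - s • U)‖ + ‖g t‖ + ‖g s‖ := by
      have e : (t - s) • U = -(g t - t • U - (g s - s • U)) + g t - g s := by
        rw [sub_smul]; abel
      rw [e]
      refine (norm_sub_le _ _).trans (add_le_add_left ((norm_add_le _ _).trans ?_) _)
      rw [norm_neg]
    have h4 : ‖g s‖ ≤ ‖g t‖ := isMinOn_iff.1 hmin t ht
    rw [norm_smul, Real.norm_eq_abs] at h3
    rw [Real.norm_eq_abs] at h2
    nlinarith [abs_nonneg (t - s)]
  rw [← lintegral_inv_sq_add_sq (s := s) hα]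
  refine le_trans (setLIntegral_mono' measurableSet_Icc fun t ht => ?_)
    (setLIntegral_le_lintegral (Icc c d) _)
  by_cases htR : t ∈ R
  · rw [indicator_of_mem htR]
    apply ENNReal.ofReal_le_ofReal
    have h1 := hR t ht htR
    have h2 := hlow t ht
    have h3 : (t - s) ^ 2 ≤ ‖g t‖ ^ 2 := by
      rw [← sq_abs]
      gcongr
    have h4 : α ^ 2 ≤ ‖g t‖ ^ 2 := by gcongr
    rw [← div_eq_mul_inv, le_div_iff₀ (by positivity), inv_mul_le_iff₀ (by nlinarith)]
    linarith
  · rw [indicator_of_notMem htR]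
    positivity

namespace LevelFlow

/-! ### Fast particles on short time intervals -/

/-- The scale `w` dominates the constants that depend on `M`, `H` and `K₁`. -/
structure IsLargeScale (M : ℝ≥0) (H K₁ w : ℝ) : Prop where
  two_le : 2 ≤ w
  static_le : 8 * staticConst M H ≤ w ^ 5
  shift_le : K₁ + 32 * staticConst M H * w ^ 16 ≤ w ^ 18 / 8

lemma exists_isLargeScale (M : ℝ≥0) (H K₁ : ℝ) : ∃ w₀, ∀ w ≥ w₀, IsLargeScale M H K₁ w := by
  set C := staticConst M H with hC
  refine ⟨max 2 (8 * (|K₁| + 32 * |C|)), fun w hw => ?_⟩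
  have h2 : 2 ≤ w := (le_max_left _ _).trans hw
  have h3 : 8 * (|K₁| + 32 * |C|) ≤ w := (le_max_right _ _).trans hw
  have h4 := abs_nonneg K₁
  have h5 := le_abs_self K₁
  have h6 := abs_nonneg C
  have h7 := le_abs_self C
  have hw16 : 1 ≤ w ^ 16 := one_le_pow₀ (by linarith)
  refine ⟨h2, ?_, ?_⟩
  · have : w ≤ w ^ 5 := le_self_pow₀ (by linarith) (by norm_num)
    linarith
  · have e : w ^ 18 = w ^ 16 * (w * w) := by ring
    have h8 : w ≤ w * w := by nlinarith
    have h9 : K₁ + 32 * C * w ^ 16 ≤ (|K₁| + 32 * |C|) * w ^ 16 := by nlinarith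
    rw [e]
    nlinarith

variable {T : ℝ} {M : ℝ≥0} {A : Set Phase} {μ : Measure Phase} {ξ η : ℝ → Space}
  {Z : ℝ → Phase → Phase} {H K₁ w a b : ℝ} {p : Phase}

lemma abs_level_sub_le_half (h : LevelFlow T M A μ ξ η Z H K₁ w) (hw : IsLargeScale M H K₁ w)
    (ha : 0 ≤ a) (hb : b ≤ T) (hab : b - a ≤ 1 / (8 * w ^ 12)) (hp : p ∈ A) {t : ℝ}
    (ht : t ∈ Icc a b) :
    |level K₁ ξ η Z t p - level K₁ ξ η Z a p| ≤ w ^ 9 / 2 := by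
  have h1 := h.abs_level_sub_le (a := a) (b := t) ⟨ha, (ht.1.trans ht.2).trans hb⟩
    ⟨ha.trans ht.1, ht.2.trans hb⟩
    (by rw [abs_of_nonneg (sub_nonneg.2 ht.1)]; linarith [ht.2]) hp
  refine h1.trans ?_
  have h2 := hw.static_le
  have h3 : 0 ≤ w ^ 4 := by positivity
  nlinarith

lemma norm_relVel_le (h : LevelFlow T M A μ ξ η Z H K₁ w) {t : ℝ} (ht : t ∈ Icc 0 T)
    (hp : p ∈ A) : ‖(Z t p).2 - η t‖ ≤ 3 / 2 * w ^ 12 := by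
  have h1 := h.norm_vel_sub_le t p
  have h2 : level K₁ ξ η Z t p ≤ w ^ 12 := h.level_le t ht p hp
  linarith

/-- On a short time interval a fast particle moves away linearly in time from its position
nearest to the charge. -/
lemma exists_nearest_time (h : LevelFlow T M A μ ξ η Z H K₁ w) (hw : IsLargeScale M H K₁ w)
    (ha : 0 ≤ a) (hab : a ≤ b) (hb : b ≤ T) (hlen : b - a ≤ 1 / (8 * w ^ 12)) (hp : p ∈ A)
    (hu : w ^ 9 ≤ level K₁ ξ η Z a p) :
    ∃ m ∈ Icc a b, ∀ t ∈ Icc a b, level K₁ ξ η Z a p / 4 * |t - m| ≤ ‖(Z t p).1 - ξ t‖ := by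
  have hw0 : 0 < w := zero_lt_two.trans_le hw.two_le
  have hsub : Icc a b ⊆ Icc 0 T := Icc_subset_Icc ha hb
  have haT : a ∈ Icc 0 T := hsub (left_mem_Icc.2 hab)
  set u := level K₁ ξ η Z a p with hu_def
  have hu1 : 1 ≤ u := h.one_le_level a p
  have huQ : u ≤ w ^ 12 := h.level_le a haT p hp
  have hD : ∀ t ∈ Icc a b, HasDerivWithinAt (fun s => (Z s p).1 - ξ s) ((Z t p).2 - η t)
      (Icc a b) t := fun t ht =>
    ((h.pos p hp t (hsub ht)).fun_sub (h.charge_pos t (hsub ht))).mono hsub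
  -- Within distance one of the charge, half the second derivative of the squared distance is `‖W‖²
  -- + ‖D‖⁻¹ + ⟪D, F⟫`. It is at least `h - K₁` minus a field term, and `shift_le` absorbs both
  -- corrections into `u ^ 2`.
  by_cases hclose : ∀ t ∈ Icc a b, ‖(Z t p).1 - ξ t‖ ≤ 1
  · have hW : ∀ t ∈ Icc a b, HasDerivWithinAt (fun s => (Z s p).2 - η s)
        (selfField μ (Z t) (Z t p).1 + coulomb ((Z t p).1 - ξ t) - selfField μ (Z t) (ξ t))
        (Icc a b) t := fun t ht =>
      ((h.vel p hp t (hsub ht)).fun_sub (h.charge_vel t (hsub ht))).mono hsub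
    obtain ⟨m, hm, hlow⟩ := exists_quadratic_lower_bound (k := u ^ 2 / 4) hab
      (fun t ht => (hD t ht).norm_sq)
      (fun t ht => ((hD t ht).inner ℝ (hW t ht)).const_mul 2) (fun t ht => by
        set D := (Z t p).1 - ξ t with hDdef
        set W := (Z t p).2 - η t with hWdef
        have hDpos : 0 < ‖D‖ := h.dist_charge_pos (hsub ht) hp
        have e1 : inner ℝ D (coulomb D) = ‖D‖⁻¹ := by
          rw [coulomb, real_inner_smul_right, real_inner_self_eq_norm_sq]
          field_simp
        have e2 : selfField μ (Z t) (Z t p).1 + coulomb D - selfField μ (Z t) (ξ t)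
            = (selfField μ (Z t) (Z t p).1 - selfField μ (Z t) (ξ t)) + coulomb D := by abel
        rw [e2, inner_add_right, e1, real_inner_self_eq_norm_sq]
        have h1 := h.norm_selfField_sub_le (hsub ht) (Z t p).1 (ξ t)
        set F := selfField μ (Z t) (Z t p).1 - selfField μ (Z t) (ξ t)
        have h2 : -(32 * staticConst M H * w ^ 16) ≤ inner ℝ D F := by
          have := abs_real_inner_le_norm D F
          have h3 : ‖D‖ * ‖F‖ ≤ 1 * (32 * staticConst M H * w ^ 16) :=
            mul_le_mul (hclose t ht) h1 (norm_nonneg _) zero_le_one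
          have := neg_abs_le (inner ℝ D F)
          linarith
        have h3 := h.level_sq t p
        rw [particleEnergy, one_div, ← hDdef, ← hWdef] at h3
        have h4 := abs_le.1 (h.abs_level_sub_le_half hw ha hb hlen hp ht)
        have h5 : u / 2 ≤ level K₁ ξ η Z t p := by linarith [h4.1]
        have h6 : u ^ 2 / 4 ≤ level K₁ ξ η Z t p ^ 2 := by nlinarith
        have h7 := hw.shift_le
        have h8 : w ^ 18 ≤ u ^ 2 := by
          have : (w ^ 9) ^ 2 ≤ u ^ 2 := by gcongr
          linarith [show (w ^ 9) ^ 2 = w ^ 18 by ring]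
        have h9 : 0 ≤ ‖W‖ ^ 2 := by positivity
        have h10 : 0 ≤ inner ℝ D F + 32 * staticConst M H * w ^ 16 := by linarith
        linarith)
    refine ⟨m, hm, fun t ht => ?_⟩
    have := hlow t ht
    refine le_of_sq_le_sq ?_ (norm_nonneg _)
    rw [mul_pow, sq_abs]
    have h0 : 0 ≤ ‖(Z m p).1 - ξ m‖ ^ 2 := by positivity
    nlinarith
  · push Not at hclose
    obtain ⟨s, hs, hs1⟩ := hclose
    -- A particle once farther than one stays far: the distance changes by at most `3 / 16` on the
    -- interval while the claim asks for at most `1 / 32`, so any `m` would do.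
    refine ⟨a, left_mem_Icc.2 hab, fun t ht => ?_⟩
    have h1 := (convex_Icc a b).norm_image_sub_le_of_norm_hasDerivWithin_le hD
      (fun r hr => h.norm_relVel_le (hsub hr) hp) ht hs
    have h2 : |s - t| ≤ 1 / (8 * w ^ 12) := (abs_sub_le_of_le_of_le hs.1 hs.2 ht.1 ht.2).trans hlen
    have h3 : |t - a| ≤ 1 / (8 * w ^ 12) := by
      rw [abs_of_nonneg (sub_nonneg.2 ht.1)]
      linarith [ht.2]
    have h4 : ‖(Z s p).1 - ξ s‖ ≤ ‖(Z s p).1 - ξ s - ((Z t p).1 - ξ t)‖ + ‖(Z t p).1 - ξ t‖ := by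
      simpa using norm_add_le ((Z s p).1 - ξ s - ((Z t p).1 - ξ t)) ((Z t p).1 - ξ t)
    have h5 : 3 / 2 * w ^ 12 * |s - t| ≤ 3 / 16 := by
      calc _ ≤ 3 / 2 * w ^ 12 * (1 / (8 * w ^ 12)) := by gcongr
        _ = 3 / 16 := by field_simp; norm_num
    have h6 : u / 4 * |t - a| ≤ 1 / 32 := by
      calc _ ≤ w ^ 12 / 4 * (1 / (8 * w ^ 12)) := by gcongr
        _ = 1 / 32 := by field_simp; norm_num
    rw [Real.norm_eq_abs] at h1
    linarith

/-- Away from the time of closest approach the velocity of a fast particle is almost constant. -/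
lemma norm_vel_sub_le_of_side (h : LevelFlow T M A μ ξ η Z H K₁ w) (hw : IsLargeScale M H K₁ w)
    (ha : 0 ≤ a) (hb : b ≤ T) (hlen : b - a ≤ 1 / (8 * w ^ 12)) (hp : p ∈ A)
    {u m : ℝ} (hu : 0 < u)
    (hm : ∀ t ∈ Icc a b, u / 4 * |t - m| ≤ ‖(Z t p).1 - ξ t‖) {s t : ℝ} (has : a ≤ s)
    (hst : s ≤ t) (htb : t ≤ b) (hside : (u ^ 2)⁻¹ ≤ s - m ∨ t - m ≤ -(u ^ 2)⁻¹) :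
    ‖(Z t p).2 - (Z s p).2‖ ≤ w ^ 9 := by
  have hw0 : 0 < w := zero_lt_two.trans_le hw.two_le
  have hθ : 0 < (u ^ 2)⁻¹ := by positivity
  have hsub : Icc s t ⊆ Icc a b := Icc_subset_Icc has htb
  have hsub' : Icc s t ⊆ Icc 0 T := hsub.trans (Icc_subset_Icc ha hb)
  have hC := h.staticConst_nonneg (hsub' (left_mem_Icc.2 hst))
  -- The force of the charge is at most `16 / (u² (r - m)²)`. Starting at distance `u⁻²` from `m`,
  -- its time integral is at most `16`, which is why the window has this width.
  have key := norm_sub_le_of_norm_deriv_le_inv_sq (v := fun r => (Z r p).2) (m := m)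
    (θ := (u ^ 2)⁻¹) (c := 16 * staticConst M H * w ^ 16) (k := 16 * (u ^ 2)⁻¹) hst hθ
    (by positivity) hside (fun r hr => (h.vel p hp r (hsub' hr)).mono hsub') (fun r hr => by
      refine (norm_add_le _ _).trans (add_le_add (h.norm_selfField_le (hsub' hr) _) ?_)
      have hne : 0 < |r - m| := by
        rw [abs_pos]
        rcases hside with hside | hside
        · exact ne_of_gt (by linarith [hr.1])
        · exact ne_of_lt (by linarith [hr.2])
      have h1 := hm r (hsub hr)
      rw [norm_coulomb, ← sq_abs (r - m)]
      calc _ ≤ ((u / 4 * |r - m|) ^ 2)⁻¹ := by gcongr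
        _ = _ := by field_simp; norm_num)
  refine key.trans ?_
  have h1 : 16 * staticConst M H * w ^ 16 * (t - s) ≤ 2 * staticConst M H * w ^ 4 := by
    calc _ ≤ 16 * staticConst M H * w ^ 16 * (1 / (8 * w ^ 12)) := by
          gcongr
          linarith
      _ = _ := by field_simp; ring
  have h2 : 16 * (u ^ 2)⁻¹ * ((u ^ 2)⁻¹)⁻¹ = 16 := by field_simp
  have h3 := hw.static_le
  have h4 : (2 : ℝ) ^ 9 ≤ w ^ 9 := by
    have := hw.two_le
    gcongr
  have h5 : 0 ≤ w ^ 4 := by positivity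
  rw [h2]
  nlinarith

end LevelFlow

namespace LevelFlow

/-! ### Contribution of a single fast particle -/

/-- Times and labels of the particles that are fast, also relative to `V₀`, and not too close to
the path `x`. -/
def restSet (K₁ : ℝ) (ξ η : ℝ → Space) (Z : ℝ → Phase → Phase) (w : ℝ) (x : ℝ → Space)
    (V₀ : Space) : Set (ℝ × Phase) :=
  {q | 250 * w ^ 9 ≤ level K₁ ξ η Z q.1 q.2 ∧ 125 * w ^ 9 ≤ ‖(Z q.1 q.2).2 - V₀‖ ∧
    (level K₁ ξ η Z q.1 q.2 ^ 2)⁻¹ ≤ ‖x q.1 - (Z q.1 q.2).1‖}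

variable {T : ℝ} {M : ℝ≥0} {A : Set Phase} {μ : Measure Phase} {ξ η : ℝ → Space}
  {Z : ℝ → Phase → Phase} {H K₁ w a b c d : ℝ} {p : Phase} {x x' : ℝ → Space} {V₀ : Space}

lemma setLIntegral_indicator_eq_zero {R : Set ℝ} {F : ℝ → ℝ≥0∞} (hR : ∀ t ∈ Icc c d, t ∉ R) :
    ∫⁻ t in Icc c d, R.indicator F t = 0 := by
  rw [setLIntegral_congr_fun (g := fun _ => 0) measurableSet_Icc fun t ht =>
    indicator_of_notMem (hR t ht) F]
  simp

lemma le_norm_sub_of_rest (h : LevelFlow T M A μ ξ η Z H K₁ w) (hw : IsLargeScale M H K₁ w)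
    (ha : 0 ≤ a) (hb : b ≤ T) (hlen : b - a ≤ 1 / (8 * w ^ 12)) (hp : p ∈ A)
    (hu : w ^ 9 ≤ level K₁ ξ η Z a p) {t : ℝ} (ht : t ∈ Icc a b)
    (hR : (t, p) ∈ restSet K₁ ξ η Z w x V₀) :
    (4 * level K₁ ξ η Z a p ^ 2)⁻¹ ≤ ‖x t - (Z t p).1‖ := by
  refine le_trans ?_ hR.2.2
  have h1 := abs_le.1 (h.abs_level_sub_le_half hw ha hb hlen hp ht)
  have h2 := h.one_le_level t p
  have h3 := h.one_le_level a p
  have h4 : level K₁ ξ η Z t p ≤ 2 * level K₁ ξ η Z a p := by linarith [h1.2]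
  apply inv_anti₀ (by positivity)
  nlinarith

/-- Away from the encounter with the charge, the relative velocity differs by at most `5 * w ^ 9`
from its value `U` frozen at one time `s` of the rest set, where `‖U‖ ≥ 125 * w ^ 9`. So
`lintegral_inv_sq_path_le` applies, with distance cutoff `(4 u²)⁻¹`. -/
lemma lintegral_rest_side_le (h : LevelFlow T M A μ ξ η Z H K₁ w) (hw : IsLargeScale M H K₁ w)
    (ha : 0 ≤ a) (hb : b ≤ T) (hlen : b - a ≤ 1 / (8 * w ^ 12)) (hp : p ∈ A)
    (hu : w ^ 9 ≤ level K₁ ξ η Z a p) {m : ℝ}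
    (hm : ∀ t ∈ Icc a b, level K₁ ξ η Z a p / 4 * |t - m| ≤ ‖(Z t p).1 - ξ t‖)
    (hac : a ≤ c) (hdb : d ≤ b) (hside : (level K₁ ξ η Z a p ^ 2)⁻¹ ≤ c - m ∨
      d - m ≤ -(level K₁ ξ η Z a p ^ 2)⁻¹)
    (hx : ∀ t ∈ Icc c d, HasDerivWithinAt x (x' t) (Icc c d) t)
    (hx' : ∀ t ∈ Icc c d, ‖x' t - V₀‖ ≤ 4 * w ^ 9) :
    ∫⁻ t in Icc c d, {t | (t, p) ∈ restSet K₁ ξ η Z w x V₀}.indicator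
        (fun t => ENNReal.ofReal ((‖x t - (Z t p).1‖ ^ 2)⁻¹)) t
      ≤ ENNReal.ofReal (8 * Real.pi * level K₁ ξ η Z a p ^ 2) := by
  have hw0 : 0 < w := zero_lt_two.trans_le hw.two_le
  have hw9 : 1 ≤ w ^ 9 := one_le_pow₀ h.scale
  have hu1 : 1 ≤ level K₁ ξ η Z a p := h.one_le_level a p
  by_cases hne : ∃ s ∈ Icc c d, (s, p) ∈ restSet K₁ ξ η Z w x V₀
  · obtain ⟨s, hs, hsR⟩ := hne
    have hsub : Icc c d ⊆ Icc a b := Icc_subset_Icc hac hdb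
    have hsub' : Icc c d ⊆ Icc 0 T := hsub.trans (Icc_subset_Icc ha hb)
    have hU : 125 * w ^ 9 ≤ ‖V₀ - (Z s p).2‖ := by
      rw [norm_sub_rev]
      exact hsR.2.1
    have hvar : ∀ t ∈ Icc c d, ‖(Z t p).2 - (Z s p).2‖ ≤ w ^ 9 := fun t ht => by
      rcases le_total s t with hst | hst
      · refine h.norm_vel_sub_le_of_side hw ha hb hlen hp (by linarith) hm (hac.trans hs.1) hst
          (ht.2.trans hdb) (hside.imp (fun e => ?_) fun e => ?_)
        · linarith [hs.1]
        · linarith [ht.2]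
      · rw [norm_sub_rev]
        refine h.norm_vel_sub_le_of_side hw ha hb hlen hp (by linarith) hm (hac.trans ht.1) hst
          (hs.2.trans hdb) (hside.imp (fun e => ?_) fun e => ?_)
        · linarith [ht.1]
        · linarith [hs.2]
    have key := lintegral_inv_sq_path_le (g := fun t => x t - (Z t p).1)
      (g' := fun t => x' t - (Z t p).2) (U := V₀ - (Z s p).2)
      (R := {t | (t, p) ∈ restSet K₁ ξ η Z w x V₀}) (c := c) (d := d)
      (α := (4 * level K₁ ξ η Z a p ^ 2)⁻¹) (by positivity)
      (fun t ht => (hx t ht).fun_sub ((h.pos p hp t (hsub' ht)).mono hsub')) (by linarith)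
      (fun t ht => by
        have e : x' t - (Z t p).2 - (V₀ - (Z s p).2) = (x' t - V₀) - ((Z t p).2 - (Z s p).2) := by
          abel
        rw [e]
        refine (norm_sub_le _ _).trans ?_
        linarith [hvar t ht, hx' t ht])
      (fun t ht hR => h.le_norm_sub_of_rest hw ha hb hlen hp hu (hsub ht) hR)
    refine key.trans_eq ?_
    congr 1
    rw [div_inv_eq_mul]
    ring
  · push Not at hne
    rw [setLIntegral_indicator_eq_zero (R := {t | (t, p) ∈ restSet K₁ ξ η Z w x V₀}) hne]
    exact zero_le

/-- Two sides cost `8 π u²` each. In the window of length `2 u⁻²` around the encounter only the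
distance cutoff is used, at a cost `16 u⁴ * 2 u⁻² = 32 u²`. A particle starting below level `w ^ 9`
never enters the rest set. -/
lemma lintegral_rest_le (h : LevelFlow T M A μ ξ η Z H K₁ w) (hw : IsLargeScale M H K₁ w)
    (ha : 0 ≤ a) (hab : a ≤ b) (hb : b ≤ T) (hlen : b - a ≤ 1 / (8 * w ^ 12)) (hp : p ∈ A)
    (hac : a ≤ c) (hdb : d ≤ b)
    (hx : ∀ t ∈ Icc c d, HasDerivWithinAt x (x' t) (Icc c d) t)
    (hx' : ∀ t ∈ Icc c d, ‖x' t - V₀‖ ≤ 4 * w ^ 9) :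
    ∫⁻ t in Icc c d, {t | (t, p) ∈ restSet K₁ ξ η Z w x V₀}.indicator
        (fun t => ENNReal.ofReal ((‖x t - (Z t p).1‖ ^ 2)⁻¹)) t
      ≤ ENNReal.ofReal (100 * level K₁ ξ η Z a p ^ 2) := by
  have hsub : Icc c d ⊆ Icc a b := Icc_subset_Icc hac hdb
  have hu1 : 1 ≤ level K₁ ξ η Z a p := h.one_le_level a p
  have hw9 : 1 ≤ w ^ 9 := one_le_pow₀ h.scale
  by_cases hu : w ^ 9 ≤ level K₁ ξ η Z a p
  · obtain ⟨m, -, hm⟩ := h.exists_nearest_time hw ha hab hb hlen hp hu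
    set u := level K₁ ξ η Z a p with hu_def
    set θ := (u ^ 2)⁻¹ with hθ
    set F := {t | (t, p) ∈ restSet K₁ ξ η Z w x V₀}.indicator
        (fun t => ENNReal.ofReal ((‖x t - (Z t p).1‖ ^ 2)⁻¹)) with hF
    have hcover : Icc c d ⊆ (Icc c (min d (m - θ)) ∪ Icc c d ∩ Icc (m - θ) (m + θ))
        ∪ Icc (max c (m + θ)) d := by
      intro t ht
      rcases le_total t (m - θ) with h1 | h1
      · exact .inl (.inl ⟨ht.1, le_min ht.2 h1⟩)
      · rcases le_total t (m + θ) with h2 | h2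
        · exact .inl (.inr ⟨ht, h1, h2⟩)
        · exact .inr ⟨max_le ht.1 h2, ht.2⟩
    have hleft : ∫⁻ t in Icc c (min d (m - θ)), F t ≤ ENNReal.ofReal (8 * Real.pi * u ^ 2) := by
      have hs : Icc c (min d (m - θ)) ⊆ Icc c d := Icc_subset_Icc le_rfl (min_le_left _ _)
      exact h.lintegral_rest_side_le hw ha hb hlen hp hu hm hac ((min_le_left _ _).trans hdb)
        (.inr (by linarith [min_le_right d (m - θ)])) (fun t ht => (hx t (hs ht)).mono hs)
        fun t ht => hx' t (hs ht)
    have hright : ∫⁻ t in Icc (max c (m + θ)) d, F t ≤ ENNReal.ofReal (8 * Real.pi * u ^ 2) := by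
      have hs : Icc (max c (m + θ)) d ⊆ Icc c d := Icc_subset_Icc (le_max_left _ _) le_rfl
      exact h.lintegral_rest_side_le hw ha hb hlen hp hu hm (hac.trans (le_max_left _ _)) hdb
        (.inl (by linarith [le_max_right c (m + θ)])) (fun t ht => (hx t (hs ht)).mono hs)
        fun t ht => hx' t (hs ht)
    have hmid : ∫⁻ t in Icc c d ∩ Icc (m - θ) (m + θ), F t ≤ ENNReal.ofReal (32 * u ^ 2) := by
      calc _ ≤ ∫⁻ t in Icc c d ∩ Icc (m - θ) (m + θ), ENNReal.ofReal (16 * u ^ 4) := by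
            refine setLIntegral_mono' (measurableSet_Icc.inter measurableSet_Icc) fun t ht => ?_
            by_cases hR : (t, p) ∈ restSet K₁ ξ η Z w x V₀
            · rw [hF, indicator_of_mem (s := {t | (t, p) ∈ restSet K₁ ξ η Z w x V₀}) hR]
              apply ENNReal.ofReal_le_ofReal
              have := h.le_norm_sub_of_rest hw ha hb hlen hp hu (hsub ht.1) hR
              calc _ ≤ (((4 * u ^ 2)⁻¹) ^ 2)⁻¹ := by gcongr
                _ = _ := by rw [inv_pow, inv_inv]; ring
            · rw [hF, indicator_of_notMem (s := {t | (t, p) ∈ restSet K₁ ξ η Z w x V₀}) hR]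
              exact zero_le
        _ = ENNReal.ofReal (16 * u ^ 4) * volume (Icc c d ∩ Icc (m - θ) (m + θ)) :=
            setLIntegral_const _ _
        _ ≤ ENNReal.ofReal (16 * u ^ 4) * volume (Icc (m - θ) (m + θ)) := by
            gcongr
            exact inter_subset_right
        _ = _ := by
            rw [Real.volume_Icc, ← ENNReal.ofReal_mul (by positivity)]
            congr 1
            rw [hθ]
            field_simp
            ring
    calc _ ≤ ∫⁻ t in (Icc c (min d (m - θ)) ∪ Icc c d ∩ Icc (m - θ) (m + θ))
          ∪ Icc (max c (m + θ)) d, F t := lintegral_mono_set hcover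
      _ ≤ _ := lintegral_union_le _ _ _
      _ ≤ _ := add_le_add_left (lintegral_union_le _ _ _) _
      _ ≤ (ENNReal.ofReal (8 * Real.pi * u ^ 2) + ENNReal.ofReal (32 * u ^ 2))
          + ENNReal.ofReal (8 * Real.pi * u ^ 2) := by gcongr
      _ = ENNReal.ofReal (8 * Real.pi * u ^ 2 + 32 * u ^ 2 + 8 * Real.pi * u ^ 2) := by
          have := Real.pi_pos
          rw [← ENNReal.ofReal_add (by positivity) (by positivity),
            ← ENNReal.ofReal_add (by positivity) (by positivity)]
      _ ≤ _ := by
          apply ENNReal.ofReal_le_ofReal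
          have := Real.pi_lt_d2
          nlinarith
  · rw [setLIntegral_indicator_eq_zero fun t ht hR => ?_]
    · exact zero_le
    · have h1 := abs_le.1 (h.abs_level_sub_le_half hw ha hb hlen hp (hsub ht))
      have h2 : 250 * w ^ 9 ≤ level K₁ ξ η Z t p := hR.1
      linarith [h1.2]

end LevelFlow

/-! ### Splitting of the plasma along a path and time average of the field. -/

/-- Contribution to the field of the particles that are close to `x`, at a distance controlled by
their relative velocity. -/
lemma lintegral_near_inv_sq_le {ν : Measure Phase} {M : ℝ≥0} (hν : ν ≤ M • volume) (x c : Space)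
    {L : ℝ} (hL : 0 ≤ L) :
    ∫⁻ q in {q : Phase | ‖q.2 - c‖ < L ∧ ‖x - q.1‖ < 2 * (‖q.2 - c‖ ^ 2)⁻¹},
        ENNReal.ofReal ((‖x - q.1‖ ^ 2)⁻¹) ∂ν
      ≤ ENNReal.ofReal (M * (2 * sphereArea ^ 2 * L)) := by
  have hA := sphereArea_nonneg
  set S : Set Phase := {q | ‖q.2 - c‖ < L ∧ ‖x - q.1‖ < 2 * (‖q.2 - c‖ ^ 2)⁻¹} with hS
  have hSm : MeasurableSet S := by
    have h1 : MeasurableSet {q : Phase | ‖q.2 - c‖ < L} :=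
      measurableSet_lt (by fun_prop) (by fun_prop)
    have h2 : MeasurableSet {q : Phase | ‖x - q.1‖ < 2 * (‖q.2 - c‖ ^ 2)⁻¹} :=
      measurableSet_lt (by fun_prop) (by fun_prop)
    exact h1.inter h2
  have hF : Measurable fun q : Phase => ENNReal.ofReal ((‖x - q.1‖ ^ 2)⁻¹) := by fun_prop
  -- For a fixed velocity the positions fill a ball of radius `2 ‖v - c‖⁻²`, over which the kernel
  -- integrates to a multiple of `‖v - c‖⁻²`. This is again integrable in velocity.
  have hinner : ∀ v : Space, ∫⁻ y, S.indicator (fun q => ENNReal.ofReal ((‖x - q.1‖ ^ 2)⁻¹)) (y, v)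
      ≤ (Metric.ball c L).indicator
        (fun v => ENNReal.ofReal (2 * sphereArea) * ENNReal.ofReal ((‖c - v‖ ^ 2)⁻¹)) v := by
    intro v
    by_cases hv : ‖v - c‖ < L
    · rw [indicator_of_mem (by rwa [Metric.mem_ball, dist_eq_norm])]
      have h1 := lintegral_ball_inv_sq_le x (r := 2 * (‖v - c‖ ^ 2)⁻¹) (by positivity)
      rw [← lintegral_indicator Metric.isOpen_ball.measurableSet] at h1
      refine le_trans (lintegral_mono fun y => ?_) (h1.trans_eq ?_)
      · by_cases hy : (y, v) ∈ S
        · rw [indicator_of_mem hy, indicator_of_mem]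
          rw [Metric.mem_ball, dist_comm, dist_eq_norm]
          exact hy.2
        · rw [indicator_of_notMem hy]
          exact zero_le
      · rw [← ENNReal.ofReal_mul (by positivity), norm_sub_rev v c]
        congr 1
        ring
    · have : ∀ y, (y, v) ∉ S := fun y hy => hv hy.1
      simp [this]
  calc _ ≤ ∫⁻ q in S, ENNReal.ofReal ((‖x - q.1‖ ^ 2)⁻¹) ∂(M • volume) :=
        lintegral_mono' (Measure.restrict_mono le_rfl hν) le_rfl
    _ = M * ∫⁻ q in S, ENNReal.ofReal ((‖x - q.1‖ ^ 2)⁻¹) := by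
        rw [Measure.restrict_smul, lintegral_smul_measure]
        rfl
    _ = M * ∫⁻ v, ∫⁻ y, S.indicator (fun q => ENNReal.ofReal ((‖x - q.1‖ ^ 2)⁻¹)) (y, v) := by
        rw [← lintegral_indicator hSm, Measure.volume_eq_prod,
          lintegral_prod_symm _ (hF.indicator hSm).aemeasurable]
    _ ≤ M * ∫⁻ v, (Metric.ball c L).indicator
        (fun v => ENNReal.ofReal (2 * sphereArea) * ENNReal.ofReal ((‖c - v‖ ^ 2)⁻¹)) v := by
        gcongr with v
        exact hinner v
    _ = M * (ENNReal.ofReal (2 * sphereArea)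
        * ∫⁻ v in Metric.ball c L, ENNReal.ofReal ((‖c - v‖ ^ 2)⁻¹)) := by
        rw [lintegral_indicator Metric.isOpen_ball.measurableSet,
          lintegral_const_mul _ (by fun_prop)]
    _ ≤ M * (ENNReal.ofReal (2 * sphereArea) * ENNReal.ofReal (sphereArea * L)) := by
        gcongr
        exact lintegral_ball_inv_sq_le c hL
    _ = _ := by
        rw [← ENNReal.ofReal_mul (by positivity), ENNReal.ofReal_mul (NNReal.coe_nonneg M),
          ENNReal.ofReal_coe_nnreal]
        congr 2
        ring

namespace LevelFlow

variable {T : ℝ} {M : ℝ≥0} {A : Set Phase} {μ : Measure Phase} {ξ η : ℝ → Space}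
  {Z : ℝ → Phase → Phase} {H K₁ w a b c d : ℝ} {p : Phase} {x x' : ℝ → Space} {V₀ : Space}

/-- Since `h ≥ ‖V - η‖² / 2`, distance at most `1 / h` implies the condition of
`lintegral_near_inv_sq_le` centred at `η t`. Velocities equal to `η t` form a null set; they are
discarded because the inverse of zero is zero. -/
lemma lintegral_near_le (h : LevelFlow T M A μ ξ η Z H K₁ w) {t : ℝ} (ht : t ∈ Icc 0 T)
    (x : Space) :
    ∫⁻ p in {p | ‖x - (Z t p).1‖ < (level K₁ ξ η Z t p ^ 2)⁻¹},
        ENNReal.ofReal ((‖x - (Z t p).1‖ ^ 2)⁻¹) ∂μ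
      ≤ ENNReal.ofReal (M * (4 * sphereArea ^ 2 * w ^ 12)) := by
  have hw : 0 < w := zero_lt_one.trans_le h.scale
  set S : Set Phase := {q | ‖q.2 - η t‖ < 2 * w ^ 12 ∧ ‖x - q.1‖ < 2 * (‖q.2 - η t‖ ^ 2)⁻¹}
  have hSm : MeasurableSet S := by
    have h1 : MeasurableSet {q : Phase | ‖q.2 - η t‖ < 2 * w ^ 12} :=
      measurableSet_lt (by fun_prop) (by fun_prop)
    have h2 : MeasurableSet {q : Phase | ‖x - q.1‖ < 2 * (‖q.2 - η t‖ ^ 2)⁻¹} :=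
      measurableSet_lt (by fun_prop) (by fun_prop)
    exact h1.inter h2
  have hbd := lintegral_near_inv_sq_le (h.density t ht) x (η t) (L := 2 * w ^ 12) (by positivity)
  rw [setLIntegral_map hSm (by fun_prop) (h.measurable_at t)] at hbd
  have hne : ∀ᵐ p ∂μ, (Z t p).2 ≠ η t := by
    have h0 : MeasurableSet {q : Phase | q.2 = η t} :=
      measurable_snd (measurableSet_singleton (η t))
    have h1 : (μ.map (Z t)) {q : Phase | q.2 = η t} = 0 := by
      refine le_antisymm ((h.density t ht _).trans_eq ?_) (zero_le)
      have e : {q : Phase | q.2 = η t} = univ ×ˢ {η t} := by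
        ext q
        simp
      rw [Measure.smul_apply, e, Measure.volume_eq_prod, Measure.prod_prod]
      simp
    rw [Measure.map_apply (h.measurable_at t) h0] at h1
    exact measure_eq_zero_iff_ae_notMem.1 h1
  have hle : {p | ‖x - (Z t p).1‖ < (level K₁ ξ η Z t p ^ 2)⁻¹} ≤ᵐ[μ] Z t ⁻¹' S := by
    filter_upwards [h.null, hne] with p hp hpne hnear
    have hpos : 0 < ‖(Z t p).2 - η t‖ := norm_pos_iff.2 (sub_ne_zero.2 hpne)
    have hle : level K₁ ξ η Z t p ≤ w ^ 12 := h.level_le t ht p hp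
    have h3 : 0 < w ^ 12 := by positivity
    refine ⟨by linarith [h.norm_vel_sub_le t p], lt_of_lt_of_le hnear ?_⟩
    rw [h.level_sq, show 2 * (‖(Z t p).2 - η t‖ ^ 2)⁻¹ = (‖(Z t p).2 - η t‖ ^ 2 / 2)⁻¹ by
      rw [inv_div]; rfl]
    apply inv_anti₀ (by positivity)
    have : 0 ≤ 1 / ‖(Z t p).1 - ξ t‖ := by positivity
    rw [particleEnergy]
    linarith [h.one_le]
  calc _ ≤ ∫⁻ p in Z t ⁻¹' S, ENNReal.ofReal ((‖x - (Z t p).1‖ ^ 2)⁻¹) ∂μ :=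
        lintegral_mono' (Measure.restrict_mono' hle le_rfl) le_rfl
    _ ≤ _ := hbd
    _ = _ := by congr 1; ring

lemma measurable_level (h : LevelFlow T M A μ ξ η Z H K₁ w) :
    Measurable fun q : ℝ × Phase => level K₁ ξ η Z q.1 q.2 := by
  have h1 := h.measurable
  have h2 := h.measurable_charge.1
  have h3 := h.measurable_charge.2
  unfold level particleEnergy
  fun_prop

lemma measurableSet_restSet (h : LevelFlow T M A μ ξ η Z H K₁ w) (hx : Measurable x) :
    MeasurableSet (restSet K₁ ξ η Z w x V₀) := by
  have h1 := h.measurable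
  have h2 := h.measurable_level
  have m1 : MeasurableSet {q : ℝ × Phase | 250 * w ^ 9 ≤ level K₁ ξ η Z q.1 q.2} :=
    measurableSet_le (by fun_prop) (by fun_prop)
  have m2 : MeasurableSet {q : ℝ × Phase | 125 * w ^ 9 ≤ ‖(Z q.1 q.2).2 - V₀‖} :=
    measurableSet_le (by fun_prop) (by fun_prop)
  have m3 : MeasurableSet {q : ℝ × Phase |
      (level K₁ ξ η Z q.1 q.2 ^ 2)⁻¹ ≤ ‖x q.1 - (Z q.1 q.2).1‖} :=
    measurableSet_le (by fun_prop) (by fun_prop)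
  exact m1.inter (m2.inter m3)

/-- Three classes have a field `O(w ^ 12) = O(Q)`: slow particles, particles nearly parallel to
`V₀`, and near ones. The first two use radii `512 * w ^ 9` and `125 * w ^ 9`, whence `8 ^ 4 + 5 ^ 4
= 4721`. Speed at least `512 * w ^ 9` forces a level above `250 * w ^ 9`. -/
lemma absField_le_add_rest (h : LevelFlow T M A μ ξ η Z H K₁ w) {t : ℝ} (ht : t ∈ Icc 0 T) :
    CharFlow.absField μ (Z t) (x t)
      ≤ ENNReal.ofReal ((4721 * staticConst M H + M * (4 * sphereArea ^ 2)) * w ^ 12)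
        + ∫⁻ p, (restSet K₁ ξ η Z w x V₀).indicator
          (fun q => ENNReal.ofReal ((‖x q.1 - (Z q.1 q.2).1‖ ^ 2)⁻¹)) (t, p) ∂μ := by
  have hw : 0 < w := zero_lt_one.trans_le h.scale
  have hC := h.staticConst_nonneg ht
  have hZ := h.measurable_at t
  have hlev : Measurable fun p => level K₁ ξ η Z t p := by
    unfold level particleEnergy
    fun_prop
  set k : Phase → ℝ≥0∞ := fun p => ENNReal.ofReal ((‖x t - (Z t p).1‖ ^ 2)⁻¹) with hk
  have hkm : Measurable k := by fun_prop
  set S₁ : Set Phase := {p | ‖(Z t p).2 - 0‖ < (8 * w ^ 3) ^ 3} with hS₁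
  set S₂ : Set Phase := {p | ‖(Z t p).2 - V₀‖ < (5 * w ^ 3) ^ 3} with hS₂
  set S₃ : Set Phase := {p | ‖x t - (Z t p).1‖ < (level K₁ ξ η Z t p ^ 2)⁻¹} with hS₃
  have m1 : MeasurableSet S₁ := measurableSet_lt (by fun_prop) (by fun_prop)
  have m2 : MeasurableSet S₂ := measurableSet_lt (by fun_prop) (by fun_prop)
  have m3 : MeasurableSet S₃ := measurableSet_lt (by fun_prop) (by fun_prop)
  have hpt : ∀ p, k p ≤ S₁.indicator k p + (S₂.indicator k p + (S₃.indicator k p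
      + (restSet K₁ ξ η Z w x V₀).indicator
          (fun q => ENNReal.ofReal ((‖x q.1 - (Z q.1 q.2).1‖ ^ 2)⁻¹)) (t, p))) := fun p => by
    by_cases h1 : p ∈ S₁
    · rw [indicator_of_mem h1]
      exact le_self_add
    by_cases h2 : p ∈ S₂
    · rw [indicator_of_mem h2]
      exact le_add_left le_self_add
    by_cases h3 : p ∈ S₃
    · rw [indicator_of_mem h3]
      exact le_add_left (le_add_left le_self_add)
    have hR : (t, p) ∈ restSet K₁ ξ η Z w x V₀ := by
      have h1' : (8 * w ^ 3) ^ 3 ≤ ‖(Z t p).2‖ := by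
        have h1' : ¬ ‖(Z t p).2 - 0‖ < (8 * w ^ 3) ^ 3 := h1
        rwa [sub_zero, not_lt] at h1'
      have h2' : (5 * w ^ 3) ^ 3 ≤ ‖(Z t p).2 - V₀‖ :=
        not_lt.1 (show ¬ ‖(Z t p).2 - V₀‖ < (5 * w ^ 3) ^ 3 from h2)
      have hv := h.norm_vel_le ht p
      have hw9 : 0 < w ^ 9 := by positivity
      refine ⟨?_, ?_, not_lt.1 (show ¬ ‖x t - (Z t p).1‖ < (level K₁ ξ η Z t p ^ 2)⁻¹ from h3)⟩
      · have e : (8 * w ^ 3) ^ 3 = 512 * w ^ 9 := by ring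
        change 250 * w ^ 9 ≤ level K₁ ξ η Z t p
        linarith
      · have e : (5 * w ^ 3) ^ 3 = 125 * w ^ 9 := by ring
        change 125 * w ^ 9 ≤ ‖(Z t p).2 - V₀‖
        linarith
    rw [indicator_of_mem hR]
    exact le_add_left (le_add_left le_add_self)
  have b1 : ∫⁻ p in S₁, k p ∂μ ≤ ENNReal.ofReal (staticConst M H * (8 * w ^ 3) ^ 4) :=
    h.lintegral_slow_le ht (by positivity) (x t) 0
  have b2 : ∫⁻ p in S₂, k p ∂μ ≤ ENNReal.ofReal (staticConst M H * (5 * w ^ 3) ^ 4) :=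
    h.lintegral_slow_le ht (by positivity) (x t) V₀
  have b3 : ∫⁻ p in S₃, k p ∂μ ≤ ENNReal.ofReal (M * (4 * sphereArea ^ 2 * w ^ 12)) :=
    h.lintegral_near_le ht (x t)
  calc _ ≤ ∫⁻ p, (S₁.indicator k p + (S₂.indicator k p + (S₃.indicator k p
      + (restSet K₁ ξ η Z w x V₀).indicator
          (fun q => ENNReal.ofReal ((‖x q.1 - (Z q.1 q.2).1‖ ^ 2)⁻¹)) (t, p)))) ∂μ :=
        lintegral_mono hpt
    _ = (∫⁻ p in S₁, k p ∂μ) + ((∫⁻ p in S₂, k p ∂μ) + ((∫⁻ p in S₃, k p ∂μ)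
      + ∫⁻ p, (restSet K₁ ξ η Z w x V₀).indicator
          (fun q => ENNReal.ofReal ((‖x q.1 - (Z q.1 q.2).1‖ ^ 2)⁻¹)) (t, p) ∂μ)) := by
        rw [lintegral_add_left (hkm.indicator m1), lintegral_add_left (hkm.indicator m2),
          lintegral_add_left (hkm.indicator m3), lintegral_indicator m1, lintegral_indicator m2,
          lintegral_indicator m3]
    _ ≤ ENNReal.ofReal (staticConst M H * (8 * w ^ 3) ^ 4)
      + (ENNReal.ofReal (staticConst M H * (5 * w ^ 3) ^ 4)
        + (ENNReal.ofReal (M * (4 * sphereArea ^ 2 * w ^ 12))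
      + ∫⁻ p, (restSet K₁ ξ η Z w x V₀).indicator
          (fun q => ENNReal.ofReal ((‖x q.1 - (Z q.1 q.2).1‖ ^ 2)⁻¹)) (t, p) ∂μ)) := by gcongr
    _ = _ := by
        rw [← add_assoc, ← add_assoc, ← ENNReal.ofReal_add (by positivity) (by positivity),
          ← ENNReal.ofReal_add (by positivity) (by positivity)]
        congr 2
        ring

/-- Bound for the time integral of the field along an almost straight path. -/
def pathConst (M : ℝ≥0) (H K₁ : ℝ) : ℝ :=
  591 * staticConst M H + M * sphereArea ^ 2 + 100 * (2 * H + K₁)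

lemma pathConst_nonneg (h : LevelFlow T M A μ ξ η Z H K₁ w) {t : ℝ} (ht : t ∈ Icc 0 T) :
    0 ≤ pathConst M H K₁ := by
  have h1 := h.staticConst_nonneg ht
  have h2 := h.energy_nonneg ht
  have h3 := h.one_le
  unfold pathConst
  positivity

/-- The terms of order `Q` are multiplied by a time `1 / (8 Q)`. For the rest, Tonelli puts the time
integral inside, where each particle costs `100` times its value of `h` at time `a`, and the second
moment of `√h` concludes. -/
lemma lintegral_absField_le (h : LevelFlow T M A μ ξ η Z H K₁ w) (hw : IsLargeScale M H K₁ w)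
    (ha : 0 ≤ a) (hab : a ≤ b) (hb : b ≤ T) (hlen : b - a ≤ 1 / (8 * w ^ 12))
    (hac : a ≤ c) (hdb : d ≤ b) (hxm : Measurable x)
    (hx : ∀ t ∈ Icc c d, HasDerivWithinAt x (x' t) (Icc c d) t)
    (hx' : ∀ t ∈ Icc c d, ‖x' t - V₀‖ ≤ 4 * w ^ 9) :
    ∫⁻ t in Icc c d, CharFlow.absField μ (Z t) (x t) ≤ ENNReal.ofReal (pathConst M H K₁) := by
  have := h.prob
  have hw0 : 0 < w := zero_lt_one.trans_le h.scale
  have hsub : Icc c d ⊆ Icc 0 T := Icc_subset_Icc (ha.trans hac) (hdb.trans hb)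
  have haT : a ∈ Icc 0 T := ⟨ha, hab.trans hb⟩
  have hC := h.staticConst_nonneg haT
  have hH := h.energy_nonneg haT
  have hK := h.one_le
  have hZ := h.measurable
  set G : ℝ × Phase → ℝ≥0∞ := (restSet K₁ ξ η Z w x V₀).indicator
    (fun q => ENNReal.ofReal ((‖x q.1 - (Z q.1 q.2).1‖ ^ 2)⁻¹)) with hG
  have hGm : Measurable G := by
    refine Measurable.indicator ?_ (h.measurableSet_restSet hxm)
    fun_prop
  set B := (4721 * staticConst M H + M * (4 * sphereArea ^ 2)) * w ^ 12 with hB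
  have hrest : ∫⁻ t in Icc c d, ∫⁻ p, G (t, p) ∂μ ≤ ENNReal.ofReal (100 * (2 * H + K₁)) := by
    rw [lintegral_lintegral_swap (f := fun t p => G (t, p)) hGm.aemeasurable]
    calc _ ≤ ∫⁻ p, ENNReal.ofReal 100 * ENNReal.ofReal (level K₁ ξ η Z a p ^ 2) ∂μ := by
          refine lintegral_mono_ae ?_
          filter_upwards [h.null] with p hp
          rw [← ENNReal.ofReal_mul (by norm_num)]
          exact h.lintegral_rest_le hw ha hab hb hlen hp hac hdb hx hx'
      _ = ENNReal.ofReal 100 * ∫⁻ p, ENNReal.ofReal (level K₁ ξ η Z a p ^ 2) ∂μ :=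
          lintegral_const_mul' _ _ ENNReal.ofReal_ne_top
      _ ≤ ENNReal.ofReal 100 * ENNReal.ofReal (2 * H + K₁) := by
          gcongr
          exact h.lintegral_level_sq_le haT
      _ = _ := (ENNReal.ofReal_mul (by norm_num)).symm
  have hconst : ∫⁻ _ in Icc c d, ENNReal.ofReal B
      ≤ ENNReal.ofReal (591 * staticConst M H + M * sphereArea ^ 2) := by
    rw [setLIntegral_const, Real.volume_Icc, ← ENNReal.ofReal_mul (by positivity)]
    apply ENNReal.ofReal_le_ofReal
    calc _ ≤ B * (1 / (8 * w ^ 12)) := by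
          gcongr
          linarith
      _ = (4721 * staticConst M H + M * (4 * sphereArea ^ 2)) / 8 := by rw [hB]; field_simp
      _ ≤ _ := by
          have : 0 ≤ M * sphereArea ^ 2 := by positivity
          linarith
  calc _ ≤ ∫⁻ t in Icc c d, (ENNReal.ofReal B + ∫⁻ p, G (t, p) ∂μ) :=
        setLIntegral_mono' measurableSet_Icc fun t ht =>
          h.absField_le_add_rest (V₀ := V₀) (hsub ht)
    _ = (∫⁻ _ in Icc c d, ENNReal.ofReal B) + ∫⁻ t in Icc c d, ∫⁻ p, G (t, p) ∂μ :=
        lintegral_add_left measurable_const _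
    _ ≤ ENNReal.ofReal (591 * staticConst M H + M * sphereArea ^ 2)
        + ENNReal.ofReal (100 * (2 * H + K₁)) := add_le_add hconst hrest
    _ = _ := (ENNReal.ofReal_add (by positivity) (by positivity)).symm

end LevelFlow

namespace LevelFlow

/-! ### Growth of `√h` on a short time interval -/

variable {T : ℝ} {M : ℝ≥0} {A : Set Phase} {μ : Measure Phase} {ξ η : ℝ → Space}
  {Z : ℝ → Phase → Phase} {H K₁ w a b : ℝ} {p : Phase}

/-- The speed of the charge is bounded by the energy, so its path is admissible with `V₀ = 0`. -/
lemma lintegral_absField_charge_le (h : LevelFlow T M A μ ξ η Z H K₁ w)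
    (hw : IsLargeScale M H K₁ w) (ha : 0 ≤ a) (hab : a ≤ b) (hb : b ≤ T)
    (hlen : b - a ≤ 1 / (8 * w ^ 12)) :
    ∫⁻ t in Icc a b, CharFlow.absField μ (Z t) (ξ t) ≤ ENNReal.ofReal (pathConst M H K₁) := by
  have hsub : Icc a b ⊆ Icc 0 T := Icc_subset_Icc ha hb
  have hw0 : 0 < w := zero_lt_one.trans_le h.scale
  refine h.lintegral_absField_le hw ha hab hb hlen le_rfl le_rfl h.measurable_charge.1 (V₀ := 0)
    (fun t ht => (h.charge_pos t (hsub ht)).mono hsub) fun t ht => ?_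
  have h1 := h.norm_charge_vel_le (hsub ht)
  have h2 := hw.shift_le
  have h3 := h.staticConst_nonneg (hsub ht)
  have h4 : 0 ≤ 32 * staticConst M H * w ^ 16 := by positivity
  have h5 : 0 ≤ w ^ 18 := by positivity
  rw [sub_zero]
  refine le_of_sq_le_sq ?_ (by positivity)
  rw [show (4 * w ^ 9) ^ 2 = 16 * w ^ 18 by ring]
  linarith

/-- A particle with initial `√h` below `w ^ 9` is slow and `V₀ = 0` works. A faster one is treated
on both sides of its encounter with the charge, with `V₀` its velocity at the corresponding end of
the interval; the encounter lasts at most `2 w ^ (-18)` and costs little even with the field bound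
of order `w ^ 16`. -/
lemma lintegral_absField_self_le (h : LevelFlow T M A μ ξ η Z H K₁ w)
    (hw : IsLargeScale M H K₁ w) (ha : 0 ≤ a) (hab : a ≤ b) (hb : b ≤ T)
    (hlen : b - a ≤ 1 / (8 * w ^ 12)) (hp : p ∈ A) :
    ∫⁻ t in Icc a b, CharFlow.absField μ (Z t) (Z t p).1
      ≤ ENNReal.ofReal (2 * pathConst M H K₁ + 32 * staticConst M H) := by
  have hsub : Icc a b ⊆ Icc 0 T := Icc_subset_Icc ha hb
  have haT : a ∈ Icc 0 T := hsub (left_mem_Icc.2 hab)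
  have hw0 : 0 < w := zero_lt_one.trans_le h.scale
  have hw9 : 0 < w ^ 9 := by positivity
  have hC := h.staticConst_nonneg haT
  have hP := h.pathConst_nonneg haT
  have hZ := h.measurable
  have hxm : Measurable fun t => (Z t p).1 := by
    have : Measurable fun t : ℝ => ((t, p) : ℝ × Phase) := by fun_prop
    exact (hZ.comp this).fst
  by_cases hu : w ^ 9 ≤ level K₁ ξ η Z a p
  · obtain ⟨m, -, hm⟩ := h.exists_nearest_time hw ha hab hb hlen hp hu
    set u := level K₁ ξ η Z a p with hu_def
    have hu0 : 0 < u := hw9.trans_le hu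
    set θ := (u ^ 2)⁻¹ with hθ
    set F : ℝ → ℝ≥0∞ := fun t => CharFlow.absField μ (Z t) (Z t p).1 with hF
    have hcover : Icc a b ⊆ (Icc a (min b (m - θ)) ∪ Icc a b ∩ Icc (m - θ) (m + θ))
        ∪ Icc (max a (m + θ)) b := by
      intro t ht
      rcases le_total t (m - θ) with h1 | h1
      · exact .inl (.inl ⟨ht.1, le_min ht.2 h1⟩)
      · rcases le_total t (m + θ) with h2 | h2
        · exact .inl (.inr ⟨ht, h1, h2⟩)
        · exact .inr ⟨max_le ht.1 h2, ht.2⟩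
    have hleft : ∫⁻ t in Icc a (min b (m - θ)), F t ≤ ENNReal.ofReal (pathConst M H K₁) := by
      have hs : Icc a (min b (m - θ)) ⊆ Icc 0 T := Icc_subset_Icc ha ((min_le_left _ _).trans hb)
      refine h.lintegral_absField_le hw ha hab hb hlen le_rfl (min_le_left _ _) hxm
        (V₀ := (Z a p).2) (fun t ht => (h.pos p hp t (hs ht)).mono hs) fun t ht => ?_
      have := h.norm_vel_sub_le_of_side hw ha hb hlen hp hu0 hm le_rfl ht.1
        (ht.2.trans (min_le_left _ _)) (.inr (by linarith [ht.2.trans (min_le_right _ _)]))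
      linarith
    have hright : ∫⁻ t in Icc (max a (m + θ)) b, F t ≤ ENNReal.ofReal (pathConst M H K₁) := by
      have hs : Icc (max a (m + θ)) b ⊆ Icc 0 T := Icc_subset_Icc (ha.trans (le_max_left _ _)) hb
      refine h.lintegral_absField_le hw ha hab hb hlen (le_max_left _ _) le_rfl hxm
        (V₀ := (Z b p).2) (fun t ht => (h.pos p hp t (hs ht)).mono hs) fun t ht => ?_
      have := h.norm_vel_sub_le_of_side hw ha hb hlen hp hu0 hm ((le_max_left _ _).trans ht.1) ht.2
        le_rfl (.inl (by linarith [(le_max_right _ _).trans ht.1]))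
      rw [norm_sub_rev]
      linarith
    have hmid : ∫⁻ t in Icc a b ∩ Icc (m - θ) (m + θ), F t
        ≤ ENNReal.ofReal (32 * staticConst M H) := by
      calc _ ≤ ∫⁻ t in Icc a b ∩ Icc (m - θ) (m + θ),
            ENNReal.ofReal (16 * staticConst M H * w ^ 16) :=
            setLIntegral_mono' (measurableSet_Icc.inter measurableSet_Icc) fun t ht =>
              h.absField_le (hsub ht.1) _
        _ = ENNReal.ofReal (16 * staticConst M H * w ^ 16)
            * volume (Icc a b ∩ Icc (m - θ) (m + θ)) := setLIntegral_const _ _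
        _ ≤ ENNReal.ofReal (16 * staticConst M H * w ^ 16) * volume (Icc (m - θ) (m + θ)) := by
            gcongr
            exact inter_subset_right
        _ = ENNReal.ofReal (32 * staticConst M H * (w ^ 16 * θ)) := by
            rw [Real.volume_Icc, ← ENNReal.ofReal_mul (by positivity)]
            congr 1
            ring
        _ ≤ _ := by
            apply ENNReal.ofReal_le_ofReal
            have h1 : w ^ 16 * θ ≤ 1 := by
              rw [hθ, ← div_eq_mul_inv, div_le_one (by positivity)]
              calc w ^ 16 ≤ w ^ 18 := pow_le_pow_right₀ h.scale (by norm_num)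
                _ = (w ^ 9) ^ 2 := by ring
                _ ≤ u ^ 2 := by gcongr
            nlinarith
    calc _ ≤ ∫⁻ t in (Icc a (min b (m - θ)) ∪ Icc a b ∩ Icc (m - θ) (m + θ))
          ∪ Icc (max a (m + θ)) b, F t := lintegral_mono_set hcover
      _ ≤ _ := lintegral_union_le _ _ _
      _ ≤ _ := add_le_add_left (lintegral_union_le _ _ _) _
      _ ≤ (ENNReal.ofReal (pathConst M H K₁) + ENNReal.ofReal (32 * staticConst M H))
          + ENNReal.ofReal (pathConst M H K₁) := by gcongr
      _ = _ := by
          rw [← ENNReal.ofReal_add (by positivity) (by positivity),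
            ← ENNReal.ofReal_add (by positivity) (by positivity)]
          congr 1
          ring
  · refine (h.lintegral_absField_le hw ha hab hb hlen le_rfl le_rfl hxm (V₀ := 0)
      (fun t ht => (h.pos p hp t (hsub ht)).mono hsub) fun t ht => ?_).trans
      (ENNReal.ofReal_le_ofReal (by linarith))
    have h1 := abs_le.1 (h.abs_level_sub_le_half hw ha hb hlen hp ht)
    have h2 := h.norm_vel_le (hsub ht) p
    rw [sub_zero]
    linarith [h1.2]

lemma measurable_absField (h : LevelFlow T M A μ ξ η Z H K₁ w) {x : ℝ → Space}
    (hx : Measurable x) : Measurable fun t => CharFlow.absField μ (Z t) (x t) := by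
  have := h.prob
  have hZ := h.measurable
  have hm : Measurable fun q : ℝ × Phase =>
      ENNReal.ofReal ((‖x q.1 - (Z q.1 q.2).1‖ ^ 2)⁻¹) := by fun_prop
  exact hm.lintegral_prod_right'

lemma level_sub_le_of_isLargeScale (h : LevelFlow T M A μ ξ η Z H K₁ w)
    (hw : IsLargeScale M H K₁ w) (ha : 0 ≤ a) (hab : a ≤ b) (hb : b ≤ T)
    (hlen : b - a ≤ 1 / (8 * w ^ 12)) (hp : p ∈ A) :
    level K₁ ξ η Z b p - level K₁ ξ η Z a p
      ≤ 3 * pathConst M H K₁ + 32 * staticConst M H := by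
  have hsub : Icc a b ⊆ Icc 0 T := Icc_subset_Icc ha hb
  have haT : a ∈ Icc 0 T := hsub (left_mem_Icc.2 hab)
  have hC := h.staticConst_nonneg haT
  have hP := h.pathConst_nonneg haT
  set g' : ℝ → ℝ := fun t => inner ℝ ((Z t p).2 - η t)
    (selfField μ (Z t) (Z t p).1 - selfField μ (Z t) (ξ t)) / (2 * level K₁ ξ η Z t p) with hg'
  have hftc := integral_eq_sub_of_hasDerivWithinAt (g := fun t => level K₁ ξ η Z t p) (g' := g')
    (C := 32 * staticConst M H * w ^ 16) hab
    (fun t ht => (h.hasDerivWithinAt_level (hsub ht) hp).mono hsub)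
    (.of_forall fun t ht => (h.abs_deriv_level_le t p).trans (by
      have h1 := h.norm_selfField_le (hsub ht) (Z t p).1
      have h2 := h.norm_selfField_le (hsub ht) (ξ t)
      linarith))
  have hbd : ‖level K₁ ξ η Z b p - level K₁ ξ η Z a p‖ₑ
      ≤ ENNReal.ofReal (3 * pathConst M H K₁ + 32 * staticConst M H) := by
    rw [← hftc, intervalIntegral.integral_of_le hab]
    calc _ ≤ ∫⁻ t in Ioc a b, ‖g' t‖ₑ := enorm_integral_le_lintegral_enorm _
      _ ≤ ∫⁻ t in Icc a b, ‖g' t‖ₑ := lintegral_mono_set Ioc_subset_Icc_self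
      _ ≤ ∫⁻ t in Icc a b, (CharFlow.absField μ (Z t) (ξ t)
          + CharFlow.absField μ (Z t) (Z t p).1) := by
          refine lintegral_mono fun t => ?_
          have h1 := h.abs_deriv_level_le t p
          rw [← ofReal_norm]
          refine (ENNReal.ofReal_le_ofReal h1).trans ?_
          rw [ENNReal.ofReal_add (norm_nonneg _) (norm_nonneg _), ofReal_norm, ofReal_norm,
            add_comm]
          exact add_le_add (CharFlow.enorm_selfField_le _ _ _) (CharFlow.enorm_selfField_le _ _ _)
      _ = (∫⁻ t in Icc a b, CharFlow.absField μ (Z t) (ξ t))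
          + ∫⁻ t in Icc a b, CharFlow.absField μ (Z t) (Z t p).1 :=
          lintegral_add_left (h.measurable_absField h.measurable_charge.1) _
      _ ≤ ENNReal.ofReal (pathConst M H K₁)
          + ENNReal.ofReal (2 * pathConst M H K₁ + 32 * staticConst M H) :=
          add_le_add (h.lintegral_absField_charge_le hw ha hab hb hlen)
            (h.lintegral_absField_self_le hw ha hab hb hlen hp)
      _ = _ := by
          rw [← ENNReal.ofReal_add (by positivity) (by positivity)]
          congr 1
          ring
  rw [← ofReal_norm, ENNReal.ofReal_le_ofReal_iff (by positivity)] at hbd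
  exact (le_abs_self _).trans hbd

/-- The increase of `√h` on a time interval of length at most `1 / (8 Q)` is bounded in terms of
`M`, `H` and `K₁` only. -/
theorem exists_level_le_add (M : ℝ≥0) (H K₁ : ℝ) : ∃ C, 0 < C ∧
    ∀ {T : ℝ} {A : Set Phase} {μ : Measure Phase} {ξ η : ℝ → Space} {Z : ℝ → Phase → Phase}
      {w : ℝ}, LevelFlow T M A μ ξ η Z H K₁ w → ∀ {a b : ℝ}, 0 ≤ a → a ≤ b → b ≤ T →
      b - a ≤ 1 / (8 * w ^ 12) → ∀ p ∈ A, level K₁ ξ η Z b p ≤ level K₁ ξ η Z a p + C := by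
  obtain ⟨w₀, hw₀⟩ := exists_isLargeScale M H K₁
  refine ⟨1 + |3 * pathConst M H K₁ + 32 * staticConst M H| + 4 * |staticConst M H| * |w₀| ^ 4,
    by positivity, ?_⟩
  intro T A μ ξ η Z w h a b ha hab hb hlen p hp
  have h1 := le_abs_self (3 * pathConst M H K₁ + 32 * staticConst M H)
  have h2 := abs_nonneg (3 * pathConst M H K₁ + 32 * staticConst M H)
  have h3 : 0 ≤ 4 * |staticConst M H| * |w₀| ^ 4 := by positivity
  -- Below the threshold `w₀`, which depends only on `M`, `H` and `K₁`, the crude growth bound `O(w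
  -- ^ 4)` is already a constant.
  rcases le_total w₀ w with hw | hw
  · linarith [h.level_sub_le_of_isLargeScale (hw₀ w hw) ha hab hb hlen hp]
  · have h4 := h.abs_level_sub_le (a := a) (b := b) ⟨ha, hab.trans hb⟩ ⟨ha.trans hab, hb⟩
      (by rwa [abs_of_nonneg (sub_nonneg.2 hab)]) hp
    have h5 : 4 * staticConst M H * w ^ 4 ≤ 4 * |staticConst M H| * |w₀| ^ 4 := by
      have hw0 : 0 ≤ w := zero_le_one.trans h.scale
      gcongr
      · exact le_abs_self _
      · exact hw.trans (le_abs_self _)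
    linarith [(le_abs_self _).trans h4]

end LevelFlow

/-! ### Time steps of a solution -/

/-- The factor two is caused by the last step: when `n` is the floor, it extends from `(n - 1) ΔT`
to `T` and may be almost twice as long as the others. -/
lemma gridTime_bounds {T ΔT : ℝ} (hΔ : 0 < ΔT) {n i : ℕ}
    (hn : n = ⌊T / ΔT⌋₊ ∨ n = ⌈T / ΔT⌉₊) (hT : 0 < T) (hi : i < n) :
    0 ≤ gridTime T ΔT n i ∧ gridTime T ΔT n i < gridTime T ΔT n (i + 1) ∧
      gridTime T ΔT n (i + 1) ≤ T ∧ gridTime T ΔT n (i + 1) - gridTime T ΔT n i ≤ 2 * ΔT := by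
  have hq : 0 < T / ΔT := div_pos hT hΔ
  have hbd : ((n : ℝ) - 1) * ΔT < T ∧ T < (n + 1) * ΔT := by
    rw [← lt_div_iff₀ hΔ, ← div_lt_iff₀ hΔ]
    rcases hn with rfl | rfl
    · exact ⟨by linarith [Nat.floor_le hq.le], Nat.lt_floor_add_one _⟩
    · exact ⟨by linarith [Nat.ceil_lt_add_one hq.le], by linarith [Nat.le_ceil (T / ΔT)]⟩
  have hi' : gridTime T ΔT n i = i * ΔT := if_pos hi
  have hiR : (i : ℝ) + 1 ≤ n := by exact_mod_cast hi
  rw [hi']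
  refine ⟨by positivity, ?_⟩
  by_cases hlt : i + 1 < n
  · have e : gridTime T ΔT n (i + 1) = (i + 1) * ΔT := by
      rw [gridTime, if_pos hlt]
      push_cast
      rfl
    have h2 : (i : ℝ) + 1 + 1 ≤ n := by exact_mod_cast hlt
    rw [e]
    refine ⟨by linarith, ?_, by linarith⟩
    nlinarith [hbd.1]
  · have e : gridTime T ΔT n (i + 1) = T := if_neg hlt
    have h2 : (n : ℝ) = i + 1 := by exact_mod_cast (by omega : n = i + 1)
    rw [e]
    rw [h2] at hbd
    exact ⟨by linarith [hbd.1], le_rfl, by linarith [hbd.2]⟩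

variable {T M K₁ : ℝ} {f₀ : Phase → ℝ} {ξ₀ η₀ : Space} {ξ η : ℝ → Space} {f : ℝ → Phase → ℝ}
  {Φ : ℝ → ℝ → Phase → Phase}

lemma IsInitialDatum.nonempty_tsupport (hd : IsInitialDatum f₀ ξ₀) : (tsupport f₀).Nonempty := by
  rw [nonempty_iff_ne_empty, Ne, tsupport_eq_empty_iff]
  rintro rfl
  have := hd.density.integral_eq_one
  simp at this

/-- The value of `√h` at time `t` on the characteristic issued at time `0` from `p`. -/
def solutionLevel (K₁ T : ℝ) (f₀ : Phase → ℝ) (ξ η : ℝ → Space) (Φ : ℝ → ℝ → Phase → Phase) :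
    ℝ → Phase → ℝ :=
  level K₁ ((Icc 0 T).indicator ξ) ((Icc 0 T).indicator η) (labelFlow T f₀ Φ)

lemma solutionLevel_eq {t : ℝ} (ht : t ∈ Icc 0 T) {p : Phase} (hp : p ∈ tsupport f₀) :
    solutionLevel K₁ T f₀ ξ η Φ t p = √(particleEnergy K₁ ξ η (Φ 0 t p) t) := by
  rw [solutionLevel, level, labelFlow_eq ht hp, particleEnergy, particleEnergy,
    indicator_of_mem ht, indicator_of_mem ht]

/-- By the group property of the flow and the transport of supports, trajectories restarted at `τ`
are those issued at time zero, so all suprema run over the same labels. -/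
lemma IsSolution.energyValues_eq (hT : 0 < T) (hd : IsInitialDatum f₀ ξ₀)
    (hs : IsSolution T f₀ ξ₀ η₀ ξ η f Φ) {τ : ℝ} (hτ : τ ∈ Icc 0 T) {I : Set ℝ}
    (hI : I ⊆ Icc 0 T) :
    energyValues K₁ ξ η Φ τ (tsupport (f τ)) I
      = {r | ∃ t ∈ I, ∃ p ∈ tsupport f₀, r = solutionLevel K₁ T f₀ ξ η Φ t p} := by
  have h0 : (0 : ℝ) ∈ Icc 0 T := ⟨le_rfl, hT.le⟩
  have hdom := hs.support_subset_domain hT hd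
  rw [energyValues, hs.support_eq hT hd hτ]
  ext r
  constructor
  · rintro ⟨t, ht, _, ⟨p, hp, rfl⟩, rfl⟩
    exact ⟨t, ht, p, hp, by
      rw [hs.flow_comp 0 h0 τ hτ t (hI ht) p (hdom hp), solutionLevel_eq (hI ht) hp]⟩
  · rintro ⟨t, ht, p, hp, rfl⟩
    exact ⟨t, ht, _, ⟨p, hp, rfl⟩, by
      rw [hs.flow_comp 0 h0 τ hτ t (hI ht) p (hdom hp), solutionLevel_eq (hI ht) hp]⟩

lemma IsSolution.bddAbove_energyValues (hT : 0 < T) (hd : IsInitialDatum f₀ ξ₀)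
    (hs : IsSolution T f₀ ξ₀ η₀ ξ η f Φ) (K₁ : ℝ) :
    BddAbove (energyValues K₁ ξ η Φ 0 (tsupport f₀) (Icc 0 T)) := by
  obtain ⟨δ, P, -, hδ, hP, -, hb, -⟩ := hs.exists_speed_bound hT hd
  have hc : ContinuousOn η (Icc 0 T) := fun t ht => (hs.charge_vel t ht).continuousWithinAt
  obtain ⟨B, hB⟩ := (isCompact_Icc.image_of_continuousOn hc).isBounded.exists_norm_le
  refine ⟨√((P + B) ^ 2 / 2 + 1 / δ + K₁), ?_⟩
  rintro _ ⟨t, ht, p, hp, rfl⟩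
  apply Real.sqrt_le_sqrt
  have h1 := hb t ht p hp
  have h2 := hB _ ⟨t, ht, rfl⟩
  have h3 : ‖(Φ 0 t p).2 - η t‖ ≤ P + B := (norm_sub_le _ _).trans (add_le_add h1.2 h2)
  have h4 : 1 / ‖(Φ 0 t p).1 - ξ t‖ ≤ 1 / δ := one_div_le_one_div_of_le hδ h1.1
  unfold particleEnergy
  gcongr

lemma IsSolution.solutionLevel_le (hT : 0 < T) (hd : IsInitialDatum f₀ ξ₀)
    (hs : IsSolution T f₀ ξ₀ η₀ ξ η f Φ) {t : ℝ} (ht : t ∈ Icc 0 T) {p : Phase}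
    (hp : p ∈ tsupport f₀) :
    solutionLevel K₁ T f₀ ξ η Φ t p ≤ maxEnergy K₁ T f₀ ξ η Φ :=
  le_csSup (hs.bddAbove_energyValues hT hd K₁) ⟨t, ht, p, hp, solutionLevel_eq ht hp⟩

lemma IsSolution.one_le_maxEnergy (hT : 0 < T) (hd : IsInitialDatum f₀ ξ₀)
    (hs : IsSolution T f₀ ξ₀ η₀ ξ η f Φ) (hK : 1 ≤ K₁) : 1 ≤ maxEnergy K₁ T f₀ ξ η Φ := by
  have h0 : (0 : ℝ) ∈ Icc 0 T := ⟨le_rfl, hT.le⟩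
  obtain ⟨p, hp⟩ := hd.nonempty_tsupport
  refine le_trans ?_ (hs.solutionLevel_le hT hd h0 hp)
  rw [solutionLevel_eq h0 hp, Real.one_le_sqrt, particleEnergy]
  have : 0 ≤ ‖(Φ 0 0 p).2 - η 0‖ ^ 2 / 2 + 1 / ‖(Φ 0 0 p).1 - ξ 0‖ := by positivity
  linarith

lemma IsSolution.levelFlow (hT : 0 < T) (hd : IsInitialDatum f₀ ξ₀)
    (hs : IsSolution T f₀ ξ₀ η₀ ξ η f Φ) (hM : eLpNorm f₀ ⊤ volume = ENNReal.ofReal M)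
    (hK : max (8 * totalEnergy f₀ ξ₀ η₀) 1 ≤ K₁) {w : ℝ} (hw : 1 ≤ w)
    (hwQ : maxEnergy K₁ T f₀ ξ η Φ = w ^ 12) :
    LevelFlow T M.toNNReal (tsupport f₀) (labelMeasure f₀) ((Icc 0 T).indicator ξ)
      ((Icc 0 T).indicator η) (labelFlow T f₀ Φ) (totalEnergy f₀ ξ₀ η₀) K₁ w where
  toCharFlow := hs.charFlow hT hd hM
  energy _ ht := hs.energy_le hT hd hM ht
  one_le := (le_max_right _ _).trans hK
  energy_le_shift := (le_max_left _ _).trans hK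
  scale := hw
  level_le _ ht _ hp := (hs.solutionLevel_le hT hd ht hp).trans_eq hwQ

/-- The growth of `√h` on a time interval of length at most `1 / (8 Q)`. -/
lemma exists_solutionLevel_le_add (M H K₁ : ℝ) (hK : max (8 * H) 1 ≤ K₁) : ∃ C, 0 < C ∧
    ∀ {T : ℝ} {f₀ : Phase → ℝ} {ξ₀ η₀ : Space} {ξ η : ℝ → Space} {f : ℝ → Phase → ℝ}
      {Φ : ℝ → ℝ → Phase → Phase}, 0 < T → IsInitialDatum f₀ ξ₀ →
      eLpNorm f₀ ⊤ volume = ENNReal.ofReal M → totalEnergy f₀ ξ₀ η₀ = H →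
      IsSolution T f₀ ξ₀ η₀ ξ η f Φ →
      (∀ p ∈ tsupport f₀, ContinuousOn (fun t => solutionLevel K₁ T f₀ ξ η Φ t p) (Icc 0 T)) ∧
      ∀ {a b : ℝ}, 0 ≤ a → a ≤ b → b ≤ T → b - a ≤ 1 / (8 * maxEnergy K₁ T f₀ ξ η Φ) →
        ∀ p ∈ tsupport f₀,
          solutionLevel K₁ T f₀ ξ η Φ b p ≤ solutionLevel K₁ T f₀ ξ η Φ a p + C := by
  obtain ⟨C, hC, hstep⟩ := LevelFlow.exists_level_le_add M.toNNReal H K₁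
  refine ⟨C, hC, ?_⟩
  intro T f₀ ξ₀ η₀ ξ η f Φ hT hd hM hH hs
  have hQ := hs.one_le_maxEnergy hT hd ((le_max_right _ _).trans hK)
  set Q := maxEnergy K₁ T f₀ ξ η Φ with hQdef
  have hwQ : Q = (Q ^ (1 / 12 : ℝ)) ^ 12 := by
    rw [← Real.rpow_natCast, ← Real.rpow_mul (by linarith)]
    norm_num
  have hF := hs.levelFlow hT hd hM (by rwa [hH]) (Real.one_le_rpow hQ (by norm_num)) hwQ
  rw [hH] at hF
  refine ⟨fun p hp t ht => (hF.hasDerivWithinAt_level ht hp).continuousWithinAt, ?_⟩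
  intro a b ha hab hb hlen p hp
  exact hstep hF ha hab hb (by rwa [← hwQ]) p hp

lemma IsSolution.stepEnergy_succ_eq (hT : 0 < T) (hd : IsInitialDatum f₀ ξ₀)
    (hs : IsSolution T f₀ ξ₀ η₀ ξ η f Φ) {ΔT : ℝ} (hΔ : 0 < ΔT) {n i : ℕ}
    (hn : n = ⌊T / ΔT⌋₊ ∨ n = ⌈T / ΔT⌉₊) (hi : i < n) :
    stepEnergy K₁ T ΔT n f₀ ξ η f Φ (i + 1)
      = sSup {r | ∃ t ∈ Ioo (gridTime T ΔT n i) (gridTime T ΔT n (i + 1)), ∃ p ∈ tsupport f₀,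
        r = solutionLevel K₁ T f₀ ξ η Φ t p} := by
  obtain ⟨h1, h2, h3, -⟩ := gridTime_bounds hΔ hn hT hi
  rw [stepEnergy, hs.energyValues_eq hT hd ⟨h1, h2.le.trans h3⟩
    (Ioo_subset_Icc_self.trans (Icc_subset_Icc h1 h3))]

/-- For `i ≥ 1` the supremum is over an open time interval, and the value at its right end is
recovered by continuity in time; for `i = 0` it is a supremum at time zero itself. -/
lemma IsSolution.solutionLevel_le_stepEnergy (hT : 0 < T) (hd : IsInitialDatum f₀ ξ₀)
    (hs : IsSolution T f₀ ξ₀ η₀ ξ η f Φ)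
    (hc : ∀ p ∈ tsupport f₀, ContinuousOn (fun t => solutionLevel K₁ T f₀ ξ η Φ t p) (Icc 0 T))
    {ΔT : ℝ} (hΔ : 0 < ΔT) {n i : ℕ} (hn : n = ⌊T / ΔT⌋₊ ∨ n = ⌈T / ΔT⌉₊) (hi : i < n)
    {p : Phase} (hp : p ∈ tsupport f₀) :
    solutionLevel K₁ T f₀ ξ η Φ (gridTime T ΔT n i) p ≤ stepEnergy K₁ T ΔT n f₀ ξ η f Φ i := by
  have h0 : (0 : ℝ) ∈ Icc 0 T := ⟨le_rfl, hT.le⟩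
  have hdom := hs.support_subset_domain hT hd
  cases i with
  | zero =>
    have e : gridTime T ΔT n 0 = 0 := by rw [gridTime, if_pos hi, Nat.cast_zero, zero_mul]
    rw [e, stepEnergy]
    refine le_csSup ⟨maxEnergy K₁ T f₀ ξ η Φ, ?_⟩ ⟨p, hp, ?_⟩
    · rintro _ ⟨q, hq, rfl⟩
      have := hs.solutionLevel_le (K₁ := K₁) hT hd h0 hq
      rwa [solutionLevel_eq h0 hq, hs.flow_self 0 h0 q (hdom hq)] at this
    · change √(particleEnergy K₁ ξ η p 0) = _
      rw [solutionLevel_eq h0 hp, hs.flow_self 0 h0 p (hdom hp)]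
  | succ j =>
    obtain ⟨h1, h2, h3, -⟩ := gridTime_bounds hΔ hn hT (Nat.lt_of_succ_lt hi)
    rw [hs.stepEnergy_succ_eq hT hd hΔ hn (Nat.lt_of_succ_lt hi)]
    set s := gridTime T ΔT n j
    set t := gridTime T ΔT n (j + 1)
    have hsub : Ioo s t ⊆ Icc 0 T := Ioo_subset_Icc_self.trans (Icc_subset_Icc h1 h3)
    have hlim := (hc p hp t ⟨h1.trans h2.le, h3⟩).mono hsub
    have := right_nhdsWithin_Ioo_neBot h2
    refine le_of_tendsto hlim ?_
    filter_upwards [self_mem_nhdsWithin] with r hr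
    refine le_csSup ⟨maxEnergy K₁ T f₀ ξ η Φ, ?_⟩ ⟨r, hr, p, hp, rfl⟩
    rintro _ ⟨t', ht', q, hq, rfl⟩
    exact hs.solutionLevel_le hT hd (hsub ht') hq

end PlasmaCharge

end

theorem mainTheorem4 (M H : ℝ) :
    ∃ K : ℝ, 0 < K ∧ IsFieldConstant M H K ∧
      ∀ K₁ K₂ : ℝ, max (8 * H) 1 ≤ K₁ → 16 ≤ K₂ → 8 * K / K₂ < 1 / 8 →
        ∃ C₂ : ℝ, 0 < C₂ ∧ ∀ (T : ℝ) (f₀ : Phase → ℝ) (ξ₀ η₀ : Space) (ξ η : ℝ → Space)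
          (f : ℝ → Phase → ℝ) (Φ : ℝ → ℝ → Phase → Phase),
          0 < T → IsInitialDatum f₀ ξ₀ →
          eLpNorm f₀ ⊤ volume = ENNReal.ofReal M → totalEnergy f₀ ξ₀ η₀ = H →
          IsSolution T f₀ ξ₀ η₀ ξ η f Φ →
          BddAbove (energyValues K₁ ξ η Φ 0 (tsupport f₀) (Icc 0 T)) ∧
          ∀ Q ΔT : ℝ, Q = maxEnergy K₁ T f₀ ξ η Φ → ΔT = 1 / (K₂ * Q) → ΔT < T →
            ∀ n : ℕ, n = ⌊T / ΔT⌋₊ ∨ n = ⌈T / ΔT⌉₊ →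
              ∀ i < n, stepEnergy K₁ T ΔT n f₀ ξ η f Φ (i + 1)
                ≤ stepEnergy K₁ T ΔT n f₀ ξ η f Φ i + C₂ * Q * ΔT := by
  obtain ⟨K, hK, hKM⟩ := exists_isFieldConstant M H
  refine ⟨K, hK, hKM, fun K₁ K₂ hK₁ hK₂ _ => ?_⟩
  obtain ⟨C, hC, hgrow⟩ := exists_solutionLevel_le_add M H K₁ hK₁
  -- Chosen so that `C₂ * Q * ΔT` is exactly the growth constant `C`.
  refine ⟨K₂ * C, by positivity, ?_⟩
  intro T f₀ ξ₀ η₀ ξ η f Φ hT hd hM hH hs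
  refine ⟨hs.bddAbove_energyValues hT hd K₁, ?_⟩
  intro Q ΔT hQ hΔ _ n hn i hi
  obtain ⟨hcont, hstep⟩ := hgrow hT hd hM hH hs
  have hQ1 : 1 ≤ Q := hQ ▸ hs.one_le_maxEnergy hT hd ((le_max_right _ _).trans hK₁)
  have hΔ0 : 0 < ΔT := by
    rw [hΔ]
    positivity
  have hC₂ : K₂ * C * Q * ΔT = C := by
    rw [hΔ]
    field_simp
  -- This is where `16 ≤ K₂` enters: even a double step is short enough for the growth estimate.
  have hlen : 2 * ΔT ≤ 1 / (8 * Q) := by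
    rw [hΔ, ← mul_div_assoc, mul_one, div_le_div_iff₀ (by positivity) (by positivity)]
    nlinarith
  obtain ⟨h1, h2, h3, h4⟩ := gridTime_bounds hΔ0 hn hT hi
  rw [hC₂, hs.stepEnergy_succ_eq hT hd hΔ0 hn hi]
  obtain ⟨q, hq⟩ := hd.nonempty_tsupport
  obtain ⟨r, hr⟩ := nonempty_Ioo.2 h2
  refine csSup_le ⟨_, r, hr, q, hq, rfl⟩ ?_
  rintro _ ⟨t, ht, p, hp, rfl⟩
  have h5 := hstep h1 ht.1.le (ht.2.le.trans h3) (by rw [← hQ]; linarith [ht.2]) p hp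
  have h6 := hs.solutionLevel_le_stepEnergy hT hd hcont hΔ0 hn hi hp
  linarith
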